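/- Let $\alpha\in\mathbb R$, $\beta\in\{-1,1\}$, $F>0$, $T>0$, let $\mathcal J=\begin{pmatrix}0&-1\\1&0\end{pmatrix}$ and $\mathcal N(\mathbf u)=|\mathbf u|^2\mathcal J\mathbf u$ for $\mathbf u\in\mathbb R^2$, and consider the Lugiato--Lefever system $$\mathbf u_t=\mathcal J(-\beta\mathbf u_{xx}-\alpha\mathbf u)-\mathbf u+\mathcal N(\mathbf u)+\begin{pmatrix}F\\0\end{pmatrix},\qquad \mathbf u(x,t)\in\mathbb R^2. \tag{1}$$ Let $\phi:\mathbb R\to\mathbb R^2$ be a smooth, nonconstant, $T$-periodic stationary solution of (1). For every $K>0$ there exists a constant $C>0$, depending only on $K$, $\phi$ and $\alpha,\beta,F,T$, such that the following holds. Let $\tau\in(0,\infty]$, $\mathbf w_0\in H^6_{\mathrm{per}}(0,T)$, $\mathbf v_0\in H^3(\mathbb R)$, and let * $\mathbf w\in C([0,\tau);H^6_{\mathrm{per}}(0,T))\cap C^1([0,\tau);H^4_{\mathrm{per}}(0,T))$ be a solution of (1) with $\mathbf w(0)=\phi+\mathbf w_0$; * $\mathbf v\in C([0,\tau);H^3(\mathbb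 R))\cap C^1([0,\tau);H^1(\mathbb R))$ be a solution of $$\mathbf v_t=\mathcal J(-\beta\mathbf v_{xx}-\alpha\mathbf v)-\mathbf v+\mathcal N(\mathbf v+\mathbf w)-\mathcal N(\mathbf w),\qquad \mathbf v(0)=\mathbf v_0;$$ * $\sigma:[0,\tau)\to\mathbb R$ be any function, and $\gamma\in C([0,\tau);H^5(\mathbb R))\cap C^1([0,\tau);H^3(\mathbb R))$ be any real-valued function with $\gamma(0)=0$. Set $\tilde{\mathbf w}(t)=\mathbf w(t)-\phi$, $\mathbf u=\mathbf w+\mathbf v$, $\hat{\mathbf w}(x,t)=\mathbf w(x-\sigma(t),t)-\phi(x)$, and define the forward-modulated perturbation $$\mathring{\mathbf v}(x,t)=\mathbf u(x,t)-\hat{\mathbf w}(x+\sigma(t)+\gamma(x,t),t)-\phi(x+\sigma(t)+\gamma(x,t))=\mathbf v(x,t)+\mathbf w(x,t)-\mathbf w(x+\gamma(x,t),t).$$ Then for every $t\in[0,\tau)$ with $$\sup_{0\le s\le t}\Bigl(\|\tilde{\mathbf w}(s)\|_{H^6_{\mathrm{per}}(0,T)}+\|\mathring{\mathbf v}(s)\|_{H^3}+\|(\gamma_x(s),\gamma_s(s))\|_{H^3\times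 H^2}\Bigr)\le K$$ we have $\mathring{\mathbf v}(t)\in H^3(\mathbb R)$, the integrand below is integrable on $[0,t]$, and $$\|\mathring{\mathbf v}(t)\|_{H^3}^2\le C\Bigl(e^{-t}\|\mathbf v_0\|_{H^3}^2+\|\mathring{\mathbf v}(t)\|_{L^2}^2+\int_0^t e^{-(t-s)}\bigl(\|\mathring{\mathbf v}(s)\|_{L^2}^2+\|\gamma_x(s)\|_{H^4}^2+\|\gamma_t(s)\|_{H^3}^2\bigr)\,ds\Bigr).$$ -/

import Mathlib

open MeasureTheory Set Filter Topology
open scoped ContDiff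

noncomputable section

namespace LLE

/-- The plane `ℝ²` with its Euclidean norm. -/
abbrev E2 := EuclideanSpace ℝ (Fin 2)

section Sobolev

variable {E : Type*} [NormedAddCommGroup E] [NormedSpace ℝ E]

/-- Local absolute continuity of `f, f', …, f^{(k-1)}`, in integral form: each of them is the
indefinite integral of the next derivative. The derivative `f^{(k)}` need only exist almost
everywhere (`iteratedDeriv` takes the value `0` where it does not). -/
def IterAbsCont (k : ℕ) (f : ℝ → E) : Prop :=
  ∀ j < k, ∀ a b : ℝ,
    IntervalIntegrable (iteratedDeriv (j + 1) f) volume a b ∧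
    iteratedDeriv j f b - iteratedDeriv j f a = ∫ x in a..b, iteratedDeriv (j + 1) f x

/-- The Sobolev space `H^k(ℝ; E)` on the line (for `k ≥ 1`: the continuous representatives of its
elements): `f, …, f^{(k-1)}` are locally absolutely continuous and `f, …, f^{(k)}` are square
integrable. In one dimension this is the space of `L²` functions with `k` weak derivatives
in `L²`, the almost everywhere derivatives being the weak ones. -/
def HSpace (k : ℕ) : Set (ℝ → E) :=
  {f | IterAbsCont k f ∧ ∀ j ≤ k, MemLp (iteratedDeriv j f) 2 volume}

/-- The norm of `H^k(ℝ; E)`; `hNorm 0` is the norm of `L²(ℝ; E)`. -/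
def hNorm (k : ℕ) (f : ℝ → E) : ℝ :=
  Real.sqrt (∑ j ∈ Finset.range (k + 1), ∫ x, ‖iteratedDeriv j f x‖ ^ 2)

/-- The Sobolev space `H^k_per(0, T)` of `T`-periodic functions (for `k ≥ 1`: the continuous
representatives of its elements). -/
def HPerSpace (T : ℝ) (k : ℕ) : Set (ℝ → E) :=
  {f | Function.Periodic f T ∧ IterAbsCont k f ∧
    ∀ j ≤ k, MemLp (iteratedDeriv j f) 2 (volume.restrict (Ioo 0 T))}

/-- The norm of `H^k_per(0, T)`. -/
def hPerNorm (T : ℝ) (k : ℕ) (f : ℝ → E) : ℝ :=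
  Real.sqrt (∑ j ∈ Finset.range (k + 1), ∫ x in Ioo 0 T, ‖iteratedDeriv j f x‖ ^ 2)

/-- `f ∈ C(I; X)` for a time set `I`, where `X` is the function space with underlying set `X`
and norm `nX`. -/
def ContCurve (X : Set (ℝ → E)) (nX : (ℝ → E) → ℝ) (I : Set ℝ) (f : ℝ → ℝ → E) : Prop :=
  ∀ t ∈ I, f t ∈ X ∧ Tendsto (fun s => nX (f s - f t)) (𝓝[I] t) (𝓝 0)

/-- `f ∈ C¹(I; X)` with time derivative `ft`, the derivative being the limit in `X` of the
difference quotients within `I` (one-sided at an endpoint of `I`). -/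
def C1Curve (X : Set (ℝ → E)) (nX : (ℝ → E) → ℝ) (I : Set ℝ) (f ft : ℝ → ℝ → E) : Prop :=
  ContCurve X nX I f ∧ ContCurve X nX I ft ∧
    ∀ t ∈ I, Tendsto (fun s => nX ((s - t)⁻¹ • (f s - f t) - ft t)) (𝓝[I \ {t}] t) (𝓝 0)

end Sobolev

/-- The matrix `𝒥 = (0 -1; 1 0)`. -/
def J (u : E2) : E2 := !₂[-u 1, u 0]

/-- The cubic nonlinearity `𝒩(u) = |u|² 𝒥 u`. -/
def cubic (u : E2) : E2 := ‖u‖ ^ 2 • J u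

/-- The linear operator `u ↦ 𝒥(-β u_xx - α u) - u`. -/
def linOp (α β : ℝ) (u : ℝ → E2) (x : ℝ) : E2 :=
  J (-β • iteratedDeriv 2 u x - α • u x) - u x

/-- `φ` is a smooth, nonconstant, `T`-periodic stationary solution of the Lugiato-Lefever system. -/
structure IsPeriodicWave (α β F T : ℝ) (φ : ℝ → E2) : Prop where
  smooth : ContDiff ℝ ∞ φ
  nonconstant : ∃ x y, φ x ≠ φ y
  periodic : Function.Periodic φ T
  stationary : ∀ x, linOp α β φ x + cubic (φ x) + !₂[F, 0] = 0

/-- The time interval `[0, τ)`, where `τ` may be `∞`. -/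
def timeInterval (τ : EReal) : Set ℝ := {t | 0 ≤ t ∧ (t : EReal) < τ}

/-- `w ∈ C([0,τ); H⁶_per(0,T)) ∩ C¹([0,τ); H⁴_per(0,T))` solves the Lugiato-Lefever system with
initial datum `φ + w₀`. -/
def IsPeriodicSolution (α β F T : ℝ) (τ : EReal) (φ w₀ : ℝ → E2) (w : ℝ → ℝ → E2) : Prop :=
  ContCurve (HPerSpace T 6) (hPerNorm T 6) (timeInterval τ) w ∧
  (∃ wt : ℝ → ℝ → E2,
    C1Curve (HPerSpace T 4) (hPerNorm T 4) (timeInterval τ) w wt ∧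
    ∀ t ∈ timeInterval τ, ∀ x,
      wt t x = linOp α β (w t) x + cubic (w t x) + !₂[F, 0]) ∧
  ∀ x, w 0 x = φ x + w₀ x

/-- `v ∈ C([0,τ); H³(ℝ)) ∩ C¹([0,τ); H¹(ℝ))` solves the equation for localized perturbations of
`w`, with initial datum `v₀`. -/
def IsLocalizedSolution (α β : ℝ) (τ : EReal) (w : ℝ → ℝ → E2) (v₀ : ℝ → E2)
    (v : ℝ → ℝ → E2) : Prop :=
  ContCurve (HSpace 3) (hNorm 3) (timeInterval τ) v ∧
  (∃ vt : ℝ → ℝ → E2,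
    C1Curve (HSpace 1) (hNorm 1) (timeInterval τ) v vt ∧
    ∀ t ∈ timeInterval τ, ∀ x,
      vt t x = linOp α β (v t) x + (cubic (v t x + w t x) - cubic (w t x))) ∧
  v 0 = v₀

/-- `γ ∈ C([0,τ); H⁵(ℝ)) ∩ C¹([0,τ); H³(ℝ))` is a phase modulation with `γ(0) = 0` and time
derivative `γt`. -/
def IsPhaseModulation (τ : EReal) (γ γt : ℝ → ℝ → ℝ) : Prop :=
  ContCurve (HSpace 5) (hNorm 5) (timeInterval τ) γ ∧
  C1Curve (HSpace 3) (hNorm 3) (timeInterval τ) γ γt ∧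
  γ 0 = 0

/-- The inverse-modulated periodic perturbation `ŵ(x,t) = w(x - σ(t), t) - φ(x)`. -/
def wHat (φ : ℝ → E2) (σ : ℝ → ℝ) (w : ℝ → ℝ → E2) (t x : ℝ) : E2 :=
  w t (x - σ t) - φ x

/-- The forward-modulated perturbation
`v̊(x,t) = u(x,t) - ŵ(x + σ(t) + γ(x,t), t) - φ(x + σ(t) + γ(x,t))`, where `u = w + v`. -/
def vRing (φ : ℝ → E2) (σ : ℝ → ℝ) (γ : ℝ → ℝ → ℝ) (w v : ℝ → ℝ → E2) (t x : ℝ) : E2 :=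
  (w t x + v t x) - wHat φ σ w t (x + σ t + γ t x) - φ (x + σ t + γ t x)

end LLE

end

/-! Write `z` for the modulated perturbation, `u = w + v`, and `W` for `w` evaluated at `x + γ`, so
that `u = z + W`. Subtracting the equation of `w` at the modulated point from that of `u` gives `z_t
= -β 𝒥 z_xx + g` with `g = -α 𝒥 z - z + 𝒩(z + W) - 𝒩(W) - residual`. The shift `σ` and the forcing
drop out, and every term of the residual carries a factor `γ_x`, `γ_xx` or `γ_t`, never `γ` itself.

In the time derivative of `‖z_xxx‖²` the dispersive part is skew and the damping yields
`-2‖z_xxx‖²`, but the nonlinearity leaves `4 ∫ ⟪u, z_xxx⟫ ⟪𝒥u, z_xxx⟫`, which is of top order,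
without sign and not small. The correction `2β ‖⟪u, z_xx⟫‖²` removes it: after one integration by
parts its time derivative contains the same integral with factor `-4β²`, and `β² = 1`. The remainder
is at most linear in `z_xxx`, with coefficients controlled by lower derivatives of `z` and by `γ_x`,
`γ_t` (`energyRate_le`). Interpolation absorbs `z_x` and `z_xx`, so the modified energy `E`
satisfies `E' ≤ -E + D (‖z‖² + ‖γ_x‖²_{H⁴} + ‖γ_t‖²_{H³})`. Gronwall's inequality and one more
interpolation, which compares `E` with the `H³` norm, finish the argument (`exists_energy_le`,
`exists_hNorm_modPert_sq_le`).

Since `z` has only three space derivatives and its time derivative is taken in `L²`, the energy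
cannot be differentiated directly. `energy_identity` replaces space derivatives by difference
quotients, which are bounded on `L²`, and passes to the limit in the integrated identity. The link
is `IsPrim.isGen`: a weak derivative is the `L²` derivative along translations. -/

noncomputable section

set_option linter.unusedSectionVars false

namespace LLE

open scoped InnerProductSpace ENNReal

/-! ### Indefinite integrals: differentiation and the product rule. -/

section Primitive

variable {E F G : Type*} [NormedAddCommGroup E] [NormedSpace ℝ E] [NormedAddCommGroup F]
  [NormedSpace ℝ F] [NormedAddCommGroup G] [NormedSpace ℝ G]

/-- `f` is an indefinite integral of the locally integrable function `f'`. -/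
def IsPrim (f f' : ℝ → E) : Prop :=
  ∀ a b : ℝ, IntervalIntegrable f' volume a b ∧ f b - f a = ∫ x in a..b, f' x

namespace IsPrim

variable {f f' g g' : ℝ → E}

lemma eq_add_integral (h : IsPrim f f') (a x : ℝ) : f x = f a + ∫ y in a..x, f' y := by
  rw [← (h a x).2]; abel

lemma locallyIntegrable (h : IsPrim f f') : LocallyIntegrable f' volume := by
  rw [MeasureTheory.locallyIntegrable_iff]
  intro k hk
  obtain ⟨a, b, hab⟩ := bddBelow_bddAbove_iff_subset_Icc.1 ⟨hk.bddBelow, hk.bddAbove⟩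
  rcases le_or_gt a b with h' | h'
  · exact (((intervalIntegrable_iff_integrableOn_Icc_of_le h').1 (h a b).1)).mono_set hab
  · rw [Icc_eq_empty (not_le.2 h')] at hab
    simp [subset_empty_iff.1 hab]

lemma continuous (h : IsPrim f f') : Continuous f := by
  have : f = fun x => f 0 + ∫ y in (0 : ℝ)..x, f' y := funext fun x => h.eq_add_integral 0 x
  rw [this]
  exact continuous_const.add (intervalIntegral.continuous_primitive (fun a b => (h a b).1) 0)

lemma ae_hasDerivAt [CompleteSpace E] (h : IsPrim f f') : ∀ᵐ x, HasDerivAt f (f' x) x := by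
  filter_upwards [LocallyIntegrable.ae_hasDerivAt_integral h.locallyIntegrable] with x hx
  have : f = fun x => f 0 + ∫ y in (0 : ℝ)..x, f' y := funext fun x => h.eq_add_integral 0 x
  rw [this]
  exact (hx 0).const_add _

lemma hasDerivAt [CompleteSpace E] (h : IsPrim f f') (hc : Continuous f') (x : ℝ) :
    HasDerivAt f (f' x) x := by
  have : f = fun x => f 0 + ∫ y in (0 : ℝ)..x, f' y := funext fun x => h.eq_add_integral 0 x
  rw [this]
  exact (hc.integral_hasStrictDerivAt 0 x).hasDerivAt.const_add _

lemma of_hasDerivAt [CompleteSpace E] (h : ∀ x, HasDerivAt f (f' x) x) (hc : Continuous f') :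
    IsPrim f f' := fun a b =>
  ⟨hc.intervalIntegrable a b,
    (intervalIntegral.integral_eq_sub_of_hasDerivAt (fun x _ => h x)
      (hc.intervalIntegrable a b)).symm⟩

lemma congr_right (h : IsPrim f f') (he : f' =ᵐ[volume] g') : IsPrim f g' := fun a b =>
  ⟨(h a b).1.congr_ae (ae_restrict_of_ae he), by
    rw [(h a b).2]
    exact intervalIntegral.integral_congr_ae (he.mono fun x hx _ => hx)⟩

lemma add (h : IsPrim f f') (k : IsPrim g g') :
    IsPrim (fun x => f x + g x) (fun x => f' x + g' x) := fun a b =>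
  ⟨(h a b).1.add (k a b).1, by
    rw [intervalIntegral.integral_add (h a b).1 (k a b).1, ← (h a b).2, ← (k a b).2,
      add_sub_add_comm]⟩

lemma sub (h : IsPrim f f') (k : IsPrim g g') :
    IsPrim (fun x => f x - g x) (fun x => f' x - g' x) := fun a b =>
  ⟨(h a b).1.sub (k a b).1, by
    rw [intervalIntegral.integral_sub (h a b).1 (k a b).1, ← (h a b).2, ← (k a b).2,
      sub_sub_sub_comm]⟩

lemma clm [CompleteSpace E] [CompleteSpace F] (L : E →L[ℝ] F) (h : IsPrim f f') :
    IsPrim (fun x => L (f x)) (fun x => L (f' x)) := fun a b =>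
  ⟨⟨L.integrable_comp (h a b).1.1, L.integrable_comp (h a b).1.2⟩, by
    rw [L.intervalIntegral_comp_comm (h a b).1, ← (h a b).2, map_sub]⟩

lemma const_smul [CompleteSpace E] (c : ℝ) (h : IsPrim f f') :
    IsPrim (fun x => c • f x) (fun x => c • f' x) :=
  h.clm (c • ContinuousLinearMap.id ℝ E)

lemma neg [CompleteSpace E] (h : IsPrim f f') : IsPrim (fun x => - f x) (fun x => - f' x) :=
  h.clm (-ContinuousLinearMap.id ℝ E)

lemma comp_add_const (h : IsPrim f f') (c : ℝ) :
    IsPrim (fun x => f (x + c)) (fun x => f' (x + c)) := fun a b =>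
  ⟨by simpa using (h (a + c) (b + c)).1.comp_add_right c, by
    rw [(h (a + c) (b + c)).2, intervalIntegral.integral_comp_add_right]⟩

/-- The increments of `f` are dominated by those of the primitive of `‖f'‖`. -/
lemma dist_le (h : IsPrim f f') (x y : ℝ) :
    dist (f x) (f y) ≤ |∫ z in x..y, ‖f' z‖| := by
  rw [dist_comm, dist_eq_norm, (h x y).2]
  exact intervalIntegral.norm_integral_le_abs_integral_norm

end IsPrim

/-- Absolute continuity is inherited from the primitive of `k`, whose increments over disjoint
intervals dominate those of `f`. -/
lemma absolutelyContinuous_of_dist_le {X : Type*} [PseudoMetricSpace X] {f : ℝ → X} {k : ℝ → ℝ} {a b : ℝ}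
    (hk : IntervalIntegrable k volume a b)
    (h : ∀ x ∈ uIcc a b, ∀ y ∈ uIcc a b, dist (f x) (f y) ≤ |∫ z in x..y, k z|) :
    AbsolutelyContinuousOnInterval f a b := by
  have H := hk.absolutelyContinuousOnInterval_intervalIntegral (c := a) left_mem_uIcc
  unfold AbsolutelyContinuousOnInterval at H ⊢
  refine squeeze_zero' (Eventually.of_forall fun E => Finset.sum_nonneg fun _ _ => dist_nonneg)
    ?_ H
  have : ∀ᶠ (E : ℕ × (ℕ → ℝ × ℝ)) in AbsolutelyContinuousOnInterval.totalLengthFilter ⊓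
      𝓟 (AbsolutelyContinuousOnInterval.disjWithin a b),
      E ∈ AbsolutelyContinuousOnInterval.disjWithin a b :=
    eventually_inf_principal.mpr (by simp)
  filter_upwards [this] with E hE
  refine Finset.sum_le_sum fun i hi => ?_
  have hx := (hE.1 i hi).1
  have hy := (hE.1 i hi).2
  refine (h _ hx _ hy).trans (le_of_eq ?_)
  have i1 := hk.mono_set (uIcc_subset_uIcc left_mem_uIcc hx)
  have i2 := hk.mono_set (uIcc_subset_uIcc left_mem_uIcc hy)
  rw [dist_comm, Real.dist_eq, intervalIntegral.integral_interval_sub_left i2 i1]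

namespace IsPrim

variable {f f' : ℝ → E} {g g' : ℝ → F}

/-- The domination makes `f` absolutely continuous, so `f` minus the primitive of `f'` is absolutely
continuous with zero derivative almost everywhere, hence constant. The factor `M` may depend on the
interval, which suits products of locally bounded functions. -/
lemma of_ae_hasDerivAt [CompleteSpace E] {k : ℝ → ℝ}
    (hk : ∀ a b, IntervalIntegrable k volume a b) (hi : ∀ a b, IntervalIntegrable f' volume a b)
    (hd : ∀ᵐ x, HasDerivAt f (f' x) x)
    (h : ∀ a b, ∃ M : ℝ, ∀ x ∈ uIcc a b, ∀ y ∈ uIcc a b,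
      dist (f x) (f y) ≤ M * |∫ z in x..y, k z|) : IsPrim f f' := by
  intro a b
  refine ⟨hi a b, ?_⟩
  obtain ⟨M, hM⟩ := h a b
  have hP : IsPrim (fun x => ∫ y in a..x, f' y) f' := fun c d =>
    ⟨hi c d, intervalIntegral.integral_interval_sub_left (hi _ _) (hi _ _)⟩
  have h1 : AbsolutelyContinuousOnInterval f a b := by
    refine absolutelyContinuous_of_dist_le (k := fun x => M * k x) ((hk a b).const_mul M) ?_
    intro x hx y hy
    rw [intervalIntegral.integral_const_mul, abs_mul]
    exact (hM x hx y hy).trans (mul_le_mul_of_nonneg_right (le_abs_self M) (abs_nonneg _))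
  have h2 : AbsolutelyContinuousOnInterval (fun x => ∫ y in a..x, f' y) a b :=
    absolutelyContinuous_of_dist_le (hi a b).norm fun x _ y _ => hP.dist_le x y
  have h3 : ∀ᵐ x, x ∈ uIcc a b → HasDerivAt (f - fun x => ∫ y in a..x, f' y) 0 x := by
    filter_upwards [hd, hP.ae_hasDerivAt] with x hx hx' _
    simpa using hx.sub hx'
  obtain ⟨C, hC⟩ := (h1.sub h2).const_of_ae_hasDerivAt_zero h3
  have e1 := hC a left_mem_uIcc
  have e2 := hC b right_mem_uIcc
  simp only [Pi.sub_apply, intervalIntegral.integral_same, sub_zero] at e1 e2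
  rw [e1, ← e2]; abel

/-- The product rule for a continuous bilinear map. -/
lemma bilin [CompleteSpace E] [CompleteSpace F] [CompleteSpace G] (B : E →L[ℝ] F →L[ℝ] G)
    (hf : IsPrim f f') (hg : IsPrim g g') :
    IsPrim (fun x => B (f x) (g x)) (fun x => B (f' x) (g x) + B (f x) (g' x)) := by
  have hi1 : ∀ a b, IntervalIntegrable (fun x => B (f' x) (g x)) volume a b := by
    intro a b
    rw [intervalIntegrable_iff]
    obtain ⟨M, hM⟩ := (isCompact_uIcc (a := a) (b := b)).exists_bound_of_continuousOn
      hg.continuous.continuousOn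
    exact B.integrable_of_bilin_of_bdd_right M (intervalIntegrable_iff.1 (hf a b).1)
      hg.continuous.aestronglyMeasurable
      ((ae_restrict_iff' measurableSet_uIoc).2 (Eventually.of_forall fun x hx =>
        hM x (uIoc_subset_uIcc hx)))
  have hi2 : ∀ a b, IntervalIntegrable (fun x => B (f x) (g' x)) volume a b := by
    intro a b
    rw [intervalIntegrable_iff]
    obtain ⟨M, hM⟩ := (isCompact_uIcc (a := a) (b := b)).exists_bound_of_continuousOn
      hf.continuous.continuousOn
    exact B.integrable_of_bilin_of_bdd_left M hf.continuous.aestronglyMeasurable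
      ((ae_restrict_iff' measurableSet_uIoc).2 (Eventually.of_forall fun x hx =>
        hM x (uIoc_subset_uIcc hx))) (intervalIntegrable_iff.1 (hg a b).1)
  refine of_ae_hasDerivAt (k := fun x => ‖f' x‖ + ‖g' x‖)
    (fun a b => (hf a b).1.norm.add (hg a b).1.norm)
    (fun a b => (hi1 a b).add (hi2 a b)) ?_ ?_
  · filter_upwards [hf.ae_hasDerivAt, hg.ae_hasDerivAt] with x h1 h2
    have := B.hasDerivWithinAt_of_bilinear h1.hasDerivWithinAt h2.hasDerivWithinAt (s := univ)
    rwa [hasDerivWithinAt_univ, add_comm] at this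
  · intro a b
    obtain ⟨M, hM⟩ := (isCompact_uIcc (a := a) (b := b)).exists_bound_of_continuousOn
      hf.continuous.continuousOn
    obtain ⟨N, hN⟩ := (isCompact_uIcc (a := a) (b := b)).exists_bound_of_continuousOn
      hg.continuous.continuousOn
    have hM0 : 0 ≤ M := (norm_nonneg _).trans (hM a left_mem_uIcc)
    have hN0 : 0 ≤ N := (norm_nonneg _).trans (hN a left_mem_uIcc)
    -- Changing one factor at a time leaves the other factor, bounded by `N` or `M` on the interval.
    refine ⟨‖B‖ * (M + N), fun x hx y hy => ?_⟩
    have e : B (f x) (g x) - B (f y) (g y) = B (f x - f y) (g x) + B (f y) (g x - g y) := by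
      simp
    have k : ∀ p : ℝ → ℝ, (∀ a b, IntervalIntegrable p volume a b) →
        (∀ z, 0 ≤ p z) → (∀ z, p z ≤ ‖f' z‖ + ‖g' z‖) →
        |∫ z in x..y, p z| ≤ |∫ z in x..y, (‖f' z‖ + ‖g' z‖)| := by
      intro p hp h0 hle
      rw [intervalIntegral.abs_integral_eq_abs_integral_uIoc,
        intervalIntegral.abs_integral_eq_abs_integral_uIoc]
      refine abs_le_abs_of_nonneg (integral_nonneg h0) (integral_mono
        (intervalIntegrable_iff.1 (hp x y))
        (intervalIntegrable_iff.1 ((hf x y).1.norm.add (hg x y).1.norm)) hle)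
    have k1 := k (fun z => ‖f' z‖) (fun a b => (hf a b).1.norm) (fun _ => norm_nonneg _)
      fun z => le_add_of_nonneg_right (norm_nonneg _)
    have k2 := k (fun z => ‖g' z‖) (fun a b => (hg a b).1.norm) (fun _ => norm_nonneg _)
      fun z => le_add_of_nonneg_left (norm_nonneg _)
    have d1 := (hf.dist_le x y).trans k1
    have d2 := (hg.dist_le x y).trans k2
    rw [dist_eq_norm] at d1 d2 ⊢
    rw [e]
    calc _ ≤ ‖B (f x - f y) (g x)‖ + ‖B (f y) (g x - g y)‖ := norm_add_le _ _
      _ ≤ ‖B‖ * ‖f x - f y‖ * ‖g x‖ + ‖B‖ * ‖f y‖ * ‖g x - g y‖ :=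
        add_le_add (B.le_opNorm₂ _ _) (B.le_opNorm₂ _ _)
      _ ≤ ‖B‖ * |∫ z in x..y, (‖f' z‖ + ‖g' z‖)| * N
          + ‖B‖ * M * |∫ z in x..y, (‖f' z‖ + ‖g' z‖)| := by
        gcongr
        · exact hN x hx
        · exact hM y hy
      _ = _ := by ring

end IsPrim

end Primitive

/-! ### Chains of weak derivatives and the Sobolev spaces. -/

section Jets

variable {E : Type*} [NormedAddCommGroup E] [NormedSpace ℝ E] [CompleteSpace E]

/-- Each of `f 0, …, f (k - 1)` is an indefinite integral of its successor. -/
def IsJet (k : ℕ) (f : ℕ → ℝ → E) : Prop := ∀ j < k, IsPrim (f j) (f (j + 1))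

namespace IsJet

variable {k : ℕ} {f g : ℕ → ℝ → E}

/-- Strictly below the top order every entry is itself an indefinite integral, hence continuous, and
the derivatives are classical. At the top order only almost everywhere equality survives. -/
lemma iteratedDeriv_eq (h : IsJet k f) : ∀ j < k, iteratedDeriv j (f 0) = f j := by
  intro j
  induction j with
  | zero => intro _; exact iteratedDeriv_zero
  | succ j ih =>
    intro hj
    rw [iteratedDeriv_succ, ih (by omega)]
    exact funext fun x => ((h j (by omega)).hasDerivAt (h (j + 1) hj).continuous x).deriv

lemma iteratedDeriv_ae_eq (h : IsJet k f) {j : ℕ} (hj : j ≤ k) :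
    iteratedDeriv j (f 0) =ᵐ[volume] f j := by
  rcases hj.lt_or_eq with hj | rfl
  · rw [h.iteratedDeriv_eq j hj]
  · cases j with
    | zero => rw [iteratedDeriv_zero]
    | succ j =>
      rw [iteratedDeriv_succ, h.iteratedDeriv_eq j (by omega)]
      filter_upwards [(h j (by omega)).ae_hasDerivAt] with x hx using hx.deriv

lemma iterAbsCont (h : IsJet k f) : IterAbsCont k (f 0) := by
  intro j hj
  have := (h j hj).congr_right (h.iteratedDeriv_ae_eq (j := j + 1) hj).symm
  rw [← h.iteratedDeriv_eq j hj] at this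
  exact this

lemma sub (hf : IsJet k f) (hg : IsJet k g) : IsJet k (fun j x => f j x - g j x) :=
  fun j hj => (hf j hj).sub (hg j hj)

lemma mem_hSpace (h : IsJet k f) (hm : ∀ j ≤ k, MemLp (f j) 2 volume) : f 0 ∈ HSpace k :=
  ⟨h.iterAbsCont, fun j hj => (memLp_congr_ae (h.iteratedDeriv_ae_eq hj)).2 (hm j hj)⟩

end IsJet

lemma HSpace.isJet {k : ℕ} {f : ℝ → E} (h : f ∈ HSpace k) :
    IsJet k (fun j => iteratedDeriv j f) := h.1

lemma HPerSpace.isJet {T : ℝ} {k : ℕ} {f : ℝ → E} (h : f ∈ HPerSpace T k) :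
    IsJet k (fun j => iteratedDeriv j f) := h.2.1

lemma HSpace.sub {k : ℕ} {f g : ℝ → E} (hf : f ∈ HSpace k) (hg : g ∈ HSpace k) :
    f - g ∈ HSpace k := by
  have := ((HSpace.isJet hf).sub (HSpace.isJet hg)).mem_hSpace fun j hj => (hf.2 j hj).sub (hg.2 j hj)
  simp only [iteratedDeriv_zero] at this
  exact this

lemma HSpace.const_smul {k : ℕ} {f : ℝ → E} (c : ℝ) (hf : f ∈ HSpace k) :
    c • f ∈ HSpace k := by
  have : IsJet k (fun j x => c • iteratedDeriv j f x) := fun j hj => (HSpace.isJet hf j hj).const_smul c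
  have := this.mem_hSpace fun j hj => (hf.2 j hj).const_smul c
  simp only [iteratedDeriv_zero] at this
  exact this

lemma iteratedDeriv_sub_of_iterAbsCont {k : ℕ} {f g : ℝ → E} (hf : IterAbsCont k f)
    (hg : IterAbsCont k g) {j : ℕ} (hj : j < k) :
    iteratedDeriv j (f - g) = fun x => iteratedDeriv j f x - iteratedDeriv j g x := by
  have := (IsJet.sub (k := k) (f := fun j => iteratedDeriv j f)
    (g := fun j => iteratedDeriv j g) hf hg).iteratedDeriv_eq j hj
  simp only [iteratedDeriv_zero] at this
  exact this

lemma HPerSpace.sub {T : ℝ} {k : ℕ} {f g : ℝ → E} (hf : f ∈ HPerSpace T k)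
    (hg : g ∈ HPerSpace T k) : f - g ∈ HPerSpace T k := by
  have h := (HPerSpace.isJet hf).sub (HPerSpace.isJet hg)
  refine ⟨hf.1.sub hg.1, ?_, fun j hj => ?_⟩
  · have := h.iterAbsCont
    simp only [iteratedDeriv_zero] at this
    exact this
  · have := h.iteratedDeriv_ae_eq hj
    simp only [iteratedDeriv_zero] at this
    exact (memLp_congr_ae (ae_restrict_of_ae this)).2 ((hf.2.2 j hj).sub (hg.2.2 j hj))

lemma HPerSpace.const_smul {T : ℝ} {k : ℕ} {f : ℝ → E} (c : ℝ) (hf : f ∈ HPerSpace T k) :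
    c • f ∈ HPerSpace T k := by
  have h : IsJet k (fun j x => c • iteratedDeriv j f x) := fun j hj => (HPerSpace.isJet hf j hj).const_smul c
  refine ⟨fun x => by simp [hf.1 x], ?_, fun j hj => ?_⟩
  · have := h.iterAbsCont
    simp only [iteratedDeriv_zero] at this
    exact this
  · have := h.iteratedDeriv_ae_eq hj
    simp only [iteratedDeriv_zero] at this
    exact (memLp_congr_ae (ae_restrict_of_ae this)).2 ((hf.2.2 j hj).const_smul c)

lemma iteratedDeriv_periodic {T : ℝ} {f : ℝ → E} (hf : Function.Periodic f T) (j : ℕ) :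
    Function.Periodic (iteratedDeriv j f) T := by
  intro x
  have := congrFun (iteratedDeriv_comp_add_const j f T) x
  rw [← this, show (fun z => f (z + T)) = f from funext hf]

lemma HPerSpace.of_contDiff {T : ℝ} {k : ℕ} {f : ℝ → E} (hf : ContDiff ℝ ∞ f)
    (hp : Function.Periodic f T) : f ∈ HPerSpace T k := by
  have hc : ∀ j, Continuous (iteratedDeriv j f) := fun j =>
    hf.continuous_iteratedDeriv j (by exact_mod_cast le_top)
  refine ⟨hp, fun j _ => IsPrim.of_hasDerivAt (fun x => ?_) (hc _), fun j _ => ?_⟩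
  · rw [iteratedDeriv_succ]
    exact ((hf.differentiable_iteratedDeriv j (by exact_mod_cast ENat.natCast_lt_top j)) x).hasDerivAt
  · refine MemLp.mono_measure (Measure.restrict_mono Ioo_subset_Icc_self le_rfl) ?_
    obtain ⟨M, hM⟩ := (isCompact_Icc (a := (0 : ℝ)) (b := T)).exists_bound_of_continuousOn
      (hc j).continuousOn
    exact MemLp.of_bound (hc j).aestronglyMeasurable M
      ((ae_restrict_iff' measurableSet_Icc).2 (Eventually.of_forall hM))

end Jets

/-! ### Sobolev embeddings into bounded functions. -/

section Sup

variable {E : Type*} [NormedAddCommGroup E] [NormedSpace ℝ E] [CompleteSpace E]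

lemma integral_norm_le_sqrt {α : Type*} [MeasurableSpace α] {μ : Measure α} [IsFiniteMeasure μ]
    {f : α → E} (hf : MemLp f 2 μ) :
    ∫ x, ‖f x‖ ∂μ ≤ √(μ.real univ) * √(∫ x, ‖f x‖ ^ 2 ∂μ) := by
  have h := integral_mul_le_Lp_mul_Lq_of_nonneg (μ := μ) Real.HolderConjugate.two_two
    (f := fun _ => 1) (g := fun x => ‖f x‖) (Eventually.of_forall fun _ => zero_le_one)
    (Eventually.of_forall fun _ => norm_nonneg _) (by simpa using memLp_const (1 : ℝ))
    (by simpa using hf.norm)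
  simpa [Real.sqrt_eq_rpow] using h

/-- Average `‖f x‖ ≤ ‖f y‖ + ∫ ‖f'‖` over `y` in the interval and apply Cauchy–Schwarz to both
integrals. -/
lemma IsPrim.norm_le {f f' : ℝ → E} (h : IsPrim f f') {a b x : ℝ} (hab : a < b)
    (hx : x ∈ Icc a b) (hf : MemLp f 2 (volume.restrict (Ioo a b)))
    (hf' : MemLp f' 2 (volume.restrict (Ioo a b))) :
    ‖f x‖ ≤ √(b - a) / (b - a) * √(∫ y in Ioo a b, ‖f y‖ ^ 2)
      + √(b - a) * √(∫ y in Ioo a b, ‖f' y‖ ^ 2) := by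
  have hL : 0 < b - a := sub_pos.2 hab
  have hv : (volume.restrict (Ioo a b)).real univ = b - a := by
    simp [hab.le]
  have h1 := integral_norm_le_sqrt hf
  have h2 := integral_norm_le_sqrt hf'
  rw [hv] at h1 h2
  have hint : Integrable (fun y => ‖f' y‖) (volume.restrict (Ioo a b)) :=
    (hf'.integrable (by norm_num)).norm
  have hint1 : Integrable (fun y => ‖f y‖) (volume.restrict (Ioo a b)) :=
    (hf.integrable (by norm_num)).norm
  have h3 : ∀ y ∈ Ioo a b, ‖f x‖ ≤ ‖f y‖ + ∫ z in Ioo a b, ‖f' z‖ := by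
    intro y hy
    have e := h.eq_add_integral y x
    have : ‖∫ z in y..x, f' z‖ ≤ ∫ z in Ioo a b, ‖f' z‖ := by
      refine (intervalIntegral.norm_integral_le_integral_norm_uIoc).trans ?_
      rw [← integral_Ioc_eq_integral_Ioo]
      refine setIntegral_mono_set ?_ (Eventually.of_forall fun _ => norm_nonneg _)
        (LE.le.eventuallyLE ?_)
      · rwa [integrableOn_Ioc_iff_integrableOn_Ioo]
      · intro z hz
        rw [mem_uIoc] at hz
        rcases hz with hz | hz
        · exact ⟨hy.1.trans hz.1, hz.2.trans hx.2⟩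
        · exact ⟨hx.1.trans_lt hz.1, hz.2.trans hy.2.le⟩
    rw [e]
    exact (norm_add_le _ _).trans (add_le_add le_rfl this)
  have h4 : ∫ y in Ioo a b, ‖f x‖ ≤ ∫ y in Ioo a b, (‖f y‖ + ∫ z in Ioo a b, ‖f' z‖) :=
    setIntegral_mono_on (integrable_const _) (hint1.add (integrable_const _)) measurableSet_Ioo h3
  rw [integral_add hint1 (integrable_const _), integral_const, integral_const, hv, smul_eq_mul,
    smul_eq_mul] at h4
  have h5 : (b - a) * ‖f x‖ ≤ √(b - a) * √(∫ y in Ioo a b, ‖f y‖ ^ 2)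
      + (b - a) * (√(b - a) * √(∫ y in Ioo a b, ‖f' y‖ ^ 2)) :=
    h4.trans (add_le_add h1 (mul_le_mul_of_nonneg_left h2 hL.le))
  rw [← mul_le_mul_iff_right₀ hL]
  refine h5.trans (le_of_eq ?_)
  field_simp

lemma sqrt_integral_le_hNorm {k j : ℕ} (hj : j ≤ k) (f : ℝ → E) :
    √(∫ x, ‖iteratedDeriv j f x‖ ^ 2) ≤ hNorm k f :=
  Real.sqrt_le_sqrt (Finset.single_le_sum (f := fun j => ∫ x, ‖iteratedDeriv j f x‖ ^ 2)
    (fun _ _ => integral_nonneg fun _ => by positivity) (Finset.mem_range.2 (by omega)))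

lemma sqrt_integral_le_hPerNorm {T : ℝ} {k j : ℕ} (hj : j ≤ k) (f : ℝ → E) :
    √(∫ x in Ioo 0 T, ‖iteratedDeriv j f x‖ ^ 2) ≤ hPerNorm T k f :=
  Real.sqrt_le_sqrt (Finset.single_le_sum
    (f := fun j => ∫ x in Ioo 0 T, ‖iteratedDeriv j f x‖ ^ 2)
    (fun _ _ => integral_nonneg fun _ => by positivity) (Finset.mem_range.2 (by omega)))

/-- The embedding of `H^k(ℝ)` into `C_b^{k-1}(ℝ)`. -/
lemma HSpace.norm_iteratedDeriv_le {k j : ℕ} (hj : j < k) {f : ℝ → E} (hf : f ∈ HSpace k)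
    (x : ℝ) : ‖iteratedDeriv j f x‖ ≤ 2 * hNorm k f := by
  -- On an interval of length one both constants equal one, which gives the factor 2 independently
  -- of `k`.
  have h := (HSpace.isJet hf j hj).norm_le (a := x) (b := x + 1) (x := x) (by linarith)
    ⟨le_rfl, by linarith⟩ ((hf.2 j hj.le).restrict _) ((hf.2 (j + 1) hj).restrict _)
  have m : ∀ i ≤ k, √(∫ y in Ioo x (x + 1), ‖iteratedDeriv i f y‖ ^ 2) ≤ hNorm k f := fun i hi =>
    (Real.sqrt_le_sqrt (setIntegral_le_integral ((hf.2 i hi).integrable_norm_pow (by norm_num))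
      (Eventually.of_forall fun _ => by positivity))).trans (sqrt_integral_le_hNorm hi f)
  have h1 := m j hj.le
  have h2 := m (j + 1) hj
  simp only [add_sub_cancel_left, Real.sqrt_one, div_one, one_mul] at h
  linarith

/-- The constant of the embedding of `H^k_per(0, T)` into `C^{k-1}`. -/
def perConst (T : ℝ) : ℝ := √T / T + √T

lemma perConst_nonneg {T : ℝ} (hT : 0 < T) : 0 ≤ perConst T := by unfold perConst; positivity

/-- The embedding of `H^k_per(0, T)` into `C^{k-1}(ℝ)`. -/
lemma HPerSpace.norm_iteratedDeriv_le {T : ℝ} (hT : 0 < T) {k j : ℕ} (hj : j < k) {f : ℝ → E}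
    (hf : f ∈ HPerSpace T k) (x : ℝ) :
    ‖iteratedDeriv j f x‖ ≤ perConst T * hPerNorm T k f := by
  obtain ⟨y, hy, hxy⟩ := (iteratedDeriv_periodic hf.1 j).exists_mem_Ico₀ hT x
  have h := (HPerSpace.isJet hf j hj).norm_le (a := 0) (b := T) (x := y) hT ⟨hy.1, hy.2.le⟩
    (hf.2.2 j hj.le) (hf.2.2 (j + 1) hj)
  rw [hxy, perConst, add_mul]
  rw [sub_zero] at h
  exact h.trans (add_le_add
    (mul_le_mul_of_nonneg_left (sqrt_integral_le_hPerNorm hj.le f) (by positivity))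
    (mul_le_mul_of_nonneg_left (sqrt_integral_le_hPerNorm hj f) (by positivity)))

end Sup

/-! ### Translations and difference quotients on `L²`. -/

section LTwo

open scoped InnerProductSpace

variable {E : Type*} [NormedAddCommGroup E]

open Classical in
/-- The class of `f` in `L²(ℝ; E)` (zero if `f` is not square integrable). -/
def cls (f : ℝ → E) : Lp E 2 (volume : Measure ℝ) :=
  if h : MemLp f 2 volume then h.toLp f else 0

lemma cls_eq_toLp {f : ℝ → E} (h : MemLp f 2 volume) : cls f = h.toLp f := dif_pos h

lemma coeFn_cls {f : ℝ → E} (h : MemLp f 2 volume) : cls f =ᵐ[volume] f := by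
  rw [cls_eq_toLp h]; exact h.coeFn_toLp

lemma cls_congr {f g : ℝ → E} (h : f =ᵐ[volume] g) : cls f = cls g := by
  by_cases hf : MemLp f 2 volume
  · rw [cls_eq_toLp hf, cls_eq_toLp ((memLp_congr_ae h).1 hf)]
    exact MemLp.toLp_congr _ _ h
  · rw [cls, cls, dif_neg hf, dif_neg (fun h' => hf ((memLp_congr_ae h).2 h'))]

lemma cls_eq_of_ae {f : ℝ → E} (F : Lp E 2 (volume : Measure ℝ)) (h : F =ᵐ[volume] f) :
    cls f = F := by
  have hf : MemLp f 2 volume := (memLp_congr_ae h).1 (Lp.memLp F)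
  exact Lp.ext ((coeFn_cls hf).trans h.symm)

lemma cls_add {f g : ℝ → E} (hf : MemLp f 2 volume) (hg : MemLp g 2 volume) :
    cls (fun x => f x + g x) = cls f + cls g := by
  rw [cls_eq_toLp hf, cls_eq_toLp hg, ← MemLp.toLp_add hf hg]
  exact cls_eq_toLp (hf.add hg)

lemma cls_sub {f g : ℝ → E} (hf : MemLp f 2 volume) (hg : MemLp g 2 volume) :
    cls (fun x => f x - g x) = cls f - cls g := by
  rw [cls_eq_toLp hf, cls_eq_toLp hg, ← MemLp.toLp_sub hf hg]
  exact cls_eq_toLp (hf.sub hg)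

lemma cls_smul [NormedSpace ℝ E] {f : ℝ → E} (c : ℝ) (hf : MemLp f 2 volume) :
    cls (fun x => c • f x) = c • cls f := by
  rw [cls_eq_toLp hf, ← MemLp.toLp_const_smul c hf]
  exact cls_eq_toLp (hf.const_smul c)

lemma norm_cls_sq {f : ℝ → E} (hf : MemLp f 2 volume) : ‖cls f‖ ^ 2 = ∫ x, ‖f x‖ ^ 2 := by
  rw [cls_eq_toLp hf, Lp.norm_toLp]
  have h := hf.eLpNorm_eq_integral_rpow_norm (by norm_num) (by norm_num)
  rw [h, ENNReal.toReal_ofReal (by positivity)]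
  simp only [ENNReal.toReal_ofNat, Real.rpow_two]
  rw [← Real.rpow_natCast, ← Real.rpow_mul (integral_nonneg fun _ => by positivity)]
  norm_num

lemma norm_cls_le {F : Type*} [NormedAddCommGroup F] {f : ℝ → E} {g : ℝ → F}
    (hf : MemLp f 2 volume) (hg : MemLp g 2 volume) (h : ∀ᵐ x, ‖f x‖ ≤ ‖g x‖) :
    ‖cls f‖ ≤ ‖cls g‖ := by
  rw [cls_eq_toLp hf, cls_eq_toLp hg, Lp.norm_toLp, Lp.norm_toLp]
  exact ENNReal.toReal_mono hg.eLpNorm_ne_top (eLpNorm_mono_ae h)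

lemma norm_cls_le_mul {F : Type*} [NormedAddCommGroup F] {f : ℝ → E} {g : ℝ → F}
    (hf : MemLp f 2 volume) (hg : MemLp g 2 volume) {c : ℝ} (hc : 0 ≤ c)
    (h : ∀ᵐ x, ‖f x‖ ≤ c * ‖g x‖) :
    ‖cls f‖ ≤ c * ‖cls g‖ := by
  have h1 : MemLp (fun x => c • ‖g x‖) 2 volume := hg.norm.const_smul c
  have h2 := norm_cls_le hf h1 (by
    filter_upwards [h] with x hx
    rwa [norm_smul, norm_norm, Real.norm_of_nonneg hc])
  have h3 := norm_cls_le hg.norm hg (Eventually.of_forall fun x => by simp)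
  rw [cls_smul c hg.norm, norm_smul, Real.norm_of_nonneg hc] at h2
  exact h2.trans (mul_le_mul_of_nonneg_left h3 hc)

lemma inner_cls [InnerProductSpace ℝ E] {f g : ℝ → E} (hf : MemLp f 2 volume)
    (hg : MemLp g 2 volume) : ⟪cls f, cls g⟫_ℝ = ∫ x, ⟪f x, g x⟫_ℝ := by
  rw [L2.inner_def]
  refine integral_congr_ae ?_
  filter_upwards [coeFn_cls hf, coeFn_cls hg] with x h1 h2
  rw [h1, h2]

lemma memLp_translate {f : ℝ → E} (hf : MemLp f 2 volume) (y : ℝ) :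
    MemLp (fun x => f (x + y)) 2 volume :=
  hf.comp_measurePreserving (measurePreserving_add_right volume y)

variable [NormedSpace ℝ E]

/-- Translation by `y` on `L²(ℝ; E)`. -/
def translate (y : ℝ) : Lp E 2 (volume : Measure ℝ) →ₗᵢ[ℝ] Lp E 2 (volume : Measure ℝ) :=
  Lp.compMeasurePreservingₗᵢ ℝ (fun x => x + y) (measurePreserving_add_right volume y)

lemma translate_cls {f : ℝ → E} (hf : MemLp f 2 volume) (y : ℝ) :
    translate y (cls f) = cls (fun x => f (x + y)) := by
  rw [cls_eq_toLp hf, cls_eq_toLp (memLp_translate hf y)]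
  exact Lp.toLp_compMeasurePreserving hf (measurePreserving_add_right volume y)

lemma exists_eq_cls (F : Lp E 2 (volume : Measure ℝ)) :
    ∃ f : ℝ → E, MemLp f 2 volume ∧ F = cls f :=
  ⟨F, Lp.memLp F, by rw [cls_eq_toLp (Lp.memLp F), Lp.toLp_coeFn]⟩

lemma translate_translate (y z : ℝ) (F : Lp E 2 (volume : Measure ℝ)) :
    translate y (translate z F) = translate (y + z) F := by
  obtain ⟨f, hf, rfl⟩ := exists_eq_cls F
  rw [translate_cls hf, translate_cls hf, translate_cls (memLp_translate hf z)]
  simp only [add_assoc]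

lemma translate_zero (F : Lp E 2 (volume : Measure ℝ)) : translate 0 F = F := by
  obtain ⟨f, hf, rfl⟩ := exists_eq_cls F
  rw [translate_cls hf]; simp

lemma continuous_translate (F : Lp E 2 (volume : Measure ℝ)) :
    Continuous fun y => translate y F := by
  have : Continuous (fun y : ℝ => (⟨fun x => x + y, by fun_prop⟩ : C(ℝ, ℝ))) :=
    ContinuousMap.continuous_of_continuous_uncurry _ (by
      simp only [Function.uncurry_def, ContinuousMap.coe_mk]; fun_prop)
  exact Continuous.compMeasurePreservingLp (continuous_const (y := F)) this
    (fun y => measurePreserving_add_right volume y) (by norm_num)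

/-- `F'` is the derivative in `L²(ℝ; E)` of `F` along translations. -/
def IsGen (F F' : Lp E 2 (volume : Measure ℝ)) : Prop :=
  HasDerivAt (fun y => translate y F) F' 0

/-- The difference quotient with step `h` on `L²(ℝ; E)`. -/
def dquot (h : ℝ) : Lp E 2 (volume : Measure ℝ) →L[ℝ] Lp E 2 (volume : Measure ℝ) :=
  h⁻¹ • ((translate h).toContinuousLinearMap - ContinuousLinearMap.id ℝ _)

lemma dquot_apply (h : ℝ) (F : Lp E 2 (volume : Measure ℝ)) :
    dquot h F = h⁻¹ • (translate h F - F) := rfl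

namespace IsGen

variable {F F' G G' : Lp E 2 (volume : Measure ℝ)}

lemma sub (hF : IsGen F F') (hG : IsGen G G') : IsGen (F - G) (F' - G') := by
  have := HasDerivAt.sub hF hG
  unfold IsGen
  refine this.congr_of_eventuallyEq (Eventually.of_forall fun y => ?_)
  simp

lemma clm (hF : IsGen F F') (L : Lp E 2 (volume : Measure ℝ) →L[ℝ] Lp E 2 (volume : Measure ℝ))
    (hL : ∀ y G, translate y (L G) = L (translate y G)) : IsGen (L F) (L F') := by
  have := L.hasFDerivAt.comp_hasDerivAt 0 hF
  unfold IsGen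
  refine this.congr_of_eventuallyEq (Eventually.of_forall fun y => ?_)
  simp [hL]

lemma translate_dquot (y h : ℝ) (G : Lp E 2 (volume : Measure ℝ)) :
    translate y (dquot h G) = dquot h (translate y G) := by
  simp only [dquot_apply, map_smul, map_sub, translate_translate, add_comm]

lemma dquot (hF : IsGen F F') (h : ℝ) : IsGen (dquot h F) (LLE.dquot h F') :=
  hF.clm _ fun y G => translate_dquot y h G

/-- The group law transports the derivative from `0` to `y`. -/
lemma hasDerivAt (hF : IsGen F F') (y : ℝ) :
    HasDerivAt (fun y => translate y F) (translate y F') y := by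
  have h1 : HasDerivAt (fun z => translate z F) F' (y - y) := by rw [sub_self]; exact hF
  have h2 := (translate y).toContinuousLinearMap.hasFDerivAt.comp_hasDerivAt y
    (h1.comp_sub_const y y)
  refine h2.congr_of_eventuallyEq (Eventually.of_forall fun z => ?_)
  simp [translate_translate]

/-- Mean value inequality along the orbit `y ↦ translate y F`, whose velocity has the constant norm
`‖F'‖`. -/
lemma norm_dquot_le (hF : IsGen F F') (h : ℝ) : ‖LLE.dquot h F‖ ≤ ‖F'‖ := by
  have h1 : ‖translate h F - translate 0 F‖ ≤ ‖F'‖ * ‖h - 0‖ :=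
    Convex.norm_image_sub_le_of_norm_hasDerivWithin_le (s := univ)
      (fun x _ => (hF.hasDerivAt x).hasDerivWithinAt) (fun x _ => by simp) convex_univ
      (mem_univ _) (mem_univ _)
  rw [translate_zero, sub_zero] at h1
  rw [dquot_apply, norm_smul, norm_inv]
  rcases eq_or_ne h 0 with rfl | hh
  · simp
  · rw [inv_mul_le_iff₀ (norm_pos_iff.2 hh), mul_comm]
    exact h1

lemma tendsto_dquot (hF : IsGen F F') : Tendsto (fun h => LLE.dquot h F) (𝓝[≠] 0) (𝓝 F') := by
  have h1 := hasDerivAt_iff_tendsto_slope.1 hF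
  refine h1.congr fun h => ?_
  simp [slope_def_module, dquot_apply, translate_zero]

/-- Difference quotients are not bounded on `L²` uniformly in the step. The iterated one still
converges, because `norm_dquot_le` applied to `dquot h F - F'` bounds the error by `‖dquot h F' -
F₂‖`. -/
lemma tendsto_dquot_two {F₂ : Lp E 2 (volume : Measure ℝ)} (h1 : IsGen F F') (h2 : IsGen F' F₂) :
    Tendsto (fun h => LLE.dquot h (LLE.dquot h F)) (𝓝[≠] 0) (𝓝 F₂) := by
  have h3 : Tendsto (fun h => LLE.dquot h F' - F₂) (𝓝[≠] 0) (𝓝 0) := by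
    simpa using h2.tendsto_dquot.sub_const F₂
  have h4 : Tendsto (fun h => LLE.dquot h (LLE.dquot h F - F')) (𝓝[≠] 0) (𝓝 0) :=
    squeeze_zero_norm (fun h => ((h1.dquot h).sub h2).norm_dquot_le h)
      (tendsto_zero_iff_norm_tendsto_zero.1 h3)
  have := (h4.add h2.tendsto_dquot)
  simpa using this

lemma tendsto_dquot_three {F₂ F₃ : Lp E 2 (volume : Measure ℝ)} (h1 : IsGen F F')
    (h2 : IsGen F' F₂) (h3 : IsGen F₂ F₃) :
    Tendsto (fun h => LLE.dquot h (LLE.dquot h (LLE.dquot h F))) (𝓝[≠] 0) (𝓝 F₃) := by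
  have h4 : Tendsto (fun h => LLE.dquot h (LLE.dquot h F') - F₃) (𝓝[≠] 0) (𝓝 0) := by
    simpa using (tendsto_dquot_two h2 h3).sub_const F₃
  have h5 : Tendsto (fun h => LLE.dquot h (LLE.dquot h (LLE.dquot h F) - F₂)) (𝓝[≠] 0) (𝓝 0) :=
    squeeze_zero_norm (fun h => (((h1.dquot h).dquot h).sub h3).norm_dquot_le h)
      (tendsto_zero_iff_norm_tendsto_zero.1 h4)
  have := (h5.add h3.tendsto_dquot)
  simpa using this

end IsGen

/-- Integration by parts on the line. -/
lemma IsGen.inner_add_inner {E : Type*} [NormedAddCommGroup E] [InnerProductSpace ℝ E]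
    {F F' G G' : Lp E 2 (volume : Measure ℝ)} (hF : IsGen F F') (hG : IsGen G G') :
    ⟪F', G⟫_ℝ + ⟪F, G'⟫_ℝ = 0 := by
  have h1 := HasDerivAt.inner ℝ hF hG
  -- Translations are isometries, so the inner product along the common orbit is constant; its
  -- derivative is the integration by parts formula.
  have h2 : HasDerivAt (fun y => ⟪translate y F, translate y G⟫_ℝ) 0 0 := by
    refine (hasDerivAt_const (0 : ℝ) ⟪F, G⟫_ℝ).congr_of_eventuallyEq
      (Eventually.of_forall fun y => ?_)
    exact LinearIsometry.inner_map_map _ _ _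
  have := h1.unique h2
  rw [translate_zero, translate_zero] at this
  linarith

/-- Minkowski's inequality for the remainder of the difference quotient. -/
lemma IsPrim.eLpNorm_remainder_le [CompleteSpace E] {f f' : ℝ → E} (h : IsPrim f f')
    (hm : StronglyMeasurable f') {δ : ℝ} {ε : ENNReal}
    (hε : ∀ r ∈ uIoc 0 δ, eLpNorm (fun x => f' (x + r) - f' x) 2 volume ≤ ε) :
    eLpNorm (fun x => f (x + δ) - f x - δ • f' x) 2 volume ≤ ENNReal.ofReal |δ| * ε := by
  have hvol : volume (uIoc 0 δ) = ENNReal.ofReal |δ| := by simp [Real.volume_uIoc]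
  -- Pointwise Cauchy–Schwarz in the translation parameter; integrating in `x` and exchanging the
  -- integrals then gives the `L²` bound.
  have key : ∀ x, ‖f (x + δ) - f x - δ • f' x‖ₑ ^ 2
      ≤ ENNReal.ofReal |δ| * ∫⁻ r in uIoc 0 δ, ‖f' (x + r) - f' x‖ₑ ^ 2 := by
    intro x
    have e : f (x + δ) - f x - δ • f' x = ∫ r in (0 : ℝ)..δ, (f' (x + r) - f' x) := by
      have i : IntervalIntegrable (fun r => f' (x + r)) volume 0 δ := by
        have := (h x (x + δ)).1.comp_add_left x
        simpa using this
      rw [intervalIntegral.integral_sub i intervalIntegrable_const,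
        intervalIntegral.integral_comp_add_left, intervalIntegral.integral_const, (h _ _).2]
      simp
    have h1 : ‖∫ r in (0 : ℝ)..δ, (f' (x + r) - f' x)‖ₑ
        ≤ ∫⁻ r in uIoc 0 δ, ‖f' (x + r) - f' x‖ₑ := by
      rw [intervalIntegral.intervalIntegral_eq_integral_uIoc]
      refine le_trans ?_ (enorm_integral_le_lintegral_enorm _)
      rw [enorm_smul]
      split_ifs <;> simp
    have h2 := ENNReal.lintegral_mul_le_Lp_mul_Lq (volume.restrict (uIoc 0 δ))
      Real.HolderConjugate.two_two (f := fun _ => 1) (g := fun r => ‖f' (x + r) - f' x‖ₑ)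
      aemeasurable_const
      (((hm.comp_measurable (measurable_const_add x)).sub stronglyMeasurable_const).enorm.aemeasurable)
    simp only [Pi.mul_apply, one_mul, ENNReal.one_rpow, lintegral_const, Measure.restrict_apply
      MeasurableSet.univ, univ_inter, hvol] at h2
    rw [e]
    calc _ ≤ (ENNReal.ofReal |δ| ^ (1 / 2 : ℝ)
        * (∫⁻ r in uIoc 0 δ, ‖f' (x + r) - f' x‖ₑ ^ (2 : ℝ)) ^ (1 / 2 : ℝ)) ^ 2 := by
          gcongr; exact h1.trans h2
      _ = _ := by
          rw [mul_pow, ← ENNReal.rpow_mul_natCast, ← ENNReal.rpow_mul_natCast]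
          norm_num
  have hsq : ∀ g : ℝ → E, eLpNorm g 2 volume ^ 2 = ∫⁻ x, ‖g x‖ₑ ^ 2 := by
    intro g
    have := eLpNorm_nnreal_pow_eq_lintegral (μ := (volume : Measure ℝ)) (f := g) (p := 2)
      (by norm_num)
    simpa using this
  have hswap : ∫⁻ x, ∫⁻ r in uIoc 0 δ, ‖f' (x + r) - f' x‖ₑ ^ 2
      = ∫⁻ r in uIoc 0 δ, ∫⁻ x, ‖f' (x + r) - f' x‖ₑ ^ 2 := by
    refine lintegral_lintegral_swap (Measurable.aemeasurable ?_)
    exact (((hm.comp_measurable (measurable_fst.add measurable_snd)).sub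
      (hm.comp_measurable measurable_fst)).enorm).pow_const 2
  have : eLpNorm (fun x => f (x + δ) - f x - δ • f' x) 2 volume ^ 2
      ≤ (ENNReal.ofReal |δ| * ε) ^ 2 := by
    rw [hsq]
    calc _ ≤ ∫⁻ x, ENNReal.ofReal |δ| * ∫⁻ r in uIoc 0 δ, ‖f' (x + r) - f' x‖ₑ ^ 2 :=
          lintegral_mono key
      _ = ENNReal.ofReal |δ| * ∫⁻ r in uIoc 0 δ, ∫⁻ x, ‖f' (x + r) - f' x‖ₑ ^ 2 := by
          rw [lintegral_const_mul' _ _ ENNReal.ofReal_ne_top, hswap]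
      _ ≤ ENNReal.ofReal |δ| * ∫⁻ r in uIoc 0 δ, ε ^ 2 := by
          gcongr 1
          refine setLIntegral_mono' measurableSet_uIoc fun r hr => ?_
          rw [← hsq]
          gcongr
          exact hε r hr
      _ = _ := by
          rw [lintegral_const, Measure.restrict_apply MeasurableSet.univ, univ_inter, hvol]
          ring
  exact (ENNReal.pow_le_pow_left_iff (by norm_num)).1 this

/-- The remainder of the difference quotient is at most `|δ|` times the largest `L²` modulus of
continuity of `f'` for shifts up to `δ`, and this modulus vanishes by strong continuity of
translations. -/
lemma IsPrim.isGen [CompleteSpace E] {f f' : ℝ → E} (h : IsPrim f f') (hf : MemLp f 2 volume)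
    (hf' : MemLp f' 2 volume) : IsGen (cls f) (cls f') := by
  -- A strongly measurable representative is needed for exchanging the integrals over `x` and over
  -- the shift.
  wlog hm : StronglyMeasurable f' generalizing f'
  · have he := hf'.1.ae_eq_mk
    rw [cls_congr he]
    exact this (h.congr_right he) ((memLp_congr_ae he).1 hf') hf'.1.stronglyMeasurable_mk
  unfold IsGen
  rw [hasDerivAt_iff_isLittleO_nhds_zero, Asymptotics.isLittleO_iff]
  intro c hc
  have hcont := (continuous_translate (cls f')).tendsto 0
  rw [translate_zero] at hcont
  obtain ⟨η, hη, hball⟩ := Metric.tendsto_nhds_nhds.1 hcont c hc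
  filter_upwards [Metric.ball_mem_nhds (0 : ℝ) hη] with δ hδ
  have m1 : MemLp (fun x => f (x + δ) - f x) 2 volume := (memLp_translate hf δ).sub hf
  have m2 : MemLp (fun x => δ • f' x) 2 volume := hf'.const_smul δ
  have m3 : MemLp (fun x => f (x + δ) - f x - δ • f' x) 2 volume := m1.sub m2
  rw [zero_add, translate_zero, translate_cls hf, ← cls_smul δ hf',
    ← cls_sub (memLp_translate hf δ) hf, ← cls_sub m1 m2, cls_eq_toLp m3, Lp.norm_toLp,
    Real.norm_eq_abs]
  have hb := h.eLpNorm_remainder_le hm (δ := δ) (ε := ENNReal.ofReal c) (by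
    intro r hr
    have hr' : dist r 0 < η := by
      rw [Metric.mem_ball, Real.dist_eq, sub_zero] at hδ
      rw [Real.dist_eq, sub_zero]
      refine lt_of_le_of_lt ?_ hδ
      rw [mem_uIoc] at hr
      rcases hr with hr | hr
      · rw [abs_of_pos hr.1]; exact hr.2.trans (le_abs_self _)
      · rw [abs_of_nonpos hr.2, abs_of_nonpos (hr.1.le.trans hr.2)]; linarith
    have h1 := hball hr'
    have m4 : MemLp (fun x => f' (x + r) - f' x) 2 volume := (memLp_translate hf' r).sub hf'
    rw [dist_eq_norm, translate_cls hf', ← cls_sub (memLp_translate hf' r) hf',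
      cls_eq_toLp m4, Lp.norm_toLp] at h1
    rw [← ENNReal.ofReal_toReal m4.eLpNorm_ne_top]
    exact ENNReal.ofReal_le_ofReal h1.le)
  refine (ENNReal.toReal_mono (by finiteness) hb).trans (le_of_eq ?_)
  rw [ENNReal.toReal_mul, ENNReal.toReal_ofReal (abs_nonneg _), ENNReal.toReal_ofReal hc.le,
    mul_comm]

end LTwo

/-! ### The rotation `𝒥`, and multiplication by bounded fields, as operators on `L²`. -/

section RotationAndProducts

/-- The matrix `𝒥` as a continuous linear map. -/
def JL : E2 →L[ℝ] E2 :=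
  LinearMap.toContinuousLinearMap
    { toFun := J
      map_add' := fun u v => by
        ext i; fin_cases i
        · simp [J, add_comm]
        · rfl
      map_smul' := fun c u => by ext i; fin_cases i <;> simp [J] }

@[simp] lemma JL_apply (u : E2) : JL u = J u := rfl

lemma inner_eq (u v : E2) : ⟪u, v⟫_ℝ = u 0 * v 0 + u 1 * v 1 := by
  simp [PiLp.inner_apply, Fin.sum_univ_two]; ring

lemma inner_J_left (u v : E2) : ⟪J u, v⟫_ℝ = -⟪u, J v⟫_ℝ := by
  simp [inner_eq, J]

lemma inner_J_self (u : E2) : ⟪u, J u⟫_ℝ = 0 := by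
  simp [inner_eq, J]; ring

lemma norm_J (u : E2) : ‖J u‖ = ‖u‖ := by
  rw [EuclideanSpace.norm_eq, EuclideanSpace.norm_eq]
  simp [J, Fin.sum_univ_two, add_comm]

/-- The real inner product of the plane as a continuous bilinear map. -/
def innerB : E2 →L[ℝ] E2 →L[ℝ] ℝ :=
  LinearMap.mkContinuous₂ (innerₗ E2) 1 fun u v => by
    simpa using norm_inner_le_norm (𝕜 := ℝ) u v

@[simp] lemma innerB_apply (u v : E2) : innerB u v = ⟪u, v⟫_ℝ := rfl

lemma norm_innerB_le : ‖innerB‖ ≤ 1 := LinearMap.mkContinuous₂_norm_le _ zero_le_one _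

/-- `L²(ℝ; ℝ²)`. -/
abbrev L2E := Lp E2 2 (volume : Measure ℝ)

/-- `𝒥` acting on `L²(ℝ; ℝ²)`. -/
def Jop : L2E →L[ℝ] L2E := JL.compLpL 2 volume

lemma memLp_J {f : ℝ → E2} (hf : MemLp f 2 volume) : MemLp (fun x => J (f x)) 2 volume :=
  JL.comp_memLp' hf

lemma Jop_cls {f : ℝ → E2} (hf : MemLp f 2 volume) : Jop (cls f) = cls fun x => J (f x) := by
  refine (cls_eq_of_ae _ ?_).symm
  filter_upwards [JL.coeFn_compLp (cls f), coeFn_cls hf] with x h1 h2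
  exact h1.trans (by rw [h2]; rfl)

lemma inner_Jop_left (F G : L2E) : ⟪Jop F, G⟫_ℝ = -⟪F, Jop G⟫_ℝ := by
  obtain ⟨f, hf, rfl⟩ := exists_eq_cls F
  obtain ⟨g, hg, rfl⟩ := exists_eq_cls G
  rw [Jop_cls hf, Jop_cls hg, inner_cls (memLp_J hf) hg, inner_cls hf (memLp_J hg),
    ← integral_neg]
  simp only [inner_J_left]

lemma translate_Jop (y : ℝ) (F : L2E) : translate y (Jop F) = Jop (translate y F) := by
  obtain ⟨f, hf, rfl⟩ := exists_eq_cls F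
  rw [Jop_cls hf, translate_cls (memLp_J hf), translate_cls hf, Jop_cls (memLp_translate hf y)]

lemma dquot_Jop (h : ℝ) (F : L2E) : dquot h (Jop F) = Jop (dquot h F) := by
  simp only [dquot_apply, translate_Jop, map_smul, map_sub]

open Classical in
/-- The class of `m` in `L^∞(ℝ; ℝ²)` (zero if `m` is not essentially bounded). -/
def clsTop (m : ℝ → E2) : Lp E2 ∞ (volume : Measure ℝ) :=
  if h : MemLp m ∞ volume then h.toLp m else 0

lemma clsTop_eq_toLp {m : ℝ → E2} (h : MemLp m ∞ volume) : clsTop m = h.toLp m := dif_pos h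

lemma coeFn_clsTop {m : ℝ → E2} (h : MemLp m ∞ volume) : clsTop m =ᵐ[volume] m := by
  rw [clsTop_eq_toLp h]; exact h.coeFn_toLp

lemma norm_clsTop_le {m : ℝ → E2} (h : MemLp m ∞ volume) {M : ℝ} (hM : 0 ≤ M)
    (hm : ∀ x, ‖m x‖ ≤ M) : ‖clsTop m‖ ≤ M := by
  rw [clsTop_eq_toLp h, Lp.norm_toLp]
  refine ENNReal.toReal_le_of_le_ofReal hM ?_
  rw [eLpNorm_exponent_top]
  exact eLpNormEssSup_le_of_ae_bound (Eventually.of_forall hm)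

/-- The product of `L^∞` and `L²` fields of the plane given by the inner product. -/
def mulB : Lp E2 ∞ (volume : Measure ℝ) →L[ℝ] L2E →L[ℝ] Lp ℝ 2 (volume : Measure ℝ) :=
  innerB.holderL volume ∞ 2 2

/-- The operator `F ↦ ⟪m, F⟫` from `L²(ℝ; ℝ²)` to `L²(ℝ)`. -/
def mulInner (m : ℝ → E2) : L2E →L[ℝ] Lp ℝ 2 (volume : Measure ℝ) := mulB (clsTop m)

lemma norm_mulInner_le {m : ℝ → E2} (h : MemLp m ∞ volume) {M : ℝ} (hM : 0 ≤ M)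
    (hm : ∀ x, ‖m x‖ ≤ M) (F : L2E) : ‖mulInner m F‖ ≤ M * ‖F‖ := by
  have h1 : ‖mulInner m F‖ ≤ ‖innerB‖ * ‖clsTop m‖ * ‖F‖ :=
    innerB.norm_holder_apply_apply_le (clsTop m) F
  refine h1.trans ?_
  have := norm_clsTop_le h hM hm
  have h2 := norm_innerB_le
  gcongr
  calc ‖innerB‖ * ‖clsTop m‖ ≤ 1 * M := by gcongr
    _ = M := one_mul M

lemma memLp_inner {m f : ℝ → E2} (hm : MemLp m ∞ volume) (hf : MemLp f 2 volume) :
    MemLp (fun x => ⟪m x, f x⟫_ℝ) 2 volume :=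
  innerB.memLp_of_bilin 2 hm hf

lemma mulInner_cls {m f : ℝ → E2} (hm : MemLp m ∞ volume) (hf : MemLp f 2 volume) :
    mulInner m (cls f) = cls fun x => ⟪m x, f x⟫_ℝ := by
  refine (cls_eq_of_ae _ ?_).symm
  filter_upwards [innerB.coeFn_holder (r := 2) (clsTop m) (cls f), coeFn_clsTop hm,
    coeFn_cls hf] with x h1 h2 h3
  refine h1.trans ?_
  rw [h2, h3]; rfl

/-- `m` is bounded by `M` and is an indefinite integral of `m'`, which is continuous and bounded
by `M`. -/
structure IsC1Bdd (M : ℝ) (m m' : ℝ → E2) : Prop where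
  prim : IsPrim m m'
  cont : Continuous m'
  le : ∀ x, ‖m x‖ ≤ M
  le' : ∀ x, ‖m' x‖ ≤ M

namespace IsC1Bdd

variable {M : ℝ} {m m' : ℝ → E2}

lemma memLp (h : IsC1Bdd M m m') : MemLp m ∞ volume :=
  memLp_top_of_bound h.prim.continuous.aestronglyMeasurable M (Eventually.of_forall h.le)

lemma memLp' (h : IsC1Bdd M m m') : MemLp m' ∞ volume :=
  memLp_top_of_bound h.cont.aestronglyMeasurable M (Eventually.of_forall h.le')

lemma J (h : IsC1Bdd M m m') : IsC1Bdd M (fun x => LLE.J (m x)) (fun x => LLE.J (m' x)) :=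
  ⟨h.prim.clm JL, JL.continuous.comp h.cont, fun x => by rw [norm_J]; exact h.le x,
    fun x => by rw [norm_J]; exact h.le' x⟩

lemma nonneg (h : IsC1Bdd M m m') : 0 ≤ M := (norm_nonneg _).trans (h.le 0)

end IsC1Bdd

/-- `f ∈ H¹` with weak derivative `f'`. -/
structure IsH1 {E : Type*} [NormedAddCommGroup E] [NormedSpace ℝ E] (f f' : ℝ → E) : Prop where
  prim : IsPrim f f'
  memLp : MemLp f 2 volume
  memLp' : MemLp f' 2 volume

/-- The difference quotient of a function with step `h`. -/
def dq {E : Type*} [NormedAddCommGroup E] [NormedSpace ℝ E] (h : ℝ) (f : ℝ → E) : ℝ → E :=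
  fun x => h⁻¹ • (f (x + h) - f x)

section DifferenceQuotient

variable {E : Type*} [NormedAddCommGroup E] [NormedSpace ℝ E]

lemma memLp_dq {f : ℝ → E} (h : ℝ) (hf : MemLp f 2 volume) : MemLp (dq h f) 2 volume :=
  ((memLp_translate hf h).sub hf).const_smul h⁻¹

lemma cls_dq {f : ℝ → E} (h : ℝ) (hf : MemLp f 2 volume) : cls (dq h f) = dquot h (cls f) := by
  have m1 : MemLp (fun x => f (x + h) - f x) 2 volume := (memLp_translate hf h).sub hf
  rw [dquot_apply, translate_cls hf, ← cls_sub (memLp_translate hf h) hf, ← cls_smul _ m1]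
  rfl

lemma IsH1.isGen [CompleteSpace E] {f f' : ℝ → E} (h : IsH1 f f') : IsGen (cls f) (cls f') :=
  h.prim.isGen h.memLp h.memLp'

lemma IsH1.dq [CompleteSpace E] {f f' : ℝ → E} (hf : IsH1 f f') (h : ℝ) :
    IsH1 (dq h f) (LLE.dq h f') :=
  ⟨((hf.prim.comp_add_const h).sub hf.prim).const_smul _, memLp_dq h hf.memLp,
    memLp_dq h hf.memLp'⟩

end DifferenceQuotient

lemma IsH1.inner {M : ℝ} {m m' f f' : ℝ → E2} (hm : IsC1Bdd M m m') (hf : IsH1 f f') :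
    IsH1 (fun x => ⟪m x, f x⟫_ℝ) (fun x => ⟪m' x, f x⟫_ℝ + ⟪m x, f' x⟫_ℝ) :=
  ⟨hm.prim.bilin innerB hf.prim, memLp_inner hm.memLp hf.memLp,
    (memLp_inner hm.memLp' hf.memLp).add (memLp_inner hm.memLp hf.memLp')⟩

lemma IsH1.isGen_mulInner {M : ℝ} {m m' f f' : ℝ → E2} (hm : IsC1Bdd M m m') (hf : IsH1 f f') :
    IsGen (mulInner m (cls f)) (mulInner m' (cls f) + mulInner m (cls f')) := by
  rw [mulInner_cls hm.memLp hf.memLp, mulInner_cls hm.memLp' hf.memLp,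
    mulInner_cls hm.memLp hf.memLp', ← cls_add (memLp_inner hm.memLp' hf.memLp)
    (memLp_inner hm.memLp hf.memLp')]
  exact (hf.inner hm).isGen

/-- Moving `𝒥` onto the multiplier turns the dispersive contribution to the energy correction into a
term that can be integrated by parts. -/
lemma mulInner_Jop {m : ℝ → E2} (hm : MemLp m ∞ volume) (hm' : MemLp (fun x => J (m x)) ∞ volume)
    (F : L2E) : mulInner m (Jop F) = -mulInner (fun x => J (m x)) F := by
  obtain ⟨f, hf, rfl⟩ := exists_eq_cls F
  rw [Jop_cls hf, mulInner_cls hm (memLp_J hf), mulInner_cls hm' hf,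
    ← neg_one_smul ℝ (cls _), ← cls_smul _ (memLp_inner hm' hf)]
  simp [inner_J_left]

end RotationAndProducts

/-! ### The modified energy and its time derivative. -/

section EnergyIdentity

/-- A form of the fundamental theorem of calculus that passes to pointwise limits. -/
lemma integral_eq_sub_of_tendsto {t M : ℝ} {f d : ℝ → ℝ} {fn dn : ℕ → ℝ → ℝ}
    (hcont : ∀ n, ContinuousOn (fn n) (Icc 0 t))
    (hder : ∀ n, ∀ s ∈ Ioo 0 t, HasDerivAt (fn n) (dn n s) s)
    (hb : ∀ n, ∀ s ∈ Ioo 0 t, |dn n s| ≤ M)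
    (hf : ∀ s ∈ Icc 0 t, Tendsto (fun n => fn n s) atTop (𝓝 (f s)))
    (hd : ∀ s ∈ Ioo 0 t, Tendsto (fun n => dn n s) atTop (𝓝 (d s))) :
    ∀ s ∈ Icc 0 t, IntervalIntegrable d volume 0 s ∧ f s - f 0 = ∫ r in (0 : ℝ)..s, d r := by
  intro s hs
  have hsub : Ioo 0 s ⊆ Ioo 0 t := Ioo_subset_Ioo_right hs.2
  have hae : ∀ᵐ r ∂(volume.restrict (uIoc 0 s)), r ∈ Ioo 0 s := by
    rw [uIoc_of_le hs.1, ← Measure.restrict_congr_set Ioo_ae_eq_Ioc]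
    exact ae_restrict_mem measurableSet_Ioo
  have : IsFiniteMeasure (volume.restrict (uIoc 0 s)) := by
    rw [uIoc_of_le hs.1]; infer_instance
  -- No measurability in time is assumed: each `dn n` agrees on the open interval with a derivative,
  -- which is measurable, and `d` inherits this as a limit.
  have hmeas : ∀ n, AEStronglyMeasurable (dn n) (volume.restrict (uIoc 0 s)) := by
    intro n
    refine (stronglyMeasurable_deriv (fn n)).aestronglyMeasurable.congr ?_
    filter_upwards [hae] with r hr using (hder n r (hsub hr)).deriv
  have hbn : ∀ n, ∀ᵐ r ∂(volume.restrict (uIoc 0 s)), ‖dn n r‖ ≤ M := by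
    intro n
    filter_upwards [hae] with r hr using hb n r (hsub hr)
  have hlim : ∀ᵐ r ∂(volume.restrict (uIoc 0 s)),
      Tendsto (fun n => dn n r) atTop (𝓝 (d r)) := by
    filter_upwards [hae] with r hr using hd r (hsub hr)
  have hint : ∀ n, IntervalIntegrable (dn n) volume 0 s := by
    intro n
    rw [intervalIntegrable_iff]
    exact Integrable.of_bound (hmeas n) M (hbn n)
  have hintd : IntervalIntegrable d volume 0 s := by
    rw [intervalIntegrable_iff]
    refine Integrable.of_bound (aestronglyMeasurable_of_tendsto_ae atTop hmeas hlim) M ?_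
    have : ∀ᵐ r ∂(volume.restrict (uIoc 0 s)), ∀ n, ‖dn n r‖ ≤ M := ae_all_iff.2 hbn
    filter_upwards [this, hlim] with r h1 h2
    exact le_of_tendsto h2.norm (Eventually.of_forall h1)
  refine ⟨hintd, ?_⟩
  have h1 : ∀ n, ∫ r in (0 : ℝ)..s, dn n r = fn n s - fn n 0 := fun n =>
    intervalIntegral.integral_eq_sub_of_hasDerivAt_of_le hs.1
      ((hcont n).mono (Icc_subset_Icc_right hs.2)) (fun r hr => hder n r (hsub hr)) (hint n)
  have h2 : Tendsto (fun n => ∫ r in (0 : ℝ)..s, dn n r) atTop (𝓝 (∫ r in (0 : ℝ)..s, d r)) := by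
    simp only [intervalIntegral.integral_of_le hs.1]
    rw [uIoc_of_le hs.1] at hmeas hbn hlim
    exact tendsto_integral_of_dominated_convergence (fun _ => M) hmeas
      (integrable_const _) hbn hlim
  simp only [h1] at h2
  exact tendsto_nhds_unique ((hf s hs).sub (hf 0 ⟨le_rfl, hs.1.trans hs.2⟩)) h2

/-- The density of the time derivative of the modified energy `‖∂ₓ³z‖² + 2β ‖⟪u, ∂ₓ²z⟫‖²`, with
`P = ∂ₓ²z`, `Q = Z = ∂ₓ³z` and `G₂, G₃` the derivatives of the inhomogeneity. -/
def energyRate (β : ℝ) (u ut ux : ℝ → E2) (P Q Z G₂ G₃ : L2E) : ℝ :=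
  2 * ⟪Z, G₃⟫_ℝ
    + 4 * β * (⟪mulInner u P, mulInner ut P⟫_ℝ + ⟪mulInner u P, mulInner u G₂⟫_ℝ)
    - 4 * β ^ 2 * (⟪mulInner ux P + mulInner u Q, mulInner (fun x => J (u x)) Q⟫_ℝ
      + ⟪mulInner u P, mulInner (fun x => J (ux x)) Q⟫_ℝ)

/-- A crude bound that will hold uniformly in the step of the difference quotients; it is the
dominating constant for the limit in `energy_identity`. -/
lemma abs_energyRate_le {β N : ℝ} {u ut ux : ℝ → E2} (hu : IsC1Bdd N u ux)
    (hut : MemLp ut ∞ volume) (hutN : ∀ x, ‖ut x‖ ≤ N) {P Q Z G₂ G₃ : L2E}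
    (hP : ‖P‖ ≤ N) (hQ : ‖Q‖ ≤ N) (hZ : ‖Z‖ ≤ N) (hG₂ : ‖G₂‖ ≤ N) (hG₃ : ‖G₃‖ ≤ N) :
    |energyRate β u ut ux P Q Z G₂ G₃|
      ≤ 2 * N ^ 2 + 4 * |β| * (2 * N ^ 4) + 4 * β ^ 2 * (3 * N ^ 4) := by
  have hN := hu.nonneg
  have b : ∀ {m : ℝ → E2}, MemLp m ∞ volume → (∀ x, ‖m x‖ ≤ N) → ∀ {F : L2E}, ‖F‖ ≤ N →
      ‖mulInner m F‖ ≤ N ^ 2 := by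
    intro m hm hmN F hF
    refine (norm_mulInner_le hm hN hmN F).trans ?_
    rw [sq]; gcongr
  have ip : ∀ {E : Type} [NormedAddCommGroup E] [InnerProductSpace ℝ E] {x y : E} {c d : ℝ},
      ‖x‖ ≤ c → ‖y‖ ≤ d → |⟪x, y⟫_ℝ| ≤ c * d := by
    intro E _ _ x y c d hx hy
    exact (abs_real_inner_le_norm x y).trans
      (mul_le_mul hx hy (norm_nonneg _) ((norm_nonneg _).trans hx))
  have a1 := ip hZ hG₃
  have a2 := ip (b hu.memLp hu.le hP) (b hut hutN hP)
  have a3 := ip (b hu.memLp hu.le hP) (b hu.memLp hu.le hG₂)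
  have a4 := ip ((norm_add_le _ _).trans (add_le_add (b hu.memLp' hu.le' hP)
    (b hu.memLp hu.le hQ))) (b hu.J.memLp hu.J.le hQ)
  have a5 := ip (b hu.memLp hu.le hP) (b hu.J.memLp' hu.J.le' hQ)
  unfold energyRate
  refine (abs_sub _ _).trans (add_le_add ((abs_add_le _ _).trans (add_le_add ?_ ?_)) ?_)
  · rw [abs_mul, abs_two]; nlinarith
  · rw [abs_mul, abs_mul, abs_of_pos (by norm_num : (0 : ℝ) < 4)]
    gcongr
    exact (abs_add_le _ _).trans (by nlinarith)
  · rw [abs_mul, abs_of_nonneg (by positivity : 0 ≤ 4 * β ^ 2)]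
    gcongr
    exact (abs_add_le _ _).trans (by nlinarith)

/-- The energy identity for solutions of `z_t = -β 𝒥 z_xx + g` with `z` in `H³` and `g` in `H³`. -/
theorem energy_identity {t β N : ℝ} {Z : ℝ → L2E} {z₀ z₁ z₂ z₃ g₀ g₁ g₂ g₃ u ut ux : ℝ → ℝ → E2}
    (hZ : ∀ s, Z s = cls (z₀ s))
    (hu : ∀ s ∈ Icc 0 t, IsC1Bdd N (u s) (ux s))
    (hut : ∀ s ∈ Icc 0 t, MemLp (ut s) ∞ volume ∧ ∀ x, ‖ut s x‖ ≤ N)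
    (hdu : ∀ s ∈ Icc 0 t,
      HasDerivWithinAt (fun s => clsTop (u s)) (clsTop (ut s)) (Icc 0 t) s)
    (hz₁ : ∀ s ∈ Icc 0 t, IsH1 (z₀ s) (z₁ s)) (hz₂ : ∀ s ∈ Icc 0 t, IsH1 (z₁ s) (z₂ s))
    (hz₃ : ∀ s ∈ Icc 0 t, IsH1 (z₂ s) (z₃ s))
    (hg₁ : ∀ s ∈ Icc 0 t, IsH1 (g₀ s) (g₁ s)) (hg₂ : ∀ s ∈ Icc 0 t, IsH1 (g₁ s) (g₂ s))
    (hg₃ : ∀ s ∈ Icc 0 t, IsH1 (g₂ s) (g₃ s))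
    (hdz : ∀ s ∈ Icc 0 t, HasDerivWithinAt Z (-β • Jop (cls (z₂ s)) + cls (g₀ s)) (Icc 0 t) s)
    (bz₂ : ∀ s ∈ Icc 0 t, ‖cls (z₂ s)‖ ≤ N) (bz₃ : ∀ s ∈ Icc 0 t, ‖cls (z₃ s)‖ ≤ N)
    (bg₂ : ∀ s ∈ Icc 0 t, ‖cls (g₂ s)‖ ≤ N) (bg₃ : ∀ s ∈ Icc 0 t, ‖cls (g₃ s)‖ ≤ N) :
    ∀ s ∈ Icc 0 t,
      IntervalIntegrable (fun r => energyRate β (u r) (ut r) (ux r) (cls (z₂ r)) (cls (z₃ r))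
        (cls (z₃ r)) (cls (g₂ r)) (cls (g₃ r))) volume 0 s ∧
      (‖cls (z₃ s)‖ ^ 2 + 2 * β * ‖mulInner (u s) (cls (z₂ s))‖ ^ 2)
        - (‖cls (z₃ 0)‖ ^ 2 + 2 * β * ‖mulInner (u 0) (cls (z₂ 0))‖ ^ 2)
        = ∫ r in (0 : ℝ)..s, energyRate β (u r) (ut r) (ux r) (cls (z₂ r)) (cls (z₃ r))
            (cls (z₃ r)) (cls (g₂ r)) (cls (g₃ r)) := by
  have hη : Tendsto (fun n : ℕ => (1 : ℝ) / (n + 1)) atTop (𝓝[≠] 0) := by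
    refine tendsto_nhdsWithin_iff.2 ⟨tendsto_one_div_add_atTop_nhds_zero_nat,
      Eventually.of_forall fun n => ?_⟩
    exact (Nat.one_div_pos_of_nat (α := ℝ)).ne'
  set D : ℕ → L2E →L[ℝ] L2E := fun n => dquot (1 / ((n : ℝ) + 1)) with hD
  have lim2 : ∀ {F F₁ F₂ : L2E}, IsGen F F₁ → IsGen F₁ F₂ →
      Tendsto (fun n => D n (D n F)) atTop (𝓝 F₂) := fun h1 h2 =>
    (IsGen.tendsto_dquot_two h1 h2).comp hη
  have lim3 : ∀ {F F₁ F₂ F₃ : L2E}, IsGen F F₁ → IsGen F₁ F₂ → IsGen F₂ F₃ →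
      Tendsto (fun n => D n (D n (D n F))) atTop (𝓝 F₃) := fun h1 h2 h3 =>
    (IsGen.tendsto_dquot_three h1 h2 h3).comp hη
  have bd2 : ∀ {F F₁ F₂ : L2E}, IsGen F F₁ → IsGen F₁ F₂ → ∀ n, ‖D n (D n F)‖ ≤ ‖F₂‖ :=
    fun h1 h2 n => ((h1.dquot _).norm_dquot_le _).trans (h2.norm_dquot_le _)
  have bd3 : ∀ {F F₁ F₂ F₃ : L2E}, IsGen F F₁ → IsGen F₁ F₂ → IsGen F₂ F₃ →
      ∀ n, ‖D n (D n (D n F))‖ ≤ ‖F₃‖ :=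
    fun h1 h2 h3 n => ((((h1.dquot _).dquot _).norm_dquot_le _).trans
      ((h2.dquot _).norm_dquot_le _)).trans (h3.norm_dquot_le _)
  refine integral_eq_sub_of_tendsto
    (M := 2 * N ^ 2 + 4 * |β| * (2 * N ^ 4) + 4 * β ^ 2 * (3 * N ^ 4))
    -- The energy with space derivatives replaced by difference quotients. It involves only bounded
    -- operators, hence is differentiable in time along the `L²` curve `Z`.
    (fn := fun n s => ‖D n (D n (D n (Z s)))‖ ^ 2
      + 2 * β * ‖mulB (clsTop (u s)) (D n (D n (Z s)))‖ ^ 2)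
    -- At the discrete level `∂ₓ³z` has two approximations, `D² z₁` from the integration by parts
    -- and `D³ z₀` from the energy; `energyRate` therefore takes them as separate arguments.
    (dn := fun n s => energyRate β (u s) (ut s) (ux s) (D n (D n (cls (z₀ s))))
      (D n (D n (cls (z₁ s)))) (D n (D n (D n (cls (z₀ s))))) (D n (D n (cls (g₀ s))))
      (D n (D n (D n (cls (g₀ s)))))) ?_ ?_ ?_ ?_ ?_
  · intro n
    have c1 : ContinuousOn Z (Icc 0 t) := fun s hs => (hdz s hs).continuousWithinAt
    have c2 : ContinuousOn (fun s => clsTop (u s)) (Icc 0 t) :=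
      fun s hs => (hdu s hs).continuousWithinAt
    have c3 := mulB.continuous.comp_continuousOn c2
    have c4 : ContinuousOn (fun s => D n (D n (Z s))) (Icc 0 t) :=
      ((D n).comp (D n)).continuous.comp_continuousOn c1
    have c5 := (D n).continuous.comp_continuousOn c4
    exact (c5.norm.pow 2).add (((c3.clm_apply c4).norm.pow 2).const_smul (2 * β))
  · intro n s hs
    have hs' : s ∈ Icc 0 t := Ioo_subset_Icc_self hs
    have hnb : Icc 0 t ∈ 𝓝 s := Icc_mem_nhds hs.1 hs.2
    have d1 := (hdz s hs').hasDerivAt hnb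
    have d2 := (hdu s hs').hasDerivAt hnb
    have d3 := ((D n).comp (D n)).hasFDerivAt.comp_hasDerivAt s d1
    have d4 := (D n).hasFDerivAt.comp_hasDerivAt s d3
    have d5 := mulB.hasDerivWithinAt_of_bilinear d2.hasDerivWithinAt d3.hasDerivWithinAt (s := univ)
    rw [hasDerivWithinAt_univ] at d5
    have d6 := d4.norm_sq.add (d5.norm_sq.const_mul (2 * β))
    refine HasDerivAt.congr_deriv d6 ?_
    set η := 1 / ((n : ℝ) + 1) with hηn
    simp only [Function.comp_apply, ContinuousLinearMap.comp_apply, hZ, map_add, map_smul]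
    have hJ : ∀ F, D n (Jop F) = Jop (D n F) := fun F => dquot_Jop _ F
    simp only [hJ]
    have m0 := (hz₁ s hs').memLp
    have m1 := (hz₂ s hs').memLp
    have m2 := (hz₃ s hs').memLp
    have e : ∀ {f : ℝ → E2}, MemLp f 2 volume → cls (dq η (dq η f)) = D n (D n (cls f)) :=
      fun hf => by rw [cls_dq _ (memLp_dq _ hf), cls_dq _ hf]
    -- the leading term is skew
    have k1 : ⟪D n (D n (D n (cls (z₀ s)))), Jop (D n (D n (D n (cls (z₂ s)))))⟫_ℝ = 0 := by
      have g1 := ((((hz₁ s hs').isGen).dquot η).dquot η).dquot η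
      have g2 := ((((hz₂ s hs').isGen).dquot η).dquot η).dquot η
      have g3 := g2.clm Jop translate_Jop
      have := g1.inner_add_inner g3
      have h0 : ∀ F : L2E, ⟪F, Jop F⟫_ℝ = 0 := fun F => by
        have := inner_Jop_left F F
        rw [real_inner_comm] at this
        linarith
      rw [h0, zero_add] at this
      exact this
    -- The factor `D² z₂` would tend to a fourth derivative, which `z` need not have. Integration by
    -- parts replaces it by `D² z₁`.
    have k2 : ⟪mulInner (u s) (D n (D n (cls (z₀ s)))),
        mulInner (fun x => J (u s x)) (D n (D n (cls (z₂ s))))⟫_ℝ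
        = -(⟪mulInner (ux s) (D n (D n (cls (z₀ s)))) + mulInner (u s) (D n (D n (cls (z₁ s)))),
            mulInner (fun x => J (u s x)) (D n (D n (cls (z₁ s))))⟫_ℝ
          + ⟪mulInner (u s) (D n (D n (cls (z₀ s)))),
            mulInner (fun x => J (ux s x)) (D n (D n (cls (z₁ s))))⟫_ℝ) := by
      have g1 := (((hz₁ s hs').dq η).dq η).isGen_mulInner (hu s hs')
      have g2 := (((hz₂ s hs').dq η).dq η).isGen_mulInner (hu s hs').J
      have := g1.inner_add_inner g2
      rw [e m0, e m1, e m2, inner_add_right] at this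
      linarith
    have k3 : mulB (clsTop (u s)) (Jop (D n (D n (cls (z₂ s)))))
        = -mulInner (fun x => J (u s x)) (D n (D n (cls (z₂ s)))) :=
      mulInner_Jop (hu s hs').memLp (hu s hs').J.memLp _
    simp only [inner_add_right, inner_smul_right, k3, inner_neg_right]
    change _ = energyRate _ _ _ _ _ _ _ _ _
    unfold energyRate
    have k2' : ⟪mulB (clsTop (u s)) (D n (D n (cls (z₀ s)))),
        mulInner (fun x => J (u s x)) (D n (D n (cls (z₂ s))))⟫_ℝ = _ := k2
    rw [k1, k2']
    simp only [mulInner]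
    ring
  · intro n s hs
    have hs' : s ∈ Icc 0 t := Ioo_subset_Icc_self hs
    have z1 := (hz₁ s hs').isGen
    have z2 := (hz₂ s hs').isGen
    have z3 := (hz₃ s hs').isGen
    have g1 := (hg₁ s hs').isGen
    have g2 := (hg₂ s hs').isGen
    have g3 := (hg₃ s hs').isGen
    exact abs_energyRate_le (hu s hs') (hut s hs').1 (hut s hs').2
      ((bd2 z1 z2 n).trans (bz₂ s hs')) ((bd2 z2 z3 n).trans (bz₃ s hs'))
      ((bd3 z1 z2 z3 n).trans (bz₃ s hs')) ((bd2 g1 g2 n).trans (bg₂ s hs'))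
      ((bd3 g1 g2 g3 n).trans (bg₃ s hs'))
  · intro s hs
    have z1 := (hz₁ s hs).isGen
    have z2 := (hz₂ s hs).isGen
    have z3 := (hz₃ s hs).isGen
    simp only [hZ]
    exact ((lim3 z1 z2 z3).norm.pow 2).add
      (((((mulInner (u s)).continuous.tendsto _).comp (lim2 z1 z2)).norm.pow 2).const_mul (2 * β))
  · intro s hs
    have hs' : s ∈ Icc 0 t := Ioo_subset_Icc_self hs
    have z1 := (hz₁ s hs').isGen
    have z2 := (hz₂ s hs').isGen
    have z3 := (hz₃ s hs').isGen
    have g1 := (hg₁ s hs').isGen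
    have g2 := (hg₂ s hs').isGen
    have g3 := (hg₃ s hs').isGen
    have m : ∀ (w : ℝ → E2) {F : ℕ → L2E} {F' : L2E}, Tendsto F atTop (𝓝 F') →
      Tendsto (fun n => mulInner w (F n)) atTop (𝓝 (mulInner w F')) := fun w _ _ h =>
        ((mulInner w).continuous.tendsto _).comp h
    have lP := lim2 z1 z2
    have lQ := lim2 z2 z3
    have lZ := lim3 z1 z2 z3
    have lG := lim2 g1 g2
    have lG3 := lim3 g1 g2 g3
    unfold energyRate
    exact (((lZ.inner lG3).const_mul 2).add
      ((((m _ lP).inner (m _ lP)).add ((m _ lP).inner (m _ lG))).const_mul (4 * β))).sub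
      (((((m _ lP).add (m _ lQ)).inner (m _ lQ)).add
        ((m _ lP).inner (m _ lQ))).const_mul (4 * β ^ 2))

end EnergyIdentity

/-! ### Sobolev norms as sums of norms of `L²` classes. -/

section NormsOfClasses

variable {E : Type*} [NormedAddCommGroup E]

lemma cls_finsetSum {ι : Type*} (s : Finset ι) {g : ι → ℝ → E}
    (hg : ∀ i ∈ s, MemLp (g i) 2 volume) :
    MemLp (fun x => ∑ i ∈ s, g i x) 2 volume ∧
      cls (fun x => ∑ i ∈ s, g i x) = ∑ i ∈ s, cls (g i) := by
  classical
  induction s using Finset.induction_on with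
  | empty =>
    have h0 : MemLp (fun _ : ℝ => (0 : E)) 2 volume := MemLp.zero'
    refine ⟨by simp, ?_⟩
    simp only [Finset.sum_empty]
    have := cls_sub h0 h0
    simpa using this
  | insert a s ha ih =>
    have h1 := hg a (Finset.mem_insert_self a s)
    have h2 := ih fun i hi => hg i (Finset.mem_insert_of_mem hi)
    simp only [Finset.sum_insert ha]
    exact ⟨h1.add h2.1, by rw [cls_add h1 h2.1, h2.2]⟩

lemma memLp_and_norm_cls_le_sum {ι : Type*} (s : Finset ι) {f : ℝ → E} {g : ι → ℝ → ℝ} {c : ι → ℝ}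
    (hf : AEStronglyMeasurable f volume) (hc : ∀ i ∈ s, 0 ≤ c i)
    (hg : ∀ i ∈ s, MemLp (g i) 2 volume) (h : ∀ᵐ x, ‖f x‖ ≤ ∑ i ∈ s, c i * |g i x|) :
    MemLp f 2 volume ∧ ‖cls f‖ ≤ ∑ i ∈ s, c i * ‖cls (g i)‖ := by
  have h1 : ∀ i ∈ s, MemLp (fun x => c i • |g i x|) 2 volume := fun i hi =>
    (hg i hi).abs.const_smul (c i)
  have h2 := cls_finsetSum s h1
  have h0 : ∀ x, 0 ≤ ∑ i ∈ s, c i * |g i x| := fun x =>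
    Finset.sum_nonneg fun i hi => mul_nonneg (hc i hi) (abs_nonneg _)
  have h3 : ∀ᵐ x, ‖f x‖ ≤ ‖∑ i ∈ s, c i • |g i x|‖ := by
    filter_upwards [h] with x hx
    rw [Real.norm_eq_abs]
    exact hx.trans (le_abs_self _)
  have hfm : MemLp f 2 volume := h2.1.of_le hf h3
  refine ⟨hfm, (norm_cls_le hfm h2.1 h3).trans ?_⟩
  rw [h2.2]
  refine (norm_sum_le _ _).trans (Finset.sum_le_sum fun i hi => ?_)
  have ha : MemLp (fun x => |g i x|) 2 volume := (hg i hi).abs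
  rw [cls_smul (c i) ha, norm_smul, Real.norm_of_nonneg (hc i hi)]
  exact mul_le_mul_of_nonneg_left (norm_cls_le ha (hg i hi)
    (Eventually.of_forall fun x => by simp)) (hc i hi)

variable [NormedSpace ℝ E] [CompleteSpace E]

lemma hNorm_nonneg (k : ℕ) (f : ℝ → E) : 0 ≤ hNorm k f := Real.sqrt_nonneg _

lemma hPerNorm_nonneg (T : ℝ) (k : ℕ) (f : ℝ → E) : 0 ≤ hPerNorm T k f := Real.sqrt_nonneg _

lemma hNorm_sq {k : ℕ} {f : ℝ → E} (hf : f ∈ HSpace k) :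
    hNorm k f ^ 2 = ∑ j ∈ Finset.range (k + 1), ‖cls (iteratedDeriv j f)‖ ^ 2 := by
  rw [hNorm, Real.sq_sqrt (Finset.sum_nonneg fun _ _ => integral_nonneg fun _ => by positivity)]
  exact Finset.sum_congr rfl fun j hj =>
    (norm_cls_sq (hf.2 j (Nat.lt_succ_iff.1 (Finset.mem_range.1 hj)))).symm

lemma norm_cls_iteratedDeriv_le {k j : ℕ} (hj : j ≤ k) {f : ℝ → E} (hf : f ∈ HSpace k) :
    ‖cls (iteratedDeriv j f)‖ ≤ hNorm k f := by
  refine le_trans (le_of_eq ?_) (sqrt_integral_le_hNorm hj f)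
  rw [← norm_cls_sq (hf.2 j hj), Real.sqrt_sq (norm_nonneg _)]

lemma norm_cls_le_hNorm {k : ℕ} {f : ℝ → E} (hf : f ∈ HSpace k) : ‖cls f‖ ≤ hNorm k f := by
  simpa using norm_cls_iteratedDeriv_le (Nat.zero_le k) hf

lemma HSpace.memLp {k : ℕ} {f : ℝ → E} (hf : f ∈ HSpace k) : MemLp f 2 volume := by
  simpa using hf.2 0 (Nat.zero_le k)

lemma cls_iteratedDeriv_sub {k j : ℕ} (hj : j ≤ k) {f g : ℝ → E} (hf : f ∈ HSpace k)
    (hg : g ∈ HSpace k) :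
    cls (iteratedDeriv j (f - g)) = cls (iteratedDeriv j f) - cls (iteratedDeriv j g) := by
  rw [← cls_sub (hf.2 j hj) (hg.2 j hj)]
  have := ((HSpace.isJet hf).sub (HSpace.isJet hg)).iteratedDeriv_ae_eq hj
  simp only [iteratedDeriv_zero] at this
  exact cls_congr this

end NormsOfClasses

/-! ### Time differentiability of modulated and composed curves. -/

section Curves

variable {E : Type*} [NormedAddCommGroup E] [NormedSpace ℝ E] [CompleteSpace E]

lemma ContCurve.continuousOn_cls {k j : ℕ} (hj : j ≤ k) {I : Set ℝ} {f : ℝ → ℝ → E}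
    (h : ContCurve (HSpace k) (hNorm k) I f) :
    ContinuousOn (fun s => cls (iteratedDeriv j (f s))) I := by
  intro t ht
  rw [ContinuousWithinAt, tendsto_iff_norm_sub_tendsto_zero]
  refine squeeze_zero' (Eventually.of_forall fun _ => norm_nonneg _) ?_ (h t ht).2
  filter_upwards [self_mem_nhdsWithin] with s hs
  rw [← cls_iteratedDeriv_sub hj (h s hs).1 (h t ht).1]
  exact norm_cls_iteratedDeriv_le hj (HSpace.sub (h s hs).1 (h t ht).1)

lemma hasDerivWithinAt_cls {I : Set ℝ} {f : ℝ → ℝ → E} {f' : ℝ → E} {t : ℝ} (ht : t ∈ I)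
    (hf : ∀ s ∈ I, MemLp (f s) 2 volume) (hf' : MemLp f' 2 volume)
    (h : Tendsto (fun s => ‖cls (fun x => (s - t)⁻¹ • (f s x - f t x) - f' x)‖)
      (𝓝[I \ {t}] t) (𝓝 0)) :
    HasDerivWithinAt (fun s => cls (f s)) (cls f') I t := by
  rw [hasDerivWithinAt_iff_tendsto_slope, tendsto_iff_norm_sub_tendsto_zero]
  refine h.congr' ?_
  filter_upwards [self_mem_nhdsWithin] with s hs
  have m1 : MemLp (fun x => f s x - f t x) 2 volume := (hf s hs.1).sub (hf t ht)
  have m2 : MemLp (fun x => (s - t)⁻¹ • (f s x - f t x)) 2 volume := m1.const_smul _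
  rw [slope_def_module, ← cls_sub (hf s hs.1) (hf t ht), ← cls_smul _ m1, ← cls_sub m2 hf']

lemma C1Curve.hasDerivWithinAt_cls {k : ℕ} {I : Set ℝ} {f ft : ℝ → ℝ → E}
    (h : C1Curve (HSpace k) (hNorm k) I f ft) {t : ℝ} (ht : t ∈ I) :
    HasDerivWithinAt (fun s => cls (f s)) (cls (ft t)) I t := by
  refine LLE.hasDerivWithinAt_cls ht (fun s hs => HSpace.memLp (h.1 s hs).1)
    (HSpace.memLp (h.2.1 t ht).1) ?_
  refine squeeze_zero' (Eventually.of_forall fun _ => norm_nonneg _) ?_ (h.2.2 t ht)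
  filter_upwards [self_mem_nhdsWithin] with s hs
  exact norm_cls_le_hNorm (HSpace.sub (HSpace.const_smul _
    (HSpace.sub (h.1 s hs.1).1 (h.1 t ht).1)) (h.2.1 t ht).1)

lemma IsPrim.norm_sub_le {f f' : ℝ → E} (h : IsPrim f f') {C : ℝ} (hC : ∀ x, ‖f' x‖ ≤ C)
    (a b : ℝ) : ‖f b - f a‖ ≤ C * |b - a| := by
  rw [(h a b).2]
  exact intervalIntegral.norm_integral_le_of_norm_le_const fun x _ => hC x

/-- Taylor's estimate of second order. -/
lemma IsPrim.norm_taylor_le {f f' f'' : ℝ → E} (h : IsPrim f f') (h' : IsPrim f' f'') {C : ℝ}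
    (hC : ∀ x, ‖f'' x‖ ≤ C) (a b : ℝ) : ‖f b - f a - (b - a) • f' a‖ ≤ C * |b - a| * |b - a| := by
  have e : f b - f a - (b - a) • f' a = ∫ x in a..b, (f' x - f' a) := by
    rw [intervalIntegral.integral_sub (h a b).1 intervalIntegrable_const,
      intervalIntegral.integral_const, (h a b).2]
  rw [e]
  refine intervalIntegral.norm_integral_le_of_norm_le_const fun x hx => ?_
  have hC0 : 0 ≤ C := (norm_nonneg _).trans (hC a)
  refine (h'.norm_sub_le hC a x).trans (mul_le_mul_of_nonneg_left ?_ hC0)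
  exact abs_sub_left_of_mem_uIcc (uIoc_subset_uIcc hx)

lemma isPrim_iteratedDeriv {k j : ℕ} (hj : j < k) {f : ℝ → E} (hf : IterAbsCont k f) :
    IsPrim (iteratedDeriv j f) (iteratedDeriv (j + 1) f) := hf j hj

lemma IterAbsCont.isPrim {k : ℕ} (hk : 0 < k) {f : ℝ → E} (hf : IterAbsCont k f) :
    IsPrim f (iteratedDeriv 1 f) := by
  have := hf 0 hk
  simp only [iteratedDeriv_zero] at this
  exact this

/-- The time derivative in `L²` of `w(x + γ(x,t), t) - w(x, t)`. -/
lemma hasDerivWithinAt_cls_comp {T : ℝ} (hT : 0 < T) {I : Set ℝ} {w wt : ℝ → ℝ → E}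
    {γ γt : ℝ → ℝ → ℝ} (hw : C1Curve (HPerSpace T 4) (hPerNorm T 4) I w wt)
    (hγ : C1Curve (HSpace 3) (hNorm 3) I γ γt) {t : ℝ} (ht : t ∈ I) :
    (∀ s ∈ I, MemLp (fun x => w s (x + γ s x) - w s x) 2 volume) ∧
    MemLp (fun x => wt t (x + γ t x) - wt t x + γt t x • iteratedDeriv 1 (w t) (x + γ t x))
      2 volume ∧
    HasDerivWithinAt (fun s => cls (fun x => w s (x + γ s x) - w s x))
      (cls fun x => wt t (x + γ t x) - wt t x + γt t x • iteratedDeriv 1 (w t) (x + γ t x)) I t := by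
  set c := perConst T with hcdef
  have hc : 0 ≤ c := perConst_nonneg hT
  have lip : ∀ {f : ℝ → E}, f ∈ HPerSpace T 4 → ∀ a b, ‖f b - f a‖ ≤ c * hPerNorm T 4 f * |b - a| :=
    fun hf a b => (IterAbsCont.isPrim (by norm_num) hf.2.1).norm_sub_le
      (HPerSpace.norm_iteratedDeriv_le hT (by norm_num) hf) a b
  have hγc : ∀ s ∈ I, Continuous (γ s) := fun s hs =>
    (IterAbsCont.isPrim (by norm_num) (hγ.1 s hs).1.1).continuous
  have hγtc : Continuous (γt t) :=
    (IterAbsCont.isPrim (by norm_num) (hγ.2.1 t ht).1.1).continuous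
  have hwc : ∀ {f : ℝ → E}, f ∈ HPerSpace T 4 → Continuous f := fun hf =>
    (IterAbsCont.isPrim (by norm_num) hf.2.1).continuous
  have hw1c : Continuous (iteratedDeriv 1 (w t)) :=
    (isPrim_iteratedDeriv (by norm_num) (hw.1 t ht).1.2.1).continuous
  have hmem : ∀ s ∈ I, MemLp (fun x => w s (x + γ s x) - w s x) 2 volume := by
    intro s hs
    refine (HSpace.memLp (hγ.1 s hs).1).of_le_mul (c := c * hPerNorm T 4 (w s)) ?_ ?_
    · have := hwc (hw.1 s hs).1
      have := hγc s hs
      exact Continuous.aestronglyMeasurable (by fun_prop)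
    · refine Eventually.of_forall fun x => (lip (hw.1 s hs).1 _ _).trans ?_
      simp
  set a1 := c * hPerNorm T 4 (wt t)
  set a2 := c * hPerNorm T 4 (w t)
  have ha1 : 0 ≤ a1 := mul_nonneg hc (hPerNorm_nonneg _ _ _)
  have ha2 : 0 ≤ a2 := mul_nonneg hc (hPerNorm_nonneg _ _ _)
  have hw1 : ∀ x, ‖iteratedDeriv 1 (w t) x‖ ≤ a2 :=
    HPerSpace.norm_iteratedDeriv_le hT (by norm_num) (hw.1 t ht).1
  have hw2 : ∀ x, ‖iteratedDeriv 2 (w t) x‖ ≤ a2 :=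
    HPerSpace.norm_iteratedDeriv_le hT (by norm_num) (hw.1 t ht).1
  have hwtc := hwc (hw.2.1 t ht).1
  have hmem' : MemLp (fun x => wt t (x + γ t x) - wt t x
      + γt t x • iteratedDeriv 1 (w t) (x + γ t x)) 2 volume := by
    refine MemLp.add ?_ ?_
    · refine (HSpace.memLp (hγ.1 t ht).1).of_le_mul (c := a1) ?_ ?_
      · have := hγc t ht
        exact Continuous.aestronglyMeasurable (by fun_prop)
      · refine Eventually.of_forall fun x => (lip (hw.2.1 t ht).1 _ _).trans ?_
        simp [a1]
    · refine (HSpace.memLp (hγ.2.1 t ht).1).of_le_mul (c := a2) ?_ ?_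
      · have := hγc t ht
        exact Continuous.aestronglyMeasurable (by fun_prop)
      · refine Eventually.of_forall fun x => ?_
        rw [norm_smul, mul_comm]
        exact mul_le_mul_of_nonneg_right (hw1 _) (norm_nonneg _)
  refine ⟨hmem, hmem', hasDerivWithinAt_cls ht hmem hmem' ?_⟩
  -- the four terms of the difference quotient
  set ε : ℝ → ℝ → E := fun s => (s - t)⁻¹ • (w s - w t) - wt t
  set δ : ℝ → ℝ → ℝ := fun s => γ s - γ t
  set κ : ℝ → ℝ → ℝ := fun s => (s - t)⁻¹ • (γ s - γ t) - γt t
  have hε : ∀ s ∈ I, ε s ∈ HPerSpace T 4 := fun s hs =>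
    HPerSpace.sub (HPerSpace.const_smul _ (HPerSpace.sub (hw.1 s hs).1 (hw.1 t ht).1))
      (hw.2.1 t ht).1
  have hδ : ∀ s ∈ I, δ s ∈ HSpace 3 := fun s hs => HSpace.sub (hγ.1 s hs).1 (hγ.1 t ht).1
  have hκ : ∀ s ∈ I, κ s ∈ HSpace 3 := fun s hs =>
    HSpace.sub (HSpace.const_smul _ (hδ s hs)) (hγ.2.1 t ht).1
  have hle : 𝓝[I \ {t}] t ≤ 𝓝[I] t := nhdsWithin_mono _ sdiff_subset
  have L1 : Tendsto (fun s => hPerNorm T 4 (ε s)) (𝓝[I \ {t}] t) (𝓝 0) := hw.2.2 t ht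
  have L2 : Tendsto (fun s => hNorm 3 (δ s)) (𝓝[I \ {t}] t) (𝓝 0) := (hγ.1 t ht).2.mono_left hle
  have L3 : Tendsto (fun s => hNorm 3 (κ s)) (𝓝[I \ {t}] t) (𝓝 0) := hγ.2.2 t ht
  have L4 : Tendsto (fun s => c * hPerNorm T 4 (ε s) * (hNorm 3 (γ t) + hNorm 3 (δ s))
      + a1 * hNorm 3 (δ s)
      + a2 * (2 * hNorm 3 (δ s)) * (hNorm 3 (γt t) + hNorm 3 (κ s))
      + a2 * hNorm 3 (κ s)) (𝓝[I \ {t}] t) (𝓝 0) := by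
    have := (((((L1.const_mul c).mul (L2.const_add (hNorm 3 (γ t)))).add (L2.const_mul a1)).add
      (((L2.const_mul 2).const_mul a2).mul (L3.const_add (hNorm 3 (γt t))))).add
      (L3.const_mul a2))
    simpa using this
  refine squeeze_zero' (Eventually.of_forall fun _ => norm_nonneg _) ?_ L4
  filter_upwards [self_mem_nhdsWithin] with s hs
  have hst : s - t ≠ 0 := sub_ne_zero.2 fun h => hs.2 (by simpa using h)
  have m0 := HSpace.memLp (hγ.1 s hs.1).1
  have mδ := HSpace.memLp (hδ s hs.1)
  have mκ := HSpace.memLp (hκ s hs.1)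
  have mq : MemLp (fun x => (s - t)⁻¹ * δ s x) 2 volume := mδ.const_smul (s - t)⁻¹
  have hb := memLp_and_norm_cls_le_sum (Finset.univ : Finset (Fin 4))
    (f := fun x => (s - t)⁻¹ • (w s (x + γ s x) - w s x - (w t (x + γ t x) - w t x))
      - (wt t (x + γ t x) - wt t x + γt t x • iteratedDeriv 1 (w t) (x + γ t x)))
    (g := ![γ s, δ s, fun x => (s - t)⁻¹ * δ s x, κ s])
    (c := ![c * hPerNorm T 4 (ε s), a1, a2 * (2 * hNorm 3 (δ s)), a2]) ?_ ?_ ?_ ?_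
  · refine hb.2.trans ?_
    simp only [Fin.sum_univ_four]
    change c * hPerNorm T 4 (ε s) * ‖cls (γ s)‖ + a1 * ‖cls (δ s)‖
      + a2 * (2 * hNorm 3 (δ s)) * ‖cls (fun x => (s - t)⁻¹ * δ s x)‖ + a2 * ‖cls (κ s)‖ ≤ _
    have n1 : ‖cls (δ s)‖ ≤ hNorm 3 (δ s) := norm_cls_le_hNorm (hδ s hs.1)
    have n2 : ‖cls (κ s)‖ ≤ hNorm 3 (κ s) := norm_cls_le_hNorm (hκ s hs.1)
    have n3 : ‖cls (γ s)‖ ≤ hNorm 3 (γ t) + hNorm 3 (δ s) := by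
      have e : γ s = fun x => γ t x + δ s x := by funext x; simp [δ]
      rw [e, cls_add (HSpace.memLp (hγ.1 t ht).1) mδ]
      exact (norm_add_le _ _).trans (add_le_add (norm_cls_le_hNorm (hγ.1 t ht).1) n1)
    have n4 : ‖cls (fun x => (s - t)⁻¹ * δ s x)‖ ≤ hNorm 3 (γt t) + hNorm 3 (κ s) := by
      have e : (fun x => (s - t)⁻¹ * δ s x) = fun x => γt t x + κ s x := by
        funext x; simp [δ, κ]
      rw [e, cls_add (HSpace.memLp (hγ.2.1 t ht).1) mκ]
      exact (norm_add_le _ _).trans (add_le_add (norm_cls_le_hNorm (hγ.2.1 t ht).1) n2)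
    have p1 := mul_nonneg hc (hPerNorm_nonneg T 4 (ε s))
    have p2 := mul_nonneg ha2 (mul_nonneg zero_le_two (hNorm_nonneg 3 (δ s)))
    gcongr
  · have := hγc s hs.1
    have := hγc t ht
    have := hwc (hw.1 s hs.1).1
    have := hwc (hw.1 t ht).1
    exact Continuous.aestronglyMeasurable (by fun_prop)
  · have p1 := mul_nonneg hc (hPerNorm_nonneg T 4 (ε s))
    have p2 := mul_nonneg ha2 (mul_nonneg zero_le_two (hNorm_nonneg 3 (δ s)))
    intro i _; fin_cases i
    · exact p1
    · exact ha1
    · exact p2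
    · exact ha2
  · intro i _; fin_cases i
    · exact m0
    · exact mδ
    · exact mq
    · exact mκ
  · refine Eventually.of_forall fun x => ?_
    simp only [Fin.sum_univ_four]
    change _ ≤ c * hPerNorm T 4 (ε s) * |γ s x| + a1 * |δ s x|
      + a2 * (2 * hNorm 3 (δ s)) * |(s - t)⁻¹ * δ s x| + a2 * |κ s x|
    -- The errors are, in order: the time quotient of `w`, whose values at the two points differ by
    -- at most a Lipschitz factor times `γ`; the shift of the argument of `wt`; the Taylor remainder
    -- of `w t`; the time quotient of `γ`.
    have e : (s - t)⁻¹ • (w s (x + γ s x) - w s x - (w t (x + γ t x) - w t x))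
        - (wt t (x + γ t x) - wt t x + γt t x • iteratedDeriv 1 (w t) (x + γ t x))
        = (ε s (x + γ s x) - ε s x) + (wt t (x + γ s x) - wt t (x + γ t x))
          + (s - t)⁻¹ • (w t (x + γ s x) - w t (x + γ t x)
              - (x + γ s x - (x + γ t x)) • iteratedDeriv 1 (w t) (x + γ t x))
          + κ s x • iteratedDeriv 1 (w t) (x + γ t x) := by
      simp only [ε, κ, Pi.sub_apply, Pi.smul_apply, smul_eq_mul]
      module
    rw [e]
    refine (norm_add_le _ _).trans (add_le_add ((norm_add_le _ _).trans (add_le_add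
      ((norm_add_le _ _).trans (add_le_add ?_ ?_)) ?_)) ?_)
    · refine (lip (hε s hs.1) _ _).trans (le_of_eq ?_)
      simp
    · refine (lip (hw.2.1 t ht).1 _ _).trans (le_of_eq ?_)
      simp [a1, δ]
    · rw [norm_smul, abs_mul, Real.norm_eq_abs]
      have h1 := (IterAbsCont.isPrim (by norm_num) (hw.1 t ht).1.2.1).norm_taylor_le
        (isPrim_iteratedDeriv (j := 1) (by norm_num) (hw.1 t ht).1.2.1) hw2 (x + γ t x) (x + γ s x)
      have h2 : x + γ s x - (x + γ t x) = δ s x := by simp [δ]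
      rw [h2] at h1 ⊢
      -- The Taylor remainder is quadratic in `δ`: one factor is small uniformly in `x`, while the
      -- other divided by `s - t` stays bounded in `L²`.
      have h3 : |δ s x| ≤ 2 * hNorm 3 (δ s) := by
        have := HSpace.norm_iteratedDeriv_le (j := 0) (by norm_num) (hδ s hs.1) x
        simpa using this
      calc |(s - t)⁻¹| * _ ≤ |(s - t)⁻¹| * (a2 * |δ s x| * |δ s x|) := by gcongr
        _ ≤ |(s - t)⁻¹| * (a2 * (2 * hNorm 3 (δ s)) * |δ s x|) := by gcongr
        _ = _ := by ring
    · rw [norm_smul, mul_comm]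
      exact mul_le_mul_of_nonneg_right (hw1 _) (norm_nonneg _)

lemma memLp_top_of_hSpace {k : ℕ} (hk : 0 < k) {f : ℝ → E} (hf : f ∈ HSpace k) :
    MemLp f ∞ volume := by
  refine memLp_top_of_bound (IterAbsCont.isPrim hk hf.1).continuous.aestronglyMeasurable
    (2 * hNorm k f) (Eventually.of_forall fun x => ?_)
  simpa using HSpace.norm_iteratedDeriv_le hk hf x

lemma memLp_top_of_hPerSpace {T : ℝ} (hT : 0 < T) {k : ℕ} (hk : 0 < k) {f : ℝ → E}
    (hf : f ∈ HPerSpace T k) : MemLp f ∞ volume := by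
  refine memLp_top_of_bound (IterAbsCont.isPrim hk hf.2.1).continuous.aestronglyMeasurable
    (perConst T * hPerNorm T k f) (Eventually.of_forall fun x => ?_)
  simpa using HPerSpace.norm_iteratedDeriv_le hT hk hf x

/-- The sum of a periodic and a localized curve is differentiable in time with respect to the
supremum norm. -/
lemma hasDerivWithinAt_clsTop_add {T : ℝ} (hT : 0 < T) {I : Set ℝ} {w wt v vt : ℝ → ℝ → E2}
    (hw : C1Curve (HPerSpace T 4) (hPerNorm T 4) I w wt)
    (hv : C1Curve (HSpace 1) (hNorm 1) I v vt) {t : ℝ} (ht : t ∈ I) :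
    HasDerivWithinAt (fun s => clsTop (fun x => w s x + v s x)) (clsTop fun x => wt t x + vt t x)
      I t := by
  have mu : ∀ s ∈ I, MemLp (fun x => w s x + v s x) ∞ volume := fun s hs =>
    (memLp_top_of_hPerSpace hT (by norm_num) (hw.1 s hs).1).add
      (memLp_top_of_hSpace (by norm_num) (hv.1 s hs).1)
  have mt : MemLp (fun x => wt t x + vt t x) ∞ volume :=
    (memLp_top_of_hPerSpace hT (by norm_num) (hw.2.1 t ht).1).add
      (memLp_top_of_hSpace (by norm_num) (hv.2.1 t ht).1)
  rw [hasDerivWithinAt_iff_tendsto_slope, tendsto_iff_norm_sub_tendsto_zero]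
  have L := ((hw.2.2 t ht).const_mul (perConst T)).add ((hv.2.2 t ht).const_mul 2)
  simp only [mul_zero, add_zero] at L
  refine squeeze_zero' (Eventually.of_forall fun _ => norm_nonneg _) ?_ L
  filter_upwards [self_mem_nhdsWithin] with s hs
  have hε : (s - t)⁻¹ • (w s - w t) - wt t ∈ HPerSpace T 4 :=
    HPerSpace.sub (HPerSpace.const_smul _ (HPerSpace.sub (hw.1 s hs.1).1 (hw.1 t ht).1))
      (hw.2.1 t ht).1
  have hδ : (s - t)⁻¹ • (v s - v t) - vt t ∈ HSpace 1 :=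
    HSpace.sub (HSpace.const_smul _ (HSpace.sub (hv.1 s hs.1).1 (hv.1 t ht).1)) (hv.2.1 t ht).1
  have m1 := ((mu s hs.1).sub (mu t ht)).const_smul (s - t)⁻¹
  have e : slope (fun s => clsTop (fun x => w s x + v s x)) t s - clsTop (fun x => wt t x + vt t x)
      = clsTop (((s - t)⁻¹ • (w s - w t) - wt t) + ((s - t)⁻¹ • (v s - v t) - vt t)) := by
    have hE : ((s - t)⁻¹ • (w s - w t) - wt t) + ((s - t)⁻¹ • (v s - v t) - vt t)
        = (s - t)⁻¹ • ((fun x => w s x + v s x) - fun x => w t x + v t x)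
          - fun x => wt t x + vt t x := by
      funext x
      simp only [Pi.add_apply, Pi.sub_apply, Pi.smul_apply]
      module
    rw [hE, slope_def_module, clsTop_eq_toLp (mu s hs.1), clsTop_eq_toLp (mu t ht),
      clsTop_eq_toLp mt, clsTop_eq_toLp (m1.sub mt), MemLp.toLp_sub m1 mt,
      MemLp.toLp_const_smul _ ((mu s hs.1).sub (mu t ht)), MemLp.toLp_sub]
  rw [e]
  refine norm_clsTop_le ((memLp_top_of_hPerSpace hT (by norm_num) hε).add
    (memLp_top_of_hSpace (by norm_num) hδ)) ?_ fun x => ?_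
  · exact add_nonneg (mul_nonneg (perConst_nonneg hT) (hPerNorm_nonneg _ _ _))
      (mul_nonneg zero_le_two (hNorm_nonneg _ _))
  · refine (norm_add_le _ _).trans (add_le_add ?_ ?_)
    · simpa using HPerSpace.norm_iteratedDeriv_le (j := 0) hT (by norm_num) hε x
    · simpa using HSpace.norm_iteratedDeriv_le (j := 0) (by norm_num) hδ x

end Curves

/-! ### Calculus of functions whose derivatives are pointwise dominated. -/

section Domination

variable {E F G : Type*} [NormedAddCommGroup E] [NormedSpace ℝ E] [CompleteSpace E]
  [NormedAddCommGroup F] [NormedSpace ℝ F] [CompleteSpace F]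
  [NormedAddCommGroup G] [NormedSpace ℝ G] [CompleteSpace G]

/-- `f` and its first `k` (weak) derivatives are dominated pointwise by `C ρ`. -/
def Dom : ℕ → ℝ → (ℝ → ℝ) → (ℝ → E) → Prop
  | 0, C, ρ, f => ∀ x, ‖f x‖ ≤ C * ρ x
  | k + 1, C, ρ, f => (∀ x, ‖f x‖ ≤ C * ρ x) ∧ ∃ f', IsPrim f f' ∧ Dom k C ρ f'

namespace Dom

variable {k : ℕ} {C D : ℝ} {ρ : ℝ → ℝ} {f : ℝ → E}

lemma le (h : Dom k C ρ f) (x : ℝ) : ‖f x‖ ≤ C * ρ x := by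
  cases k with
  | zero => exact h x
  | succ k => exact h.1 x

lemma of_succ (h : Dom (k + 1) C ρ f) : Dom k C ρ f := by
  induction k generalizing f with
  | zero => exact h.1
  | succ k ih =>
    obtain ⟨h0, f', hp, hd⟩ := h
    exact ⟨h0, f', hp, ih hd⟩

lemma mono {ρ' : ℝ → ℝ} (h : Dom k C ρ f) (hCD : ∀ x, C * ρ x ≤ D * ρ' x) : Dom k D ρ' f := by
  induction k generalizing f with
  | zero => exact fun x => (h x).trans (hCD x)
  | succ k ih =>
    obtain ⟨h0, f', hp, hd⟩ := h
    exact ⟨fun x => (h0 x).trans (hCD x), f', hp, ih hd⟩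

lemma mono_const (h : Dom k C ρ f) (hρ : ∀ x, 0 ≤ ρ x) (hCD : C ≤ D) : Dom k D ρ f :=
  h.mono fun x => mul_le_mul_of_nonneg_right hCD (hρ x)

lemma add {g : ℝ → E} (hf : Dom k C ρ f) (hg : Dom k D ρ g) :
    Dom k (C + D) ρ (fun x => f x + g x) := by
  induction k generalizing f g with
  | zero => exact fun x => (norm_add_le _ _).trans (by rw [add_mul]; exact add_le_add (hf x) (hg x))
  | succ k ih =>
    obtain ⟨h0, f', hp, hd⟩ := hf
    obtain ⟨h0', g', hp', hd'⟩ := hg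
    exact ⟨fun x => (norm_add_le _ _).trans (by rw [add_mul]; exact add_le_add (h0 x) (h0' x)),
      _, hp.add hp', ih hd hd'⟩

lemma clm {c : ℝ} (hc : 0 ≤ c) (L : E →L[ℝ] F) (hL : ∀ x, ‖L x‖ ≤ c * ‖x‖) (hf : Dom k C ρ f) :
    Dom k (c * C) ρ (fun x => L (f x)) := by
  have key : ∀ {f : ℝ → E} {x}, ‖f x‖ ≤ C * ρ x → ‖L (f x)‖ ≤ c * C * ρ x := fun h =>
    (hL _).trans (by rw [mul_assoc]; exact mul_le_mul_of_nonneg_left h hc)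
  induction k generalizing f with
  | zero => exact fun x => key (hf x)
  | succ k ih =>
    obtain ⟨h0, f', hp, hd⟩ := hf
    exact ⟨fun x => key (h0 x), _, hp.clm L, ih hd⟩

/-- Leibniz' rule doubles the number of terms with each derivative, whence `2 ^ k`. Only one factor
has to be dominated by `ρ`; boundedness suffices for the other. -/
lemma bilin {g : ℝ → F} (B : E →L[ℝ] F →L[ℝ] G) (hB : ‖B‖ ≤ 1) (hC : 0 ≤ C) (hD : 0 ≤ D)
    (hρ : ∀ x, 0 ≤ ρ x)
    (hf : Dom k C (fun _ => 1) f) (hg : Dom k D ρ g) :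
    Dom k (2 ^ k * (C * D)) ρ (fun x => B (f x) (g x)) := by
  have key : ∀ (k : ℕ) {f : ℝ → E} {g : ℝ → F} {x : ℝ}, ‖f x‖ ≤ C * 1 → ‖g x‖ ≤ D * ρ x →
      ‖B (f x) (g x)‖ ≤ 2 ^ k * (C * D) * ρ x := by
    intro k f g x h1 h2
    rw [mul_one] at h1
    have h3 : ‖B (f x) (g x)‖ ≤ C * (D * ρ x) := by
      calc _ ≤ ‖B‖ * ‖f x‖ * ‖g x‖ := B.le_opNorm₂ _ _
        _ ≤ 1 * C * (D * ρ x) := by gcongr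
        _ = _ := by ring
    have h4 : (1 : ℝ) ≤ 2 ^ k := one_le_pow₀ one_le_two
    have h5 : 0 ≤ C * D * ρ x := mul_nonneg (mul_nonneg hC hD) (hρ x)
    nlinarith
  induction k generalizing f g with
  | zero => exact fun x => key 0 (hf x) (hg x)
  | succ k ih =>
    obtain ⟨f0, f', hp, hd⟩ := id hf
    obtain ⟨g0, g', hp', hd'⟩ := id hg
    refine ⟨fun x => key (k + 1) (f0 x) (g0 x), _, hp.bilin B hp', ?_⟩
    have := (ih hd hg.of_succ).add (ih hf.of_succ hd')
    rwa [show 2 ^ k * (C * D) + 2 ^ k * (C * D) = 2 ^ (k + 1) * (C * D) by ring] at this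

lemma of_iteratedDeriv {n j : ℕ} {f : ℝ → E} (hf : IterAbsCont n f) (hjk : j + k ≤ n)
    (hb : ∀ i, j ≤ i → i ≤ j + k → ∀ x, ‖iteratedDeriv i f x‖ ≤ C * ρ x) :
    Dom k C ρ (iteratedDeriv j f) := by
  induction k generalizing j with
  | zero => exact hb j le_rfl le_rfl
  | succ k ih =>
    refine ⟨hb j le_rfl (by omega), _, hf j (by omega), ih (by omega) fun i h1 h2 => hb i ?_ ?_⟩
    · omega
    · omega

lemma const (k : ℕ) (c : E) : Dom k ‖c‖ (fun _ => 1) (fun _ => c) := by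
  have h0 : ∀ k, Dom k ‖c‖ (fun _ => 1) (fun _ : ℝ => (0 : E)) := by
    intro k
    have hp : IsPrim (fun _ : ℝ => (0 : E)) (fun _ => 0) := fun a b => by simp
    induction k with
    | zero => exact fun x => by simp
    | succ k ih => exact ⟨fun x => by simp, _, hp, ih⟩
  have hp : IsPrim (fun _ : ℝ => c) (fun _ => (0 : E)) := fun a b => by simp
  cases k with
  | zero => exact fun x => by simp
  | succ k => exact ⟨fun x => by simp, _, hp, h0 k⟩

end Dom

/-- Scalar multiplication with the vector as first argument. -/
def smulB : E →L[ℝ] ℝ →L[ℝ] E := (ContinuousLinearMap.lsmul ℝ ℝ).flip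

@[simp] lemma smulB_apply (v : E) (c : ℝ) : smulB v c = c • v := rfl

lemma norm_smulB_le : ‖(smulB : E →L[ℝ] ℝ →L[ℝ] E)‖ ≤ 1 := by
  rw [smulB, ContinuousLinearMap.opNorm_flip]
  exact ContinuousLinearMap.opNorm_lsmul_le

lemma IsPrim.smul {s s' : ℝ → ℝ} {f f' : ℝ → E} (hs : IsPrim s s') (hf : IsPrim f f') :
    IsPrim (fun x => s x • f x) (fun x => s' x • f x + s x • f' x) := by
  have := hf.bilin smulB hs
  simp only [smulB_apply] at this
  simpa only [add_comm] using this

lemma Dom.smul {k : ℕ} {C D : ℝ} {ρ : ℝ → ℝ} {s : ℝ → ℝ} {f : ℝ → E} (hC : 0 ≤ C) (hD : 0 ≤ D)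
    (hρ : ∀ x, 0 ≤ ρ x) (hs : Dom k D ρ s) (hf : Dom k C (fun _ => 1) f) :
    Dom k (2 ^ k * (C * D)) ρ (fun x => s x • f x) :=
  hf.bilin smulB norm_smulB_le hC hD hρ hs

lemma Dom.smul' {k : ℕ} {C D : ℝ} {ρ : ℝ → ℝ} {s : ℝ → ℝ} {f : ℝ → E} (hC : 0 ≤ C) (hD : 0 ≤ D)
    (hρ : ∀ x, 0 ≤ ρ x) (hs : Dom k C (fun _ => 1) s) (hf : Dom k D ρ f) :
    Dom k (2 ^ k * (C * D)) ρ (fun x => s x • f x) :=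
  Dom.bilin (ContinuousLinearMap.lsmul ℝ ℝ) ContinuousLinearMap.opNorm_lsmul_le hC hD hρ hs hf

end Domination

/-! ### The wave at the modulated point `x + γ(x)`. -/

section Composition

variable {E : Type*} [NormedAddCommGroup E] [NormedSpace ℝ E] [CompleteSpace E]

/-- The derivative of order `k` of `w` at the modulated point `x + γ(x)`. -/
def modul (w : ℝ → E) (γ : ℝ → ℝ) (k : ℕ) (x : ℝ) : E := iteratedDeriv k w (x + γ x)

variable {w : ℝ → E} {γ : ℝ → ℝ} {N : ℝ}

lemma continuous_iteratedDeriv_of_iterAbsCont {k j : ℕ} (hj : j < k) {f : ℝ → E}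
    (hf : IterAbsCont k f) : Continuous (iteratedDeriv j f) := (isPrim_iteratedDeriv hj hf).continuous

/-- For `k ≤ 4` the derivative of order `k + 1` of `w` is continuous, so the chain rule is
classical. -/
lemma isPrim_modul (hw : IterAbsCont 6 w) (hγ : IterAbsCont 5 γ) {k : ℕ} (hk : k ≤ 4) :
    IsPrim (modul w γ k) (fun x => (1 + iteratedDeriv 1 γ x) • modul w γ (k + 1) x) := by
  have cγ := (IterAbsCont.isPrim (by norm_num) hγ).continuous
  have cγ1 := continuous_iteratedDeriv_of_iterAbsCont (j := 1) (by norm_num) hγ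
  have cw := continuous_iteratedDeriv_of_iterAbsCont (j := k + 1) (by omega) hw
  refine IsPrim.of_hasDerivAt (fun x => ?_) ?_
  · have h1 := (isPrim_iteratedDeriv (j := k) (by omega) hw).hasDerivAt cw (x + γ x)
    have h2 := (IterAbsCont.isPrim (by norm_num) hγ).hasDerivAt cγ1 x
    exact h1.scomp x ((hasDerivAt_id x).add h2)
  · exact (continuous_const.add cγ1).smul (cw.comp (continuous_id.add cγ))

lemma dom_one_add_deriv (hγ : IterAbsCont 5 γ)
    (hγN : ∀ j, 1 ≤ j → j ≤ 3 → ∀ x, |iteratedDeriv j γ x| ≤ N) :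
    Dom 2 (1 + N) (fun _ => 1) (fun x => 1 + iteratedDeriv 1 γ x) := by
  have h := (Dom.const 2 (1 : ℝ)).add (Dom.of_iteratedDeriv (k := 2) (j := 1) (C := N)
    (ρ := fun _ => 1) hγ (by norm_num) fun i h1 h2 x => by simpa using hγN i h1 h2 x)
  simpa using h

/-- The bound for the first three derivatives of `modul w γ k`. -/
def modulConst (N : ℝ) : ℝ := 64 * (1 + N) ^ 4

/-- Each derivative costs one order of `w` and a factor `1 + γ_x`, so three derivatives starting
from `k ≤ 2` reach order five, the highest one bounded pointwise. Only `γ_x` and its derivatives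
enter, not the size of `γ`. -/
lemma dom_modul (hN : 0 ≤ N) (hw : IterAbsCont 6 w) (hγ : IterAbsCont 5 γ)
    (hwN : ∀ j ≤ 5, ∀ x, ‖iteratedDeriv j w x‖ ≤ N)
    (hγN : ∀ j, 1 ≤ j → j ≤ 3 → ∀ x, |iteratedDeriv j γ x| ≤ N) {k : ℕ} (hk : k ≤ 2) :
    Dom 3 (modulConst N) (fun _ => 1) (modul w γ k) := by
  have ha := dom_one_add_deriv hγ hγN
  have h1 : 1 ≤ 1 + N := by linarith
  have one : ∀ x : ℝ, (0 : ℝ) ≤ (fun _ => 1) x := fun _ => zero_le_one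
  set A := 1 + N with hA
  have hA0 : 0 ≤ A := by linarith
  have b : ∀ j ≤ 5, ∀ x, ‖modul w γ j x‖ ≤ A * 1 := fun j hj x =>
    (hwN j hj _).trans (by linarith)
  -- The number of controlled derivatives is raised one at a time, for a range of orders `j` that
  -- shrinks accordingly.
  have s1 : ∀ j ≤ 4, Dom 1 (A ^ 2) (fun _ => 1) (modul w γ j) := by
    intro j hj
    refine ⟨fun x => (b j (by omega) x).trans (by nlinarith), _, isPrim_modul hw hγ hj, ?_⟩
    have h0 : Dom 0 A (fun _ => 1) (modul w γ (j + 1)) := b (j + 1) (by omega)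
    have := Dom.smul' hA0 hA0 one ha.of_succ.of_succ h0
    exact this.mono_const one (by nlinarith)
  have s2 : ∀ j ≤ 3, Dom 2 (4 * A ^ 3) (fun _ => 1) (modul w γ j) := by
    intro j hj
    refine ⟨fun x => (b j (by omega) x).trans ?_, _, isPrim_modul hw hγ (by omega), ?_⟩
    · have : 1 ≤ A ^ 2 := one_le_pow₀ h1
      nlinarith
    · have := Dom.smul' hA0 (by positivity) one ha.of_succ (s1 (j + 1) (by omega))
      refine this.mono_const one ?_
      nlinarith [pow_nonneg hA0 3]
  refine ⟨fun x => (b k (by omega) x).trans ?_, _, isPrim_modul hw hγ (by omega), ?_⟩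
  · have : 1 ≤ A ^ 3 := one_le_pow₀ h1
    unfold modulConst
    nlinarith
  · have := Dom.smul' hA0 (by positivity) one ha (s2 (k + 1) (by omega))
    refine this.mono_const one ?_
    unfold modulConst
    nlinarith [pow_nonneg hA0 4]

/-- The displacement `w(x + γ(x)) - w(x)` is dominated by `γ`. -/
lemma dom_modul_sub (hN : 0 ≤ N) (hw : IterAbsCont 6 w) (hγ : IterAbsCont 5 γ)
    (hwN : ∀ j ≤ 5, ∀ x, ‖iteratedDeriv j w x‖ ≤ N)
    (hγN : ∀ j, 1 ≤ j → j ≤ 3 → ∀ x, |iteratedDeriv j γ x| ≤ N) {j : ℕ} (hj : j ≤ 3) :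
    ∃ C, 0 ≤ C ∧ ∀ k ≤ 3 - j, Dom j C (fun x => ∑ i ∈ Finset.range 4, |iteratedDeriv i γ x|)
      (fun x => modul w γ k x - iteratedDeriv k w x) := by
  set ρ : ℝ → ℝ := fun x => ∑ i ∈ Finset.range 4, |iteratedDeriv i γ x| with hρ
  have hρ0 : ∀ x, 0 ≤ ρ x := fun x => Finset.sum_nonneg fun _ _ => abs_nonneg _
  have hle : ∀ i < 4, ∀ x, |iteratedDeriv i γ x| ≤ ρ x := fun i hi x =>
    Finset.single_le_sum (f := fun i => |iteratedDeriv i γ x|) (fun _ _ => abs_nonneg _)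
      (Finset.mem_range.2 hi)
  have b : ∀ k ≤ 3, ∀ x, ‖modul w γ k x - iteratedDeriv k w x‖ ≤ N * ρ x := by
    intro k hk x
    refine ((isPrim_iteratedDeriv (j := k) (by omega) hw).norm_sub_le
      (hwN (k + 1) (by omega)) x (x + γ x)).trans ?_
    have := hle 0 (by norm_num) x
    simp only [iteratedDeriv_zero] at this
    rw [add_sub_cancel_left]
    gcongr
  have hM : 0 ≤ modulConst N := by unfold modulConst; positivity
  have hγ1 : Dom 2 1 ρ (iteratedDeriv 1 γ) := Dom.of_iteratedDeriv hγ (by norm_num)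
    fun i h1 h2 x => by simpa using hle i (by omega) x
  induction j with
  | zero => exact ⟨N, hN, fun k hk => b k (by omega)⟩
  | succ j ih =>
    obtain ⟨C, hC, h⟩ := ih (by omega)
    -- The derivative of the displacement of order `k` is the displacement of order `k + 1`, covered
    -- by induction, plus `γ_x` times a bounded function.
    refine ⟨N + (C + 2 ^ j * (modulConst N * 1)), by positivity, fun k hk =>
      ⟨fun x => (b k (by omega) x).trans ?_, fun x => (modul w γ (k + 1) x
        - iteratedDeriv (k + 1) w x) + iteratedDeriv 1 γ x • modul w γ (k + 1) x, ?_, ?_⟩⟩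
    · exact mul_le_mul_of_nonneg_right (le_add_of_nonneg_right (by positivity)) (hρ0 x)
    · have := (isPrim_modul hw hγ (k := k) (by omega)).sub
        (isPrim_iteratedDeriv (j := k) (by omega) hw)
      refine this.congr_right (Eventually.of_forall fun x => ?_)
      simp only
      module
    · have h1 := h (k + 1) (by omega)
      have h2 : Dom j (2 ^ j * (modulConst N * 1)) ρ
          (fun x => iteratedDeriv 1 γ x • modul w γ (k + 1) x) := by
        have hj2 : j ≤ 2 := by omega
        interval_cases j
        · refine Dom.smul hM zero_le_one hρ0 hγ1.of_succ.of_succ (fun x => ?_)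
          refine (hwN (k + 1) (by omega) _).trans ?_
          have : 1 ≤ (1 + N) ^ 3 := one_le_pow₀ (by linarith)
          unfold modulConst
          nlinarith
        · exact Dom.smul hM zero_le_one hρ0 hγ1.of_succ
            (dom_modul hN hw hγ hwN hγN (by omega)).of_succ.of_succ
        · exact Dom.smul hM zero_le_one hρ0 hγ1
            (dom_modul hN hw hγ hwN hγN (by omega)).of_succ
      exact (h1.add h2).mono_const hρ0 (by linarith)

end Composition

/-! ### From pointwise domination to Sobolev regularity. -/

section DominatedJets

variable {E : Type*} [NormedAddCommGroup E] [NormedSpace ℝ E] [CompleteSpace E]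

namespace Dom

variable {k : ℕ} {C : ℝ} {ρ : ℝ → ℝ} {f : ℝ → E}

lemma exists_jet (h : Dom k C ρ f) :
    ∃ F : ℕ → ℝ → E, F 0 = f ∧ IsJet k F ∧ ∀ j ≤ k, ∀ x, ‖F j x‖ ≤ C * ρ x := by
  induction k generalizing f with
  | zero => exact ⟨fun _ => f, rfl, fun j hj => absurd hj (Nat.not_lt_zero j), fun _ _ x => h x⟩
  | succ k ih =>
    obtain ⟨h0, f', hp, hd⟩ := h
    obtain ⟨F, rfl, hF, hb⟩ := ih hd
    refine ⟨fun n => Nat.casesOn n f F, rfl, ?_, ?_⟩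
    · intro j hj
      cases j with
      | zero => exact hp
      | succ j => exact hF j (by omega)
    · intro j hj
      cases j with
      | zero => exact h0
      | succ j => exact hb j (by omega)

lemma mem_hSpace (h : Dom k C ρ f) (hk : 0 < k) (hρ : MemLp ρ 2 volume) : f ∈ HSpace k := by
  obtain ⟨F, rfl, hF, hb⟩ := h.exists_jet
  refine hF.mem_hSpace fun j hj => ?_
  have hm : AEStronglyMeasurable (F j) volume := by
    cases j with
    | zero => exact (hF 0 hk).continuous.aestronglyMeasurable
    | succ j => exact (hF j hj).locallyIntegrable.aestronglyMeasurable
  refine (hρ.const_smul C).of_le hm (Eventually.of_forall fun x => ?_)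
  exact (hb j hj x).trans (le_abs_self _)

lemma isPrim_deriv (h : Dom (k + 2) C ρ f) :
    IsPrim f (iteratedDeriv 1 f) ∧ Dom (k + 1) C ρ (iteratedDeriv 1 f) := by
  obtain ⟨h0, f', hp, hd⟩ := h
  have hc : Continuous f' := by
    obtain ⟨-, f'', hp', -⟩ := hd
    exact hp'.continuous
  have : iteratedDeriv 1 f = f' := by
    rw [iteratedDeriv_one]
    exact funext fun x => (hp.hasDerivAt hc x).deriv
  rw [this]
  exact ⟨hp, hd⟩

end Dom

end DominatedJets

/-! ### The cubic nonlinearity as a trilinear form. -/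

section Trilinear

/-- The trilinear map `(a, b, c) ↦ ⟪a, b⟫ 𝒥 c`, with `𝒩(u) = tri u u u`. -/
def tri (a b c : E2) : E2 := ⟪a, b⟫_ℝ • J c

lemma tri_comm (a b c : E2) : tri a b c = tri b a c := by rw [tri, tri, real_inner_comm]

lemma cubic_eq_tri (u : E2) : cubic u = tri u u u := by
  rw [cubic, tri, real_inner_self_eq_norm_sq]

lemma tri_add_left (a a' b c : E2) : tri (a + a') b c = tri a b c + tri a' b c := by
  rw [tri, tri, tri, inner_add_left, add_smul]

lemma tri_add_mid (a b b' c : E2) : tri a (b + b') c = tri a b c + tri a b' c := by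
  rw [tri, tri, tri, inner_add_right, add_smul]

lemma tri_add_right (a b c c' : E2) : tri a b (c + c') = tri a b c + tri a b c' := by
  simp only [tri, ← JL_apply, map_add, smul_add]

lemma norm_tri_le (a b c : E2) : ‖tri a b c‖ ≤ ‖a‖ * ‖b‖ * ‖c‖ := by
  rw [tri, norm_smul, norm_J]
  exact mul_le_mul_of_nonneg_right (norm_inner_le_norm a b) (norm_nonneg _)

lemma IsPrim.tri {f f' g g' h h' : ℝ → E2} (hf : IsPrim f f') (hg : IsPrim g g')
    (hh : IsPrim h h') :
    IsPrim (fun x => tri (f x) (g x) (h x))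
      (fun x => LLE.tri (f' x) (g x) (h x) + LLE.tri (f x) (g' x) (h x)
        + LLE.tri (f x) (g x) (h' x)) := by
  have := (hf.bilin innerB hg).smul (hh.clm JL)
  refine this.congr_right (Eventually.of_forall fun x => ?_)
  simp only [innerB_apply, JL_apply, LLE.tri, add_smul]

variable {k : ℕ} {B D : ℝ} {ρ : ℝ → ℝ} {f g h : ℝ → E2}

lemma Dom.J (hf : Dom k D ρ f) : Dom k D ρ (fun x => LLE.J (f x)) := by
  have := hf.clm zero_le_one JL fun x => by rw [JL_apply, norm_J, one_mul]
  rwa [one_mul] at this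

lemma Dom.tri_mid (hB : 0 ≤ B) (hD : 0 ≤ D) (hρ : ∀ x, 0 ≤ ρ x) (hf : Dom k B (fun _ => 1) f)
    (hg : Dom k D ρ g) (hh : Dom k B (fun _ => 1) h) :
    Dom k (4 ^ k * (B ^ 2 * D)) ρ (fun x => tri (f x) (g x) (h x)) := by
  have := Dom.smul hB (by positivity) hρ (hf.bilin innerB norm_innerB_le hB hD hρ hg) hh.J
  rwa [show 2 ^ k * (B * (2 ^ k * (B * D))) = 4 ^ k * (B ^ 2 * D) by
    rw [show (4 : ℝ) = 2 * 2 by norm_num, mul_pow]; ring] at this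

lemma Dom.tri_right (hB : 0 ≤ B) (hD : 0 ≤ D) (hρ : ∀ x, 0 ≤ ρ x) (hf : Dom k B (fun _ => 1) f)
    (hg : Dom k B (fun _ => 1) g) (hh : Dom k D ρ h) :
    Dom k (4 ^ k * (B ^ 2 * D)) ρ (fun x => tri (f x) (g x) (h x)) := by
  have := Dom.smul' (by positivity) hD hρ
    (hf.bilin innerB norm_innerB_le hB hB (fun _ => zero_le_one) hg) hh.J
  rwa [show 2 ^ k * (2 ^ k * (B * B) * D) = 4 ^ k * (B ^ 2 * D) by
    rw [show (4 : ℝ) = 2 * 2 by norm_num, mul_pow]; ring] at this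

/-- The derivative of the cubic nonlinearity at `u`. -/
def cubicDeriv (u h : E2) : E2 := (2 : ℝ) • tri u h u + tri u u h

/-- The expansion of the third derivative of `𝒩(W + z) - 𝒩(W)`: all terms other than the leading
one are dominated by lower derivatives of `z`. -/
lemma exists_cubic_jet {N : ℝ} (hN : 0 ≤ N) : ∃ C, 0 ≤ C ∧ ∀ {W z z₁ z₂ z₃ : ℝ → E2} {ρ : ℝ → ℝ},
    (∀ x, 0 ≤ ρ x) → Dom 3 N (fun _ => 1) W → IsPrim z z₁ → IsPrim z₁ z₂ → IsPrim z₂ z₃ →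
    Dom 2 N (fun _ => 1) z → Dom 1 N (fun _ => 1) z₁ →
    Dom 2 1 ρ z → Dom 1 1 ρ z₁ → Dom 0 1 ρ z₂ →
    ∃ G₁ G₂ G₃ : ℝ → E2, IsPrim (fun x => cubic (z x + W x) - cubic (W x)) G₁ ∧ IsPrim G₁ G₂ ∧
      IsPrim G₂ G₃ ∧ (∀ x, ‖cubic (z x + W x) - cubic (W x)‖ ≤ C * ρ x) ∧
      (∀ x, ‖G₁ x‖ ≤ C * ρ x) ∧ (∀ x, ‖G₂ x‖ ≤ C * ρ x) ∧
      ∀ x, ‖G₃ x - cubicDeriv (z x + W x) (z₃ x)‖ ≤ C * ρ x := by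
  -- A common bound for `W` and `u = z + W`.
  set B := N + N with hB
  have hB0 : 0 ≤ B := by positivity
  -- Six trilinear terms in each of `S`, `Q`, `V` carry at most `4 ^ 2 * B ^ 2`, and fewer
  -- derivatives carry smaller powers of `4`; the factor 20 covers all the sums below.
  refine ⟨4 ^ 2 * (B ^ 2 * 1) * 20, by positivity, ?_⟩
  intro W z z₁ z₂ z₃ ρ hρ hW p1 p2 p3 bz bz₁ dz dz₁ dz₂
  have one : ∀ x : ℝ, (0 : ℝ) ≤ (fun _ => 1) x := fun _ => zero_le_one
  have hNB : N ≤ B := by linarith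
  obtain ⟨pW, hW₁⟩ := hW.isPrim_deriv
  set W₁ := iteratedDeriv 1 W
  have bW : Dom 2 B (fun _ => 1) W := hW.of_succ.mono_const one hNB
  have bW₁ : Dom 2 B (fun _ => 1) W₁ := hW₁.mono_const one hNB
  set u : ℝ → E2 := fun x => z x + W x with hu
  set u₁ : ℝ → E2 := fun x => z₁ x + W₁ x with hu₁
  have pu : IsPrim u u₁ := p1.add pW
  have bu : Dom 2 B (fun _ => 1) u := bz.add hW.of_succ
  have bu₁ : Dom 1 B (fun _ => 1) u₁ := bz₁.add hW₁.of_succ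
  -- the lower order parts of the first and second derivatives
  set S : ℝ → E2 := fun x => (tri (W₁ x) (z x) (u x) + tri (W₁ x) (z x) (u x))
    + (tri (W x) (W₁ x) (z x) + tri (W x) (W₁ x) (z x))
    + (tri (u x) (z x) (W₁ x) + tri (W x) (z x) (W₁ x)) with hS
  set Q : ℝ → E2 := fun x => (tri (u₁ x) (z₁ x) (u x) + tri (u₁ x) (z₁ x) (u x))
    + (tri (u x) (z₁ x) (u₁ x) + tri (u x) (z₁ x) (u₁ x))
    + (tri (u x) (u₁ x) (z₁ x) + tri (u x) (u₁ x) (z₁ x)) with hQ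
  set V : ℝ → E2 := fun x => (tri (u₁ x) (z₂ x) (u x) + tri (u₁ x) (z₂ x) (u x))
    + (tri (u x) (z₂ x) (u₁ x) + tri (u x) (z₂ x) (u₁ x))
    + (tri (u x) (u₁ x) (z₂ x) + tri (u x) (u₁ x) (z₂ x)) with hV
  have dS := (((Dom.tri_mid hB0 zero_le_one hρ bW₁ dz bu).add
    (Dom.tri_mid hB0 zero_le_one hρ bW₁ dz bu)).add
    ((Dom.tri_right hB0 zero_le_one hρ bW bW₁ dz).add
      (Dom.tri_right hB0 zero_le_one hρ bW bW₁ dz))).add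
    ((Dom.tri_mid hB0 zero_le_one hρ bu dz bW₁).add (Dom.tri_mid hB0 zero_le_one hρ bW dz bW₁))
  have dQ := (((Dom.tri_mid hB0 zero_le_one hρ bu₁ dz₁ bu.of_succ).add
    (Dom.tri_mid hB0 zero_le_one hρ bu₁ dz₁ bu.of_succ)).add
    ((Dom.tri_mid hB0 zero_le_one hρ bu.of_succ dz₁ bu₁).add
      (Dom.tri_mid hB0 zero_le_one hρ bu.of_succ dz₁ bu₁))).add
    ((Dom.tri_right hB0 zero_le_one hρ bu.of_succ bu₁ dz₁).add
      (Dom.tri_right hB0 zero_le_one hρ bu.of_succ bu₁ dz₁))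
  have hbu := bu.of_succ.of_succ
  have hbu₁ := bu₁.of_succ
  have dV := (((Dom.tri_mid hB0 zero_le_one hρ hbu₁ dz₂ hbu).add
    (Dom.tri_mid hB0 zero_le_one hρ hbu₁ dz₂ hbu)).add
    ((Dom.tri_mid hB0 zero_le_one hρ hbu dz₂ hbu₁).add
      (Dom.tri_mid hB0 zero_le_one hρ hbu dz₂ hbu₁))).add
    ((Dom.tri_right hB0 zero_le_one hρ hbu hbu₁ dz₂).add
      (Dom.tri_right hB0 zero_le_one hρ hbu hbu₁ dz₂))
  obtain ⟨dS0, S₁, pS, dS₁⟩ := id dS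
  obtain ⟨dS₁0, S₂, pS₁, dS₂⟩ := id dS₁
  obtain ⟨dQ0, Q₁, pQ, dQ₁⟩ := id dQ
  -- leading terms
  have lead : ∀ {y y' : ℝ → E2}, IsPrim y y' → IsPrim (fun x => cubicDeriv (u x) (y x))
      (fun x => ((tri (u₁ x) (y x) (u x) + tri (u₁ x) (y x) (u x))
        + (tri (u x) (y x) (u₁ x) + tri (u x) (y x) (u₁ x))
        + (tri (u x) (u₁ x) (y x) + tri (u x) (u₁ x) (y x))) + cubicDeriv (u x) (y' x)) := by
    intro y y' hy
    refine (((pu.tri hy pu).const_smul (2 : ℝ)).add (pu.tri pu hy)).congr_right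
      (Eventually.of_forall fun x => ?_)
    simp only [cubicDeriv]
    rw [tri_comm (u₁ x) (u x) (y x)]
    module
  have blead : ∀ {y : ℝ → E2}, Dom 0 1 ρ y → ∀ x, ‖cubicDeriv (u x) (y x)‖ ≤ 3 * B ^ 2 * ρ x := by
    intro y hy x
    have h1 := Dom.tri_mid hB0 zero_le_one hρ hbu hy hbu x
    have h2 := Dom.tri_right hB0 zero_le_one hρ hbu hbu hy x
    have h3 : ‖cubicDeriv (u x) (y x)‖ ≤ 2 * ‖tri (u x) (y x) (u x)‖ + ‖tri (u x) (u x) (y x)‖ := by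
      refine (norm_add_le _ _).trans (add_le_add (le_of_eq ?_) le_rfl)
      rw [norm_smul]; norm_num
    simp only [pow_zero, mul_one, one_mul] at h1 h2
    linarith
  -- The derivative is `𝒩'(u) z₁ + (𝒩'(u) - 𝒩'(W)) W₁`, and `S` is the second summand expanded so
  -- that every term contains `z`.
  have hp : IsPrim (fun x => cubic (z x + W x) - cubic (W x))
      (fun x => cubicDeriv (u x) (z₁ x) + S x) := by
    have h1 := (pu.tri pu pu).sub (pW.tri pW pW)
    simp only [cubic_eq_tri]
    refine h1.congr_right (Eventually.of_forall fun x => ?_)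
    simp only [hS, hu, hu₁, cubicDeriv, tri_add_left, tri_add_mid, tri_add_right]
    rw [tri_comm (z₁ x) (z x), tri_comm (z₁ x) (W x) (z x), tri_comm (z₁ x) (z x) (W x),
      tri_comm (z₁ x) (W x) (W x), tri_comm (W₁ x) (z x) (z x), tri_comm (W₁ x) (W x) (z x),
      tri_comm (W₁ x) (z x) (W x), tri_comm (W₁ x) (W x) (W x), tri_comm (W x) (z x) (W₁ x)]
    module
  have b4 : 0 ≤ B ^ 2 := by positivity
  have hρB : ∀ x, 0 ≤ B ^ 2 * ρ x := fun x => mul_nonneg b4 (hρ x)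
  refine ⟨fun x => cubicDeriv (u x) (z₁ x) + S x, fun x => (Q x + cubicDeriv (u x) (z₂ x)) + S₁ x,
    fun x => (Q₁ x + (V x + cubicDeriv (u x) (z₃ x))) + S₂ x, hp, (lead p2).add pS,
    (pQ.add (lead p3)).add pS₁, ?_, ?_, ?_, ?_⟩
  · intro x
    have e : cubic (z x + W x) - cubic (W x)
        = tri (u x) (z x) (u x) + tri (W x) (z x) (u x) + tri (W x) (W x) (z x) := by
      simp only [cubic_eq_tri, hu, tri_add_left, tri_add_mid, tri_add_right]
      rw [tri_comm (W x) (z x) (W x), tri_comm (W x) (z x) (z x)]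
      abel
    have h1 := (Dom.tri_mid hB0 zero_le_one hρ bu dz bu).le x
    have h2 := (Dom.tri_mid hB0 zero_le_one hρ bW dz bu).le x
    have h3 := (Dom.tri_right hB0 zero_le_one hρ bW bW dz).le x
    rw [e]
    refine ((norm_add_le _ _).trans (add_le_add ((norm_add_le _ _).trans (add_le_add h1 h2))
      h3)).trans ?_
    have := hρB x
    nlinarith
  · intro x
    refine (norm_add_le _ _).trans ((add_le_add (blead dz₁.of_succ x) (dS0 x)).trans ?_)
    have := hρB x
    nlinarith
  · intro x
    refine ((norm_add_le _ _).trans (add_le_add ((norm_add_le _ _).trans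
      (add_le_add (dQ0 x) (blead dz₂ x))) (dS₁0 x))).trans ?_
    have := hρB x
    nlinarith
  · intro x
    have e : (Q₁ x + (V x + cubicDeriv (u x) (z₃ x))) + S₂ x - cubicDeriv (z x + W x) (z₃ x)
        = Q₁ x + V x + S₂ x := by
      simp only [hu]; abel
    rw [e]
    refine ((norm_add_le _ _).trans (add_le_add ((norm_add_le _ _).trans
      (add_le_add (dQ₁ x) (dV x))) (dS₂ x))).trans ?_
    have := hρB x
    nlinarith

end Trilinear

/-! ### The residual produced by the phase modulation. -/

section Residual

variable {w : ℝ → E2} {γ γt : ℝ → ℝ} {N : ℝ}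

/-- The residual of the modulated wave in the Lugiato-Lefever system. -/
def residual (β : ℝ) (w : ℝ → E2) (γ γt : ℝ → ℝ) (x : ℝ) : E2 :=
  γt x • modul w γ 1 x
    + β • J ((2 * iteratedDeriv 1 γ x + iteratedDeriv 1 γ x ^ 2) • modul w γ 2 x
      + iteratedDeriv 2 γ x • modul w γ 1 x)

/-- The bound for the residual. -/
def residualConst (β N : ℝ) : ℝ :=
  8 * modulConst N + |β| * (8 * (modulConst N * (8 * (1 + N))) + 8 * modulConst N)

lemma modulConst_nonneg (hN : 0 ≤ N) : 0 ≤ modulConst N := by unfold modulConst; positivity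

/-- Every summand has a factor `γ_t`, `γ_x` or `γ_xx`, which is dominated by `ρ`, times a bounded
derivative of `w`. Three further derivatives reach order five in `γ`, from `γ_xx`, and order five in
`w`. -/
lemma dom_residual (β : ℝ) (hN : 0 ≤ N) (hw : IterAbsCont 6 w) (hγ : IterAbsCont 5 γ)
    (hγt : IterAbsCont 3 γt)
    (hwN : ∀ j ≤ 5, ∀ x, ‖iteratedDeriv j w x‖ ≤ N)
    (hγN : ∀ j, 1 ≤ j → j ≤ 3 → ∀ x, |iteratedDeriv j γ x| ≤ N) {ρ : ℝ → ℝ}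
    (hρ : ∀ x, 0 ≤ ρ x) (hγρ : ∀ j, 1 ≤ j → j ≤ 5 → ∀ x, |iteratedDeriv j γ x| ≤ ρ x)
    (hγtρ : ∀ j ≤ 3, ∀ x, |iteratedDeriv j γt x| ≤ ρ x) :
    Dom 3 (residualConst β N) ρ (residual β w γ γt) := by
  have hM := modulConst_nonneg hN
  have c1 := dom_modul hN hw hγ hwN hγN (k := 1) (by norm_num)
  have c2 := dom_modul hN hw hγ hwN hγN (k := 2) (by norm_num)
  have dt : Dom 3 1 ρ γt := by
    have := Dom.of_iteratedDeriv (k := 3) (j := 0) (C := 1) (ρ := ρ) hγt (by norm_num)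
      fun i _ h x => by simpa using hγtρ i h x
    simpa using this
  have d2 : Dom 3 1 ρ (iteratedDeriv 2 γ) := Dom.of_iteratedDeriv hγ (by norm_num)
    fun i h1 h2 x => by simpa using hγρ i (by omega) h2 x
  have ha := dom_one_add_deriv hγ hγN
  have p1 : IsPrim (iteratedDeriv 1 γ) (iteratedDeriv 2 γ) :=
    isPrim_iteratedDeriv (by norm_num) hγ
  have ds : Dom 3 (8 * (1 + N)) ρ
      (fun x => 2 * iteratedDeriv 1 γ x + iteratedDeriv 1 γ x ^ 2) := by
    -- The derivative `2 (1 + γ_x) γ_xx` is written as a sum of two equal terms so that only `γ_xx`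
    -- has to be dominated and `1 + γ_x` bounded.
    refine ⟨fun x => ?_, fun x => (1 + iteratedDeriv 1 γ x) • iteratedDeriv 2 γ x
      + (1 + iteratedDeriv 1 γ x) • iteratedDeriv 2 γ x, ?_, ?_⟩
    · have h1 := hγρ 1 le_rfl (by norm_num) x
      have h2 := hγN 1 le_rfl (by norm_num) x
      have h3 := hρ x
      rw [Real.norm_eq_abs]
      calc |2 * iteratedDeriv 1 γ x + iteratedDeriv 1 γ x ^ 2|
          ≤ |2 * iteratedDeriv 1 γ x| + |iteratedDeriv 1 γ x ^ 2| := abs_add_le _ _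
        _ = 2 * |iteratedDeriv 1 γ x| + |iteratedDeriv 1 γ x| * |iteratedDeriv 1 γ x| := by
            rw [abs_mul, abs_two, sq, abs_mul]
        _ ≤ 2 * ρ x + N * ρ x := by gcongr
        _ ≤ 8 * (1 + N) * ρ x := by nlinarith [mul_nonneg hN h3]
    · have := (p1.const_smul (2 : ℝ)).add (p1.smul p1)
      simp only [smul_eq_mul] at this ⊢
      have e : (fun x => 2 * iteratedDeriv 1 γ x + iteratedDeriv 1 γ x ^ 2)
          = fun x => 2 * iteratedDeriv 1 γ x + iteratedDeriv 1 γ x * iteratedDeriv 1 γ x := by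
        funext x; ring
      rw [e]
      refine this.congr_right (Eventually.of_forall fun x => ?_)
      ring
    · have := Dom.smul' (by linarith) zero_le_one hρ ha d2.of_succ
      have h2 := this.add this
      rwa [show 2 ^ 2 * ((1 + N) * 1) + 2 ^ 2 * ((1 + N) * 1) = 8 * (1 + N) by ring] at h2
  have h1 := Dom.smul hM zero_le_one hρ dt c1
  have h2 := Dom.smul hM (by linarith) hρ ds c2
  have h3 := Dom.smul hM zero_le_one hρ d2 c1
  have h4 := (h2.add h3).clm (abs_nonneg β) (β • JL) fun x => by
    rw [_root_.smul_apply, norm_smul, JL_apply, norm_J, Real.norm_eq_abs]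
  refine ((h1.add h4).mono_const hρ (le_of_eq ?_))
  unfold residualConst
  ring

end Residual

/-! ### Cancellation, dissipation and Gronwall's inequality. -/

section EnergyInequality

/-- Young's inequality with weight `δ / 2` in both hypotheses; inserting the bound for `a₁ ^ 2` into
that for `a₂ ^ 2` leaves `a₂ ^ 2 / 4` on the right, which is absorbed. -/
lemma interpolation_aux {a₀ a₁ a₂ a₃ δ : ℝ} (hδ : 0 < δ) (hδ1 : δ ≤ 1)
    (h1 : a₁ ^ 2 ≤ a₀ * a₂) (h2 : a₂ ^ 2 ≤ a₁ * a₃) :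
    a₁ ^ 2 + a₂ ^ 2 ≤ δ * a₃ ^ 2 + a₀ ^ 2 / δ ^ 2 := by
  have e1 : a₁ ^ 2 ≤ δ / 2 * a₂ ^ 2 + 1 / (2 * δ) * a₀ ^ 2 := by
    have : a₀ * a₂ ≤ δ / 2 * a₂ ^ 2 + 1 / (2 * δ) * a₀ ^ 2 := by
      have : 0 ≤ (δ * a₂ - a₀) ^ 2 / (2 * δ) := by positivity
      have e : (δ * a₂ - a₀) ^ 2 / (2 * δ) = δ / 2 * a₂ ^ 2 + 1 / (2 * δ) * a₀ ^ 2 - a₀ * a₂ := by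
        field_simp; ring
      linarith
    linarith
  have e2 : a₂ ^ 2 ≤ δ / 2 * a₃ ^ 2 + 1 / (2 * δ) * a₁ ^ 2 := by
    have : a₁ * a₃ ≤ δ / 2 * a₃ ^ 2 + 1 / (2 * δ) * a₁ ^ 2 := by
      have : 0 ≤ (δ * a₃ - a₁) ^ 2 / (2 * δ) := by positivity
      have e : (δ * a₃ - a₁) ^ 2 / (2 * δ) = δ / 2 * a₃ ^ 2 + 1 / (2 * δ) * a₁ ^ 2 - a₁ * a₃ := by
        field_simp; ring
      linarith
    linarith
  have e3 : 1 / (2 * δ) * a₁ ^ 2 ≤ 1 / 4 * a₂ ^ 2 + 1 / (4 * δ ^ 2) * a₀ ^ 2 := by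
    have := mul_le_mul_of_nonneg_left e1 (by positivity : 0 ≤ 1 / (2 * δ))
    refine this.trans (le_of_eq ?_)
    field_simp; ring
  have e4 : 1 / (4 * δ ^ 2) * a₀ ^ 2 = a₀ ^ 2 / δ ^ 2 / 4 := by field_simp
  have e5 : 1 / (2 * δ) * a₀ ^ 2 ≤ a₀ ^ 2 / δ ^ 2 / 2 := by
    rw [show 1 / (2 * δ) * a₀ ^ 2 = a₀ ^ 2 / δ ^ 2 / 2 * δ by field_simp]
    exact mul_le_of_le_one_right (by positivity) hδ1
  have e6 : δ / 2 * a₂ ^ 2 ≤ 1 / 2 * a₂ ^ 2 := by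
    have := sq_nonneg a₂
    nlinarith
  have e7 : 0 ≤ a₀ ^ 2 / δ ^ 2 := by positivity
  have e8 : 0 ≤ δ * a₃ ^ 2 := by positivity
  linarith

/-- Integration by parts and Cauchy–Schwarz. -/
lemma norm_sq_le_of_isGen {F F₁ F₂ : L2E} (h1 : IsGen F F₁) (h2 : IsGen F₁ F₂) :
    ‖F₁‖ ^ 2 ≤ ‖F‖ * ‖F₂‖ := by
  have h := h1.inner_add_inner h2
  rw [real_inner_self_eq_norm_sq] at h
  have := neg_le_of_abs_le (abs_real_inner_le_norm F F₂)
  linarith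

/-- The part `|u|² 𝒥h` of `𝒩'(u) h` is pointwise orthogonal to `h`. What survives is the indefinite
top order term that the energy correction is designed to cancel. -/
lemma inner_cls_cubicDeriv {u h : ℝ → E2} (hu : MemLp u ∞ volume)
    (hJu : MemLp (fun x => J (u x)) ∞ volume) (hh : MemLp h 2 volume)
    (hm : MemLp (fun x => cubicDeriv (u x) (h x)) 2 volume) :
    ⟪cls h, cls (fun x => cubicDeriv (u x) (h x))⟫_ℝ
      = 2 * ⟪mulInner u (cls h), mulInner (fun x => J (u x)) (cls h)⟫_ℝ := by
  rw [mulInner_cls hu hh, mulInner_cls hJu hh, inner_cls hh hm,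
    inner_cls (memLp_inner hu hh) (memLp_inner hJu hh), ← integral_const_mul]
  refine integral_congr_ae (Eventually.of_forall fun x => ?_)
  simp only [cubicDeriv, tri, inner_add_right, inner_smul_right, inner_J_self]
  rw [real_inner_comm (J (u x)) (h x)]
  simp
  ring

lemma norm_cubicDeriv_le {N : ℝ} {u h : E2} (hu : ‖u‖ ≤ N) :
    ‖cubicDeriv u h‖ ≤ 3 * N ^ 2 * ‖h‖ := by
  have k1 := norm_tri_le u h u
  have k2 := norm_tri_le u u h
  have k3 : ‖cubicDeriv u h‖ ≤ 2 * ‖tri u h u‖ + ‖tri u u h‖ := by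
    refine (norm_add_le _ _).trans (add_le_add (le_of_eq ?_) le_rfl)
    rw [norm_smul]; norm_num
  have k5 : ‖u‖ ^ 2 * ‖h‖ ≤ N ^ 2 * ‖h‖ := by gcongr
  nlinarith

lemma aestronglyMeasurable_tri {f g h : ℝ → E2} (hf : AEStronglyMeasurable f volume)
    (hg : AEStronglyMeasurable g volume) (hh : AEStronglyMeasurable h volume) :
    AEStronglyMeasurable (fun x => tri (f x) (g x) (h x)) volume := by
  have m1 : AEStronglyMeasurable (fun x => ⟪f x, g x⟫_ℝ) volume := hf.inner hg
  have m2 : AEStronglyMeasurable (fun x => J (h x)) volume :=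
    JL.continuous.comp_aestronglyMeasurable hh
  exact m1.smul m2

lemma memLp_cubicDeriv {N : ℝ} {u ux h : ℝ → E2} (hu : IsC1Bdd N u ux) (hh : MemLp h 2 volume) :
    MemLp (fun x => cubicDeriv (u x) (h x)) 2 volume := by
  have huc : AEStronglyMeasurable u volume := hu.prim.continuous.aestronglyMeasurable
  have m1 := aestronglyMeasurable_tri huc hh.1 huc
  have m2 := aestronglyMeasurable_tri huc huc hh.1
  have m3 : AEStronglyMeasurable (fun x => cubicDeriv (u x) (h x)) volume :=
    (m1.const_smul (2 : ℝ)).add m2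
  exact hh.of_le_mul m3 (Eventually.of_forall fun x => norm_cubicDeriv_le (hu.le x))

/-- The dissipative bound for the rate of change of the modified energy. -/
lemma energyRate_le {α β N C S : ℝ} (hβ : |β| = 1)
    {u ut ux h g₃ r : ℝ → E2} (hu : IsC1Bdd N u ux)
    (hut : MemLp ut ∞ volume) (hutN : ∀ x, ‖ut x‖ ≤ N) (hh : MemLp h 2 volume)
    (hr : MemLp r 2 volume)
    (hg : ∀ x, g₃ x = cubicDeriv (u x) (h x) - h x - α • J (h x) + r x)
    {P G₂ : L2E} (hP : ‖P‖ ≤ S) (hG₂ : ‖G₂‖ ≤ C * S) (hrS : ‖cls r‖ ≤ C * S) :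
    energyRate β u ut ux P (cls h) (cls h) G₂ (cls g₃)
      ≤ -2 * ‖cls h‖ ^ 2 + (2 * C + 8 * N ^ 2) * S * ‖cls h‖
        + 4 * (N ^ 2 + N ^ 2 * C) * S ^ 2 := by
  have hN := hu.nonneg
  have hS : 0 ≤ S := (norm_nonneg _).trans hP
  have hlead := memLp_cubicDeriv hu hh
  have e : cls g₃ = cls (fun x => cubicDeriv (u x) (h x)) - cls h - α • Jop (cls h) + cls r := by
    have m1 : MemLp (fun x => α • J (h x)) 2 volume := (memLp_J hh).const_smul α
    have m2 : MemLp (fun x => cubicDeriv (u x) (h x) - h x) 2 volume := hlead.sub hh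
    have m3 : MemLp (fun x => cubicDeriv (u x) (h x) - h x - α • J (h x)) 2 volume := m2.sub m1
    rw [show g₃ = fun x => cubicDeriv (u x) (h x) - h x - α • J (h x) + r x from funext hg,
      cls_add m3 hr, cls_sub m2 m1, cls_sub hlead hh, cls_smul α (memLp_J hh), Jop_cls hh]
  have hJ0 : ⟪cls h, Jop (cls h)⟫_ℝ = 0 := by
    have := inner_Jop_left (cls h) (cls h)
    rw [real_inner_comm] at this
    linarith
  have ip : ∀ {E : Type} [NormedAddCommGroup E] [InnerProductSpace ℝ E] {x y : E} {c d : ℝ},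
      ‖x‖ ≤ c → ‖y‖ ≤ d → |⟪x, y⟫_ℝ| ≤ c * d := by
    intro E _ _ x y c d hx hy
    exact (abs_real_inner_le_norm x y).trans
      (mul_le_mul hx hy (norm_nonneg _) ((norm_nonneg _).trans hx))
  have bm : ∀ {m : ℝ → E2}, MemLp m ∞ volume → (∀ x, ‖m x‖ ≤ N) → ∀ {F : L2E} {c : ℝ}, ‖F‖ ≤ c →
      ‖mulInner m F‖ ≤ N * c := fun hm hmN _ _ hF =>
    (norm_mulInner_le hm hN hmN _).trans (mul_le_mul_of_nonneg_left hF hN)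
  have a1 := ip (le_refl ‖cls h‖) hrS
  have a2 := ip (bm hu.memLp hu.le hP) (bm hut hutN hP)
  have a3 := ip (bm hu.memLp hu.le hP) (bm hu.memLp hu.le hG₂)
  have a4 := ip (bm hu.memLp' hu.le' hP) (bm hu.J.memLp hu.J.le (le_refl ‖cls h‖))
  have a5 := ip (bm hu.memLp hu.le hP) (bm hu.J.memLp' hu.J.le' (le_refl ‖cls h‖))
  -- With `β² = 1` the term `-4β² ⟪mulInner u h, mulInner (𝒥u) h⟫` from the correction cancels
  -- exactly the one from `inner_cls_cubicDeriv`.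
  have hβ2 : β ^ 2 = 1 := by rw [← sq_abs, hβ]; norm_num
  have b1 : ∀ {x c : ℝ}, |x| ≤ c → β * x ≤ c := fun {x c} hx => by
    refine (le_abs_self _).trans ?_
    rw [abs_mul, hβ, one_mul]; exact hx
  have b2 := b1 a2
  have b3 := b1 a3
  unfold energyRate
  rw [e, hβ2, inner_add_right, inner_sub_right, inner_sub_right, inner_smul_right, hJ0,
    real_inner_self_eq_norm_sq, inner_cls_cubicDeriv hu.memLp hu.J.memLp hh hlead, inner_add_left]
  have c1 := le_of_abs_le a1
  have c4 := neg_le_of_abs_le a4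
  have c5 := neg_le_of_abs_le a5
  nlinarith

/-- Gronwall's inequality for an indefinite integral. -/
lemma gronwall_exp {t : ℝ} (ht : 0 ≤ t) {e d b : ℝ → ℝ}
    (h : ∀ s ∈ Icc 0 t, IntervalIntegrable d volume 0 s ∧ e s - e 0 = ∫ r in (0 : ℝ)..s, d r)
    (hd : ∀ s ∈ Icc 0 t, d s ≤ -e s + b s)
    (hb : IntervalIntegrable (fun s => Real.exp (-(t - s)) * b s) volume 0 t) :
    e t ≤ Real.exp (-t) * e 0 + ∫ s in (0 : ℝ)..t, Real.exp (-(t - s)) * b s := by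
  have hdt : IntegrableOn d (Icc 0 t) volume :=
    (intervalIntegrable_iff_integrableOn_Icc_of_le ht).1 (h t ⟨ht, le_rfl⟩).1
  -- Extension by zero gives a primitive on the whole line, so the product rule for `IsPrim` applies
  -- to the exponential times the energy.
  set d' : ℝ → ℝ := (Icc 0 t).indicator d
  have hi : Integrable d' volume := hdt.integrable_indicator measurableSet_Icc
  set e' : ℝ → ℝ := fun s => e 0 + ∫ r in (0 : ℝ)..s, d' r
  have hp : IsPrim e' d' := fun x y => ⟨hi.intervalIntegrable, by
    simp only [e', add_sub_add_left_eq_sub]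
    exact intervalIntegral.integral_interval_sub_left hi.intervalIntegrable hi.intervalIntegrable⟩
  have he' : ∀ s ∈ Icc 0 t, e' s = e s := by
    intro s hs
    have : ∫ r in (0 : ℝ)..s, d' r = ∫ r in (0 : ℝ)..s, d r := by
      refine intervalIntegral.integral_congr fun r hr => ?_
      rw [uIcc_of_le hs.1] at hr
      have hr' : r ∈ Icc 0 t := ⟨hr.1, hr.2.trans hs.2⟩
      exact indicator_of_mem hr' d
    simp only [e', this, ← (h s hs).2]
    ring
  have hexp : IsPrim (fun s => Real.exp (-(t - s))) (fun s => Real.exp (-(t - s))) := by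
    refine IsPrim.of_hasDerivAt (fun s => ?_) (by fun_prop)
    have h1 : HasDerivAt (fun s : ℝ => -(t - s)) 1 s := by
      exact ((hasDerivAt_id s).const_sub t).neg.congr_deriv (by norm_num)
    simpa using h1.exp
  have hm := hexp.smul hp 0 t
  simp only [smul_eq_mul] at hm
  rw [he' t ⟨ht, le_rfl⟩, he' 0 ⟨le_rfl, ht⟩] at hm
  have hle := intervalIntegral.integral_mono_on ht hm.1 hb fun s hs => by
    rw [he' s hs, show d' s = d s from indicator_of_mem hs d, ← mul_add]
    exact mul_le_mul_of_nonneg_left (by linarith [hd s hs]) (Real.exp_pos _).le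
  rw [← hm.2] at hle
  simp only [sub_self, neg_zero, Real.exp_zero, one_mul, sub_zero] at hle
  linarith

end EnergyInequality

/-! ### Inclusions of Sobolev spaces and the norms of derivatives. -/

section SpaceLemmas

variable {E : Type*} [NormedAddCommGroup E] [NormedSpace ℝ E] [CompleteSpace E]

lemma HSpace.mono {j k : ℕ} (hjk : j ≤ k) {f : ℝ → E} (hf : f ∈ HSpace k) : f ∈ HSpace j :=
  ⟨fun i hi => hf.1 i (hi.trans_le hjk), fun i hi => hf.2 i (hi.trans hjk)⟩

lemma HSpace.deriv {k : ℕ} {f : ℝ → E} (hf : f ∈ HSpace (k + 1)) : deriv f ∈ HSpace k := by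
  refine ⟨fun i hi => ?_, fun i hi => ?_⟩
  · simp only [← iteratedDeriv_succ']
    exact hf.1 (i + 1) (by omega)
  · rw [← iteratedDeriv_succ']
    exact hf.2 (i + 1) (by omega)

lemma hNorm_zero_sq {k : ℕ} {f : ℝ → E} (hf : f ∈ HSpace k) : hNorm 0 f ^ 2 = ‖cls f‖ ^ 2 := by
  rw [hNorm_sq (HSpace.mono (Nat.zero_le k) hf)]
  simp

lemma hNorm_deriv_sq {k : ℕ} {f : ℝ → E} (hf : f ∈ HSpace (k + 1)) :
    hNorm k (_root_.deriv f) ^ 2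
      = ∑ j ∈ Finset.range (k + 1), ‖cls (iteratedDeriv (j + 1) f)‖ ^ 2 := by
  rw [hNorm_sq (HSpace.deriv hf)]
  simp only [← iteratedDeriv_succ']

lemma HSpace.isH1 {k j : ℕ} (hj : j < k) {f : ℝ → E} (hf : f ∈ HSpace k) :
    IsH1 (iteratedDeriv j f) (iteratedDeriv (j + 1) f) :=
  ⟨hf.1 j hj, hf.2 j hj.le, hf.2 (j + 1) hj⟩

end SpaceLemmas

/-! ### The perturbation and its inhomogeneity at a fixed time. -/

section Snapshot

/-- The forward-modulated perturbation of `w` by `v` with phase modulation `γ`, at a fixed time. -/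
def modPert (w v : ℝ → E2) (γ : ℝ → ℝ) (x : ℝ) : E2 := (w x + v x) - w (x + γ x)

/-- The inhomogeneity in `z_t = -β 𝒥 z_xx + g` for `z = modPert w v γ`. -/
def inhom (α β : ℝ) (w v : ℝ → E2) (γ γt : ℝ → ℝ) (x : ℝ) : E2 :=
  (-(α • J (modPert w v γ x)) - modPert w v γ x
    + (cubic (modPert w v γ x + modul w γ 0 x) - cubic (modul w γ 0 x)))
    - residual β w γ γt x

/-- A function dominating the inhomogeneity up to its leading part. -/
def dominant (z : ℝ → E2) (γ γt : ℝ → ℝ) (x : ℝ) : ℝ :=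
  ∑ j ∈ Finset.range 3, ‖iteratedDeriv j z x‖ + ∑ j ∈ Finset.range 5, |iteratedDeriv (j + 1) γ x|
    + ∑ j ∈ Finset.range 4, |iteratedDeriv j γt x|

variable {w v : ℝ → E2} {γ γt : ℝ → ℝ} {N : ℝ}

lemma modPert_add_modul (x : ℝ) : modPert w v γ x + modul w γ 0 x = w x + v x := by
  simp [modPert, modul]

/-- A qualitative statement: the displacement of `w` is dominated by `γ` and its first three
derivatives, all square integrable. The size of `γ` itself is used here only for membership. -/
lemma modPert_mem_hSpace (hN : 0 ≤ N) (hv : v ∈ HSpace 3) (hw : IterAbsCont 6 w)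
    (hγ : γ ∈ HSpace 5) (hwN : ∀ j ≤ 5, ∀ x, ‖iteratedDeriv j w x‖ ≤ N)
    (hγN : ∀ j, 1 ≤ j → j ≤ 3 → ∀ x, |iteratedDeriv j γ x| ≤ N) :
    modPert w v γ ∈ HSpace 3 := by
  obtain ⟨C, hC, h⟩ := dom_modul_sub hN hw hγ.1 hwN hγN (j := 3) le_rfl
  have hd := (h 0 (by norm_num)).mem_hSpace (by norm_num)
    (memLp_finsetSum _ fun i hi => (hγ.2 i (by have := Finset.mem_range.1 hi; omega)).abs)
  have := HSpace.sub hv hd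
  have e : modPert w v γ = v - fun x => modul w γ 0 x - iteratedDeriv 0 w x := by
    funext x
    simp only [modPert, modul, iteratedDeriv_zero, Pi.sub_apply]
    abel
  rw [e]
  exact this

lemma iteratedDeriv_two_of_isPrim {E : Type*} [NormedAddCommGroup E] [NormedSpace ℝ E]
    [CompleteSpace E] {f f₁ f₂ : ℝ → E} (h1 : IsPrim f f₁) (h2 : IsPrim f₁ f₂)
    (hc : Continuous f₂) : iteratedDeriv 2 f = f₂ := by
  have e1 : deriv f = f₁ := funext fun x => (h1.hasDerivAt h2.continuous x).deriv
  rw [iteratedDeriv_succ, iteratedDeriv_one, e1]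
  exact funext fun x => (h2.hasDerivAt hc x).deriv

lemma iteratedDeriv_two_modPert (hv : IterAbsCont 3 v) (hw : IterAbsCont 6 w)
    (hγ : IterAbsCont 5 γ) (x : ℝ) :
    iteratedDeriv 2 (modPert w v γ) x = (iteratedDeriv 2 w x + iteratedDeriv 2 v x)
      - (iteratedDeriv 2 γ x • modul w γ 1 x
        + (1 + iteratedDeriv 1 γ x) • ((1 + iteratedDeriv 1 γ x) • modul w γ 2 x)) := by
  have p0 : IsPrim (fun x => w (x + γ x)) (fun x => (1 + iteratedDeriv 1 γ x) • modul w γ 1 x) := by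
    have := isPrim_modul hw hγ (k := 0) (by norm_num)
    rwa [show modul w γ 0 = fun x => w (x + γ x) by funext x; simp [modul]] at this
  have pa : IsPrim (fun x => 1 + iteratedDeriv 1 γ x) (iteratedDeriv 2 γ) := by
    have h0 : IsPrim (fun _ : ℝ => (1 : ℝ)) (fun _ => 0) := fun a b => by simp
    simpa using h0.add (isPrim_iteratedDeriv (j := 1) (by norm_num) hγ)
  have p1 := pa.smul (isPrim_modul hw hγ (k := 1) (by norm_num))
  have q0 := ((IterAbsCont.isPrim (by norm_num) hw).add (IterAbsCont.isPrim (by norm_num) hv)).sub p0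
  have q1 := ((isPrim_iteratedDeriv (j := 1) (by norm_num) hw).add
    (isPrim_iteratedDeriv (j := 1) (by norm_num) hv)).sub p1
  have hc : Continuous (fun x => (iteratedDeriv 2 w x + iteratedDeriv 2 v x)
      - (iteratedDeriv 2 γ x • modul w γ 1 x
        + (1 + iteratedDeriv 1 γ x) • ((1 + iteratedDeriv 1 γ x) • modul w γ 2 x))) := by
    have c1 := continuous_iteratedDeriv_of_iterAbsCont (j := 2) (by norm_num) hw
    have c2 := continuous_iteratedDeriv_of_iterAbsCont (j := 2) (by norm_num) hv
    have c3 := continuous_iteratedDeriv_of_iterAbsCont (j := 2) (by norm_num) hγ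
    have c4 := pa.continuous
    have c5 := (isPrim_modul hw hγ (k := 1) (by norm_num)).continuous
    have c6 := (isPrim_modul hw hγ (k := 2) (by norm_num)).continuous
    exact (c1.add c2).sub ((c3.smul c5).add (c4.smul (c4.smul c6)))
  exact congrFun (iteratedDeriv_two_of_isPrim q0 q1 hc) x

/-- Cauchy–Schwarz for finite sums: a factor 3 for the three groups and 5 for the number of terms in
the longest one. -/
lemma memLp_dominant {z : ℝ → E2} (hz : z ∈ HSpace 3) (hγ : γ ∈ HSpace 5) (hγt : γt ∈ HSpace 3) :
    MemLp (dominant z γ γt) 2 volume ∧ ‖cls (dominant z γ γt)‖ ^ 2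
      ≤ 15 * (∑ j ∈ Finset.range 3, ‖cls (iteratedDeriv j z)‖ ^ 2
        + (hNorm 4 (deriv γ) ^ 2 + hNorm 3 γt ^ 2)) := by
  have m1 : ∀ j ∈ Finset.range 3, MemLp (fun x => ‖iteratedDeriv j z x‖) 2 volume := fun j hj =>
    (hz.2 j (by have := Finset.mem_range.1 hj; omega)).norm
  have m2 : ∀ j ∈ Finset.range 5, MemLp (fun x => |iteratedDeriv (j + 1) γ x|) 2 volume :=
    fun j hj => (hγ.2 (j + 1) (by have := Finset.mem_range.1 hj; omega)).abs
  have m3 : ∀ j ∈ Finset.range 4, MemLp (fun x => |iteratedDeriv j γt x|) 2 volume := fun j hj =>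
    (hγt.2 j (by have := Finset.mem_range.1 hj; omega)).abs
  have s1 := cls_finsetSum _ m1
  have s2 := cls_finsetSum _ m2
  have s3 := cls_finsetSum _ m3
  have s12 : MemLp (fun x => ∑ j ∈ Finset.range 3, ‖iteratedDeriv j z x‖
    + ∑ j ∈ Finset.range 5, |iteratedDeriv (j + 1) γ x|) 2 volume := s1.1.add s2.1
  refine ⟨s12.add s3.1, ?_⟩
  have b1 : ‖∑ j ∈ Finset.range 3, cls (fun x => ‖iteratedDeriv j z x‖)‖
      ≤ ∑ j ∈ Finset.range 3, ‖cls (iteratedDeriv j z)‖ :=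
    (norm_sum_le _ _).trans (Finset.sum_le_sum fun j hj => norm_cls_le (m1 j hj)
      (hz.2 j (by have := Finset.mem_range.1 hj; omega)) (Eventually.of_forall fun x => by simp))
  have b2 : ‖∑ j ∈ Finset.range 5, cls (fun x => |iteratedDeriv (j + 1) γ x|)‖
      ≤ ∑ j ∈ Finset.range 5, ‖cls (iteratedDeriv (j + 1) γ)‖ :=
    (norm_sum_le _ _).trans (Finset.sum_le_sum fun j hj => norm_cls_le (m2 j hj)
      (hγ.2 (j + 1) (by have := Finset.mem_range.1 hj; omega))
      (Eventually.of_forall fun x => by simp))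
  have b3 : ‖∑ j ∈ Finset.range 4, cls (fun x => |iteratedDeriv j γt x|)‖
      ≤ ∑ j ∈ Finset.range 4, ‖cls (iteratedDeriv j γt)‖ :=
    (norm_sum_le _ _).trans (Finset.sum_le_sum fun j hj => norm_cls_le (m3 j hj)
      (hγt.2 j (by have := Finset.mem_range.1 hj; omega)) (Eventually.of_forall fun x => by simp))
  have c1 := sq_sum_le_card_mul_sum_sq (s := Finset.range 3) (f := fun j => ‖cls (iteratedDeriv j z)‖)
  have c2 := sq_sum_le_card_mul_sum_sq (s := Finset.range 5)
    (f := fun j => ‖cls (iteratedDeriv (j + 1) γ)‖)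
  have c3 := sq_sum_le_card_mul_sum_sq (s := Finset.range 4)
    (f := fun j => ‖cls (iteratedDeriv j γt)‖)
  simp only [Finset.card_range, Nat.cast_ofNat] at c1 c2 c3
  have e : cls (dominant z γ γt) = ∑ j ∈ Finset.range 3, cls (fun x => ‖iteratedDeriv j z x‖)
      + ∑ j ∈ Finset.range 5, cls (fun x => |iteratedDeriv (j + 1) γ x|)
      + ∑ j ∈ Finset.range 4, cls (fun x => |iteratedDeriv j γt x|) := by
    rw [← s1.2, ← s2.2, ← s3.2, ← cls_add s1.1 s2.1, ← cls_add s12 s3.1]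
    rfl
  have h4 : ‖cls (dominant z γ γt)‖ ≤ ∑ j ∈ Finset.range 3, ‖cls (iteratedDeriv j z)‖
      + ∑ j ∈ Finset.range 5, ‖cls (iteratedDeriv (j + 1) γ)‖
      + ∑ j ∈ Finset.range 4, ‖cls (iteratedDeriv j γt)‖ := by
    rw [e]
    exact (norm_add_le _ _).trans (add_le_add ((norm_add_le _ _).trans (add_le_add b1 b2)) b3)
  rw [hNorm_deriv_sq hγ, hNorm_sq hγt]
  set A := ∑ j ∈ Finset.range 3, ‖cls (iteratedDeriv j z)‖
  set B := ∑ j ∈ Finset.range 5, ‖cls (iteratedDeriv (j + 1) γ)‖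
  set D := ∑ j ∈ Finset.range 4, ‖cls (iteratedDeriv j γt)‖
  have n1 : 0 ≤ ∑ j ∈ Finset.range 3, ‖cls (iteratedDeriv j z)‖ ^ 2 :=
    Finset.sum_nonneg fun _ _ => by positivity
  have n3 : 0 ≤ ∑ j ∈ Finset.range 4, ‖cls (iteratedDeriv j γt)‖ ^ 2 :=
    Finset.sum_nonneg fun _ _ => by positivity
  have h5 : ‖cls (dominant z γ γt)‖ ^ 2 ≤ (A + B + D) ^ 2 := by gcongr
  have h6 : (A + B + D) ^ 2 ≤ 3 * (A ^ 2 + B ^ 2 + D ^ 2) := by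
    nlinarith [sq_nonneg (A - B), sq_nonneg (B - D), sq_nonneg (A - D)]
  have h7 : (4 : ℕ) + 1 = 5 ∧ (3 : ℕ) + 1 = 4 := ⟨rfl, rfl⟩
  rw [h7.1, h7.2]
  linarith

/-- The bound for the inhomogeneity up to its leading part. -/
lemma exists_inhom_jet (α β : ℝ) (hN : 0 ≤ N) : ∃ C, 0 ≤ C ∧ ∀ {w v : ℝ → E2} {γ γt : ℝ → ℝ},
    v ∈ HSpace 3 → IterAbsCont 6 w → γ ∈ HSpace 5 → γt ∈ HSpace 3 →
    (∀ j ≤ 5, ∀ x, ‖iteratedDeriv j w x‖ ≤ N) →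
    (∀ j, 1 ≤ j → j ≤ 3 → ∀ x, |iteratedDeriv j γ x| ≤ N) →
    (∀ j ≤ 2, ∀ x, ‖iteratedDeriv j (modPert w v γ) x‖ ≤ N) →
    ∃ g₁ g₂ g₃ r : ℝ → E2, IsPrim (inhom α β w v γ γt) g₁ ∧ IsPrim g₁ g₂ ∧ IsPrim g₂ g₃ ∧
      (∀ x, ‖inhom α β w v γ γt x‖ ≤ C * dominant (modPert w v γ) γ γt x) ∧
      (∀ x, ‖g₁ x‖ ≤ C * dominant (modPert w v γ) γ γt x) ∧
      (∀ x, ‖g₂ x‖ ≤ C * dominant (modPert w v γ) γ γt x) ∧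
      (∀ x, ‖r x‖ ≤ C * dominant (modPert w v γ) γ γt x) ∧
      ∀ x, g₃ x = cubicDeriv (w x + v x) (iteratedDeriv 3 (modPert w v γ) x)
        - iteratedDeriv 3 (modPert w v γ) x - α • J (iteratedDeriv 3 (modPert w v γ) x) + r x := by
  have hM := modulConst_nonneg hN
  -- `exists_cubic_jet` takes one bound for both `W` and `z`; that of `W` is the larger one.
  have hNM : N ≤ modulConst N := by
    have : 1 ≤ (1 + N) ^ 3 := one_le_pow₀ (by linarith)
    unfold modulConst
    nlinarith
  obtain ⟨C₁, hC₁, hcub⟩ := exists_cubic_jet hM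
  have hR : 0 ≤ residualConst β N := by
    unfold residualConst; positivity
  refine ⟨|α| + 1 + C₁ + residualConst β N, by positivity, ?_⟩
  intro w v γ γt hv hw hγ hγt hwN hγN hzN
  set z := modPert w v γ with hz
  set ρ := dominant z γ γt with hρdef
  have hzm : z ∈ HSpace 3 := modPert_mem_hSpace hN hv hw hγ hwN hγN
  have n1 : ∀ x, 0 ≤ ∑ j ∈ Finset.range 3, ‖iteratedDeriv j z x‖ := fun x =>
    Finset.sum_nonneg fun _ _ => norm_nonneg _
  have n2 : ∀ x, 0 ≤ ∑ j ∈ Finset.range 5, |iteratedDeriv (j + 1) γ x| := fun x =>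
    Finset.sum_nonneg fun _ _ => abs_nonneg _
  have n3 : ∀ x, 0 ≤ ∑ j ∈ Finset.range 4, |iteratedDeriv j γt x| := fun x =>
    Finset.sum_nonneg fun _ _ => abs_nonneg _
  have hρ : ∀ x, 0 ≤ ρ x := fun x => add_nonneg (add_nonneg (n1 x) (n2 x)) (n3 x)
  have hzρ : ∀ j ≤ 2, ∀ x, ‖iteratedDeriv j z x‖ ≤ ρ x := by
    intro j hj x
    have := Finset.single_le_sum (f := fun j => ‖iteratedDeriv j z x‖)
      (fun _ _ => norm_nonneg _) (Finset.mem_range.2 (by omega : j < 3))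
    have h2 := n2 x
    have h3 := n3 x
    simp only [hρdef, dominant]
    linarith
  have hγρ : ∀ j, 1 ≤ j → j ≤ 5 → ∀ x, |iteratedDeriv j γ x| ≤ ρ x := by
    intro j h1 hj x
    obtain ⟨i, rfl⟩ := Nat.exists_eq_add_of_le' h1
    have := Finset.single_le_sum (f := fun j => |iteratedDeriv (j + 1) γ x|)
      (fun _ _ => abs_nonneg _) (Finset.mem_range.2 (by omega : i < 5))
    have h2 := n1 x
    have h3 := n3 x
    simp only [hρdef, dominant]
    linarith
  have hγtρ : ∀ j ≤ 3, ∀ x, |iteratedDeriv j γt x| ≤ ρ x := by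
    intro j hj x
    have := Finset.single_le_sum (f := fun j => |iteratedDeriv j γt x|)
      (fun _ _ => abs_nonneg _) (Finset.mem_range.2 (by omega : j < 4))
    have h2 := n1 x
    have h3 := n2 x
    simp only [hρdef, dominant]
    linarith
  have dz : ∀ {j k : ℕ}, j + k ≤ 2 → Dom k 1 ρ (iteratedDeriv j z) := fun hjk =>
    Dom.of_iteratedDeriv hzm.1 (by omega) fun i _ h2 x => by rw [one_mul]; exact hzρ i (by omega) x
  have bz : ∀ {j k : ℕ}, j + k ≤ 2 → Dom k (modulConst N) (fun _ => 1) (iteratedDeriv j z) :=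
    fun hjk => Dom.of_iteratedDeriv hzm.1 (by omega) fun i _ h2 x => by
      rw [mul_one]; exact (hzN i (by omega) x).trans hNM
  have p : ∀ j < 3, IsPrim (iteratedDeriv j z) (iteratedDeriv (j + 1) z) := fun j hj => hzm.1 j hj
  have p0 := p 0 (by norm_num)
  have dz0 := dz (j := 0) (k := 2) (by norm_num)
  have bz0 := bz (j := 0) (k := 2) (by norm_num)
  have hz0 := hzρ 0 (by norm_num)
  simp only [iteratedDeriv_zero, zero_add] at p0 dz0 bz0 hz0
  have p1 := p 1 (by norm_num)
  have p2 := p 2 (by norm_num)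
  obtain ⟨G₁, G₂, G₃, q1, q2, q3, b0, b1, b2, b3⟩ := hcub hρ
    (dom_modul hN hw hγ.1 hwN hγN (k := 0) (by norm_num)) p0 p1 p2 bz0
    (bz (j := 1) (k := 1) (by norm_num)) dz0 (dz (j := 1) (k := 1) (by norm_num))
    (dz (j := 2) (k := 0) (by norm_num))
  obtain ⟨r0, R₁, t1, r1, R₂, t2, r2, R₃, t3, r3⟩ :=
    dom_residual β hN hw hγ.1 hγt.1 hwN hγN hρ hγρ hγtρ
  have lin : ∀ {f f' : ℝ → E2}, IsPrim f f' →
      IsPrim (fun x => -(α • J (f x)) - f x) (fun x => -(α • J (f' x)) - f' x) := fun hf =>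
    ((hf.clm JL).const_smul α).neg.sub hf
  have nlin : ∀ {f : E2} {c : ℝ}, ‖f‖ ≤ c → ‖-(α • J f) - f‖ ≤ (|α| + 1) * c := by
    intro f c hf
    refine (norm_sub_le _ _).trans ?_
    rw [norm_neg, norm_smul, norm_J, Real.norm_eq_abs, add_mul, one_mul]
    gcongr
  have comb : ∀ {a b c : E2} {x : ℝ}, ‖a‖ ≤ (|α| + 1) * ρ x → ‖b‖ ≤ C₁ * ρ x →
      ‖c‖ ≤ residualConst β N * ρ x → ‖a + b - c‖ ≤ (|α| + 1 + C₁ + residualConst β N) * ρ x := by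
    intro a b c x h1 h2 h3
    refine (norm_sub_le _ _).trans ?_
    rw [add_mul, add_mul]
    exact add_le_add ((norm_add_le _ _).trans (add_le_add h1 h2)) h3
  refine ⟨fun x => (-(α • J (iteratedDeriv 1 z x)) - iteratedDeriv 1 z x + G₁ x) - R₁ x,
    fun x => (-(α • J (iteratedDeriv 2 z x)) - iteratedDeriv 2 z x + G₂ x) - R₂ x,
    fun x => (-(α • J (iteratedDeriv 3 z x)) - iteratedDeriv 3 z x + G₃ x) - R₃ x,
    -- The remainder `r` omits everything containing the third derivative of `z`: the leading part
    -- of `G₃` and the linear terms.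
    fun x => (G₃ x - cubicDeriv (z x + modul w γ 0 x) (iteratedDeriv 3 z x)) - R₃ x,
    ((lin p0).add q1).sub t1, ((lin p1).add q2).sub t2, ((lin p2).add q3).sub t3,
    fun x => comb (nlin (hz0 x)) (b0 x) (r0 x),
    fun x => comb (nlin (hzρ 1 (by norm_num) x)) (b1 x) (r1 x),
    fun x => comb (nlin (hzρ 2 (by norm_num) x)) (b2 x) (r2 x), fun x => ?_, fun x => ?_⟩
  · have := comb (a := 0) (by
      rw [norm_zero]; exact mul_nonneg (by positivity) (hρ x)) (b3 x) (r3 x)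
    rwa [zero_add] at this
  · beta_reduce
    rw [hz, modPert_add_modul]
    abel

end Snapshot

/-! ### Bounds for `u = w + v` and the evolution equations at a fixed time. -/

section SnapshotBounds

variable {w v wt vt : ℝ → E2} {γ γt : ℝ → ℝ} {α β N : ℝ}

lemma iteratedDeriv_one_modPert (hv : IterAbsCont 3 v) (hw : IterAbsCont 6 w)
    (hγ : IterAbsCont 5 γ) (x : ℝ) :
    iteratedDeriv 1 (modPert w v γ) x = (iteratedDeriv 1 w x + iteratedDeriv 1 v x)
      - (1 + iteratedDeriv 1 γ x) • modul w γ 1 x := by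
  have p0 : IsPrim (fun x => w (x + γ x)) (fun x => (1 + iteratedDeriv 1 γ x) • modul w γ 1 x) := by
    have := isPrim_modul hw hγ (k := 0) (by norm_num)
    rwa [show modul w γ 0 = fun x => w (x + γ x) by funext x; simp [modul]] at this
  have q0 := ((IterAbsCont.isPrim (by norm_num) hw).add
    (IterAbsCont.isPrim (by norm_num) hv)).sub p0
  have c1 := continuous_iteratedDeriv_of_iterAbsCont (j := 1) (by norm_num) hw
  have c2 := continuous_iteratedDeriv_of_iterAbsCont (j := 1) (by norm_num) hv
  have c3 := continuous_iteratedDeriv_of_iterAbsCont (j := 1) (by norm_num) hγ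
  have c4 := (isPrim_modul hw hγ (k := 1) (by norm_num)).continuous
  rw [iteratedDeriv_one]
  exact (q0.hasDerivAt ((c1.add c2).sub ((continuous_const.add c3).smul c4)) x).deriv

/-- The bound for `w + v` and its first two derivatives in terms of the one for `w`, `γ_x` and the
modulated perturbation. -/
def sumConst (N : ℝ) : ℝ := N + N * N + (1 + N) * ((1 + N) * N)

/-- Because `u` is the modulated perturbation plus `w` at the modulated point, it is controlled
without any a priori bound on `v`. -/
lemma norm_iteratedDeriv_add_le (hN : 0 ≤ N) (hv : v ∈ HSpace 3) (hw : IterAbsCont 6 w)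
    (hγ : γ ∈ HSpace 5) (hwN : ∀ j ≤ 5, ∀ x, ‖iteratedDeriv j w x‖ ≤ N)
    (hγN : ∀ j, 1 ≤ j → j ≤ 3 → ∀ x, |iteratedDeriv j γ x| ≤ N)
    (hzN : ∀ j ≤ 2, ∀ x, ‖iteratedDeriv j (modPert w v γ) x‖ ≤ N) {j : ℕ} (hj : j ≤ 2) (x : ℝ) :
    ‖iteratedDeriv j w x + iteratedDeriv j v x‖ ≤ sumConst N := by
  have hW : ∀ j ≤ 2, ‖modul w γ j x‖ ≤ N := fun j hj => hwN j (by omega) _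
  have h1 : ‖(1 : ℝ) + iteratedDeriv 1 γ x‖ ≤ 1 + N :=
    (norm_add_le _ _).trans (add_le_add (by simp) (hγN 1 le_rfl (by norm_num) x))
  have hz := hzN j hj x
  unfold sumConst
  have hN2 : 0 ≤ N * N := mul_nonneg hN hN
  have hN3 : 0 ≤ N * (N * N) := mul_nonneg hN hN2
  interval_cases j
  · have e := modPert_add_modul (w := w) (v := v) (γ := γ) x
    simp only [iteratedDeriv_zero] at hz ⊢
    rw [← e]
    have := (norm_add_le (modPert w v γ x) (modul w γ 0 x)).trans
      (add_le_add hz (hW 0 (by norm_num)))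
    nlinarith
  · rw [iteratedDeriv_one_modPert hv.1 hw hγ.1 x] at hz
    have e : ‖(1 + iteratedDeriv 1 γ x) • modul w γ 1 x‖ ≤ (1 + N) * N := by
      rw [norm_smul]; exact mul_le_mul h1 (hW 1 (by norm_num)) (norm_nonneg _) (by linarith)
    have := norm_le_norm_sub_add (iteratedDeriv 1 w x + iteratedDeriv 1 v x)
      ((1 + iteratedDeriv 1 γ x) • modul w γ 1 x)
    nlinarith
  · rw [iteratedDeriv_two_modPert hv.1 hw hγ.1 x] at hz
    have e1 : ‖iteratedDeriv 2 γ x • modul w γ 1 x‖ ≤ N * N := by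
      rw [norm_smul]
      exact mul_le_mul (hγN 2 (by norm_num) (by norm_num) x) (hW 1 (by norm_num))
        (norm_nonneg _) hN
    have e2 : ‖(1 + iteratedDeriv 1 γ x) • ((1 + iteratedDeriv 1 γ x) • modul w γ 2 x)‖
        ≤ (1 + N) * ((1 + N) * N) := by
      rw [norm_smul, norm_smul]
      exact mul_le_mul h1 (mul_le_mul h1 (hW 2 le_rfl) (norm_nonneg _) (by linarith))
        (by positivity) (by linarith)
    have e3 := norm_add_le (iteratedDeriv 2 γ x • modul w γ 1 x)
      ((1 + iteratedDeriv 1 γ x) • ((1 + iteratedDeriv 1 γ x) • modul w γ 2 x))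
    have := norm_le_norm_sub_add (iteratedDeriv 2 w x + iteratedDeriv 2 v x)
      (iteratedDeriv 2 γ x • modul w γ 1 x
        + (1 + iteratedDeriv 1 γ x) • ((1 + iteratedDeriv 1 γ x) • modul w γ 2 x))
    linarith

lemma isC1Bdd_add (hv : IterAbsCont 3 v) (hw : IterAbsCont 6 w) {U : ℝ}
    (hU : ∀ j ≤ 2, ∀ x, ‖iteratedDeriv j w x + iteratedDeriv j v x‖ ≤ U) :
    IsC1Bdd U (fun x => w x + v x) (fun x => iteratedDeriv 1 w x + iteratedDeriv 1 v x) :=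
  ⟨(IterAbsCont.isPrim (by norm_num) hw).add (IterAbsCont.isPrim (by norm_num) hv),
    (continuous_iteratedDeriv_of_iterAbsCont (j := 1) (by norm_num) hw).add
      (continuous_iteratedDeriv_of_iterAbsCont (j := 1) (by norm_num) hv),
    fun x => by simpa using hU 0 (by norm_num) x, fun x => hU 1 (by norm_num) x⟩

variable {f : E2}

/-- The sum of the periodic solution and its localized perturbation solves the full system; hence
`u_t` is controlled by `u` and `u_xx` alone. -/
lemma add_time_deriv_eq (hwt : ∀ x, wt x = linOp α β w x + cubic (w x) + f)
    (hvt : ∀ x, vt x = linOp α β v x + (cubic (v x + w x) - cubic (w x))) (x : ℝ) :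
    wt x + vt x = J (-β • (iteratedDeriv 2 w x + iteratedDeriv 2 v x) - α • (w x + v x))
      - (w x + v x) + cubic (w x + v x) + f := by
  rw [hwt, hvt, add_comm (v x) (w x)]
  simp only [linOp, ← JL_apply, map_add, map_sub, map_smul]
  module

lemma norm_add_time_deriv_le (hwt : ∀ x, wt x = linOp α β w x + cubic (w x) + f)
    (hvt : ∀ x, vt x = linOp α β v x + (cubic (v x + w x) - cubic (w x))) {U : ℝ}
    (hU : ∀ j ≤ 2, ∀ x, ‖iteratedDeriv j w x + iteratedDeriv j v x‖ ≤ U) (x : ℝ) :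
    ‖wt x + vt x‖ ≤ |β| * U + |α| * U + U + U ^ 3 + ‖f‖ := by
  have h0 := hU 0 (by norm_num) x
  have h2 := hU 2 le_rfl x
  simp only [iteratedDeriv_zero] at h0
  rw [add_time_deriv_eq hwt hvt]
  refine (norm_add_le _ _).trans (add_le_add ((norm_add_le _ _).trans (add_le_add
    ((norm_sub_le _ _).trans (add_le_add ?_ h0)) ?_)) le_rfl)
  · rw [norm_J]
    refine (norm_sub_le _ _).trans ?_
    rw [norm_smul, norm_smul, norm_neg, Real.norm_eq_abs, Real.norm_eq_abs]
    gcongr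
  · rw [cubic, norm_smul, norm_J, norm_pow, norm_norm, ← pow_succ]
    gcongr

/-- The forcing `f` cancels in the difference of the equations for `u` and for `w` at `x + γ`. The
residual collects `γ_t w_x` from the time derivative and the discrepancy between `w_xx` at `x + γ`
and the second derivative of the composition. -/
lemma modPert_time_deriv_eq (hv : IterAbsCont 3 v) (hw : IterAbsCont 6 w) (hγ : IterAbsCont 5 γ)
    (hwt : ∀ x, wt x = linOp α β w x + cubic (w x) + f)
    (hvt : ∀ x, vt x = linOp α β v x + (cubic (v x + w x) - cubic (w x))) (x : ℝ) :
    vt x - (wt (x + γ x) - wt x + γt x • iteratedDeriv 1 w (x + γ x))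
      = -β • J (iteratedDeriv 2 (modPert w v γ) x) + inhom α β w v γ γt x := by
  rw [iteratedDeriv_two_modPert hv hw hγ, hwt, hwt, hvt, inhom, modPert_add_modul, residual,
    add_comm (v x) (w x)]
  simp only [linOp, modul, modPert, iteratedDeriv_zero, ← JL_apply, map_add, map_sub, map_smul]
  module

lemma norm_cls_mul_le {g : ℝ → E2} {ρ : ℝ → ℝ} {C : ℝ} (hC : 0 ≤ C)
    (hg : AEStronglyMeasurable g volume) (hρ : MemLp ρ 2 volume) (h : ∀ x, ‖g x‖ ≤ C * ρ x) :
    MemLp g 2 volume ∧ ‖cls g‖ ≤ C * ‖cls ρ‖ := by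
  have hm : MemLp g 2 volume := (hρ.const_mul C).mono' hg (Eventually.of_forall h)
  exact ⟨hm, norm_cls_le_mul hm hρ hC (Eventually.of_forall fun x => (h x).trans
    (mul_le_mul_of_nonneg_left (le_abs_self _) hC))⟩

lemma norm_iteratedDeriv_le_dominant (z : ℝ → E2) (γ γt : ℝ → ℝ) {j : ℕ} (hj : j < 3) (x : ℝ) :
    ‖iteratedDeriv j z x‖ ≤ dominant z γ γt x := by
  have h1 := Finset.single_le_sum (f := fun j => ‖iteratedDeriv j z x‖)
    (fun _ _ => norm_nonneg _) (Finset.mem_range.2 hj)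
  have h2 : 0 ≤ ∑ j ∈ Finset.range 5, |iteratedDeriv (j + 1) γ x| :=
    Finset.sum_nonneg fun _ _ => abs_nonneg _
  have h3 : 0 ≤ ∑ j ∈ Finset.range 4, |iteratedDeriv j γt x| :=
    Finset.sum_nonneg fun _ _ => abs_nonneg _
  simp only [dominant]
  linarith

end SnapshotBounds

/-! ### Absorption arguments for real numbers. -/

section Scalars

/-- The dissipation `2 b₃ ^ 2` is spent in three parts: `b₃ ^ 2` pays for `-E`, half of `b₃ ^ 2` for
Young's inequality on the cross term, and the other half for the interpolated lower derivatives; the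
choice of `δ` makes the last part fit. -/
lemma rate_le_of_bounds {D₁ D₂ U δ b₀ b₁ b₂ b₃ S Γ rate E : ℝ} (hD₂ : 0 ≤ D₂)
    (hδ : δ * (30 * (D₁ ^ 2 / 2 + D₂ + 2 * U ^ 2) + 1) = 1)
    (hE : E ≤ b₃ ^ 2 + 2 * U ^ 2 * b₂ ^ 2) (hδ0 : 0 < δ)
    (hS : S ^ 2 ≤ 15 * (b₀ ^ 2 + b₁ ^ 2 + b₂ ^ 2 + Γ)) (hΓ : 0 ≤ Γ)
    (hb : b₁ ^ 2 + b₂ ^ 2 ≤ δ * b₃ ^ 2 + b₀ ^ 2 / δ ^ 2)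
    (hrate : rate ≤ -2 * b₃ ^ 2 + D₁ * S * b₃ + D₂ * S ^ 2) :
    rate ≤ -E + 15 * (D₁ ^ 2 / 2 + D₂ + 2 * U ^ 2) * (1 + 1 / δ ^ 2) * (b₀ ^ 2 + Γ) := by
  set D₃ := D₁ ^ 2 / 2 + D₂ + 2 * U ^ 2
  have hD₃ : 0 ≤ D₃ := by positivity
  have h1 : D₁ * S * b₃ ≤ b₃ ^ 2 / 2 + D₁ ^ 2 / 2 * S ^ 2 := by nlinarith [sq_nonneg (D₁ * S - b₃)]
  have h2 : (D₁ ^ 2 / 2 + D₂) * S ^ 2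
      ≤ (D₁ ^ 2 / 2 + D₂) * (15 * (b₀ ^ 2 + b₁ ^ 2 + b₂ ^ 2 + Γ)) := by gcongr
  have h3 : 2 * U ^ 2 * b₂ ^ 2 ≤ 2 * U ^ 2 * (15 * (b₀ ^ 2 + b₁ ^ 2 + b₂ ^ 2 + Γ)) := by
    gcongr; nlinarith [sq_nonneg b₀, sq_nonneg b₁, sq_nonneg b₂]
  have h4 : D₃ * (15 * (b₁ ^ 2 + b₂ ^ 2)) ≤ D₃ * (15 * (δ * b₃ ^ 2 + b₀ ^ 2 / δ ^ 2)) := by gcongr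
  have h5 : D₃ * (15 * (δ * b₃ ^ 2)) ≤ b₃ ^ 2 / 2 := by
    have : 15 * D₃ * δ ≤ 1 / 2 := by linarith
    nlinarith [sq_nonneg b₃]
  have h6 : 0 ≤ 15 * D₃ * (1 / δ ^ 2) * Γ := by positivity
  have e : 15 * D₃ * (1 + 1 / δ ^ 2) * (b₀ ^ 2 + Γ) = D₃ * (15 * (b₀ ^ 2 + Γ))
      + D₃ * (15 * (b₀ ^ 2 / δ ^ 2)) + 15 * D₃ * (1 / δ ^ 2) * Γ := by ring
  have e2 : D₃ * (15 * (b₀ ^ 2 + b₁ ^ 2 + b₂ ^ 2 + Γ))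
      = (D₁ ^ 2 / 2 + D₂) * (15 * (b₀ ^ 2 + b₁ ^ 2 + b₂ ^ 2 + Γ))
        + 2 * U ^ 2 * (15 * (b₀ ^ 2 + b₁ ^ 2 + b₂ ^ 2 + Γ)) := by
    simp only [D₃]; ring
  rw [e]
  linarith

/-- Interpolation is used twice: with `δ = 1` to remove `b₁` and `b₂` from the norm, and with `δ =
(4 * U ^ 2 + 1)⁻¹` to absorb the energy correction into half of `b₃ ^ 2`. -/
lemma sum_sq_le_of_energy {U b₀ b₁ b₂ b₃ m E : ℝ}
    (hE : b₃ ^ 2 ≤ E + 2 * U ^ 2 * b₂ ^ 2) (h1 : b₁ ^ 2 ≤ b₀ * b₂) (h2 : b₂ ^ 2 ≤ b₁ * b₃)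
    (hm : m = b₀ ^ 2 + b₁ ^ 2 + b₂ ^ 2 + b₃ ^ 2) :
    m ≤ 4 * E + (8 * U ^ 2 * (4 * U ^ 2 + 1) ^ 2 + 2) * b₀ ^ 2 := by
  have i1 := interpolation_aux one_pos le_rfl h1 h2
  have hp : 0 < 4 * U ^ 2 + 1 := by positivity
  have i2 := interpolation_aux (inv_pos.2 hp) (inv_le_one_of_one_le₀ (by nlinarith [sq_nonneg U]))
    h1 h2
  have i3 : 2 * U ^ 2 * b₂ ^ 2
      ≤ 2 * U ^ 2 * ((4 * U ^ 2 + 1)⁻¹ * b₃ ^ 2 + b₀ ^ 2 / (4 * U ^ 2 + 1)⁻¹ ^ 2) := by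
    gcongr
    linarith [sq_nonneg b₁]
  have i4 : 2 * U ^ 2 * ((4 * U ^ 2 + 1)⁻¹ * b₃ ^ 2) ≤ b₃ ^ 2 / 2 := by
    have : 2 * U ^ 2 * (4 * U ^ 2 + 1)⁻¹ ≤ 1 / 2 := by
      rw [← div_eq_mul_inv, div_le_iff₀ hp]; linarith
    nlinarith [sq_nonneg b₃]
  have e : b₀ ^ 2 / (4 * U ^ 2 + 1)⁻¹ ^ 2 = (4 * U ^ 2 + 1) ^ 2 * b₀ ^ 2 := by
    field_simp
  rw [e] at i3
  simp only [one_mul, one_pow, div_one] at i1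
  nlinarith

end Scalars

/-! ### Restriction to smaller time sets, and interpolation in `H³`. -/

section Curves

variable {E : Type*} [NormedAddCommGroup E] [NormedSpace ℝ E]

lemma ContCurve.mono {X : Set (ℝ → E)} {nX : (ℝ → E) → ℝ} {I I' : Set ℝ} {f : ℝ → ℝ → E}
    (h : ContCurve X nX I f) (hI : I' ⊆ I) : ContCurve X nX I' f := fun t ht =>
  ⟨(h t (hI ht)).1, (h t (hI ht)).2.mono_left (nhdsWithin_mono t hI)⟩

lemma C1Curve.mono {X : Set (ℝ → E)} {nX : (ℝ → E) → ℝ} {I I' : Set ℝ} {f ft : ℝ → ℝ → E}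
    (h : C1Curve X nX I f ft) (hI : I' ⊆ I) : C1Curve X nX I' f ft :=
  ⟨h.1.mono hI, h.2.1.mono hI, fun t ht =>
    (h.2.2 t (hI ht)).mono_left (nhdsWithin_mono t (sdiff_subset_sdiff_left hI))⟩

end Curves

lemma IsC1Bdd.mono {M M' : ℝ} {m m' : ℝ → E2} (h : IsC1Bdd M m m') (hM : M ≤ M') :
    IsC1Bdd M' m m' :=
  ⟨h.prim, h.cont, fun x => (h.le x).trans hM, fun x => (h.le' x).trans hM⟩

lemma le_one_add_sq (x : ℝ) : x ≤ 1 + x ^ 2 := by nlinarith [sq_nonneg (x - 1), sq_nonneg x]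

/-- Interpolation of the derivatives of a function in `H³`. -/
lemma norm_cls_interpolation {z : ℝ → E2} (hz : z ∈ HSpace 3) :
    ‖cls (iteratedDeriv 1 z)‖ ^ 2 ≤ ‖cls z‖ * ‖cls (iteratedDeriv 2 z)‖ ∧
      ‖cls (iteratedDeriv 2 z)‖ ^ 2 ≤ ‖cls (iteratedDeriv 1 z)‖ * ‖cls (iteratedDeriv 3 z)‖ := by
  have hgen : ∀ j < 3, IsGen (cls (iteratedDeriv j z)) (cls (iteratedDeriv (j + 1) z)) :=
    fun j hj => (HSpace.isH1 hj hz).isGen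
  have i1 := norm_sq_le_of_isGen (hgen 0 (by norm_num)) (hgen 1 (by norm_num))
  rw [iteratedDeriv_zero] at i1
  exact ⟨i1, norm_sq_le_of_isGen (hgen 1 (by norm_num)) (hgen 2 (by norm_num))⟩

/-! ### The energy estimate along a modulated flow. -/

section Evolution

variable {α β T : ℝ} {f : E2} {I : Set ℝ} {w wt v vt : ℝ → ℝ → E2} {γ γt : ℝ → ℝ → ℝ}

/-- The evolution equation of the modulated perturbation in `L²`. -/
lemma hasDerivWithinAt_cls_modPert (hT : 0 < T)
    (hw : C1Curve (HPerSpace T 4) (hPerNorm T 4) I w wt)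
    (hv : C1Curve (HSpace 1) (hNorm 1) I v vt) (hγ : C1Curve (HSpace 3) (hNorm 3) I γ γt)
    {s : ℝ} (hs : s ∈ I) (hw6 : IterAbsCont 6 (w s)) (hv3 : v s ∈ HSpace 3)
    (hγ5 : γ s ∈ HSpace 5)
    (hwt : ∀ x, wt s x = linOp α β (w s) x + cubic (w s x) + f)
    (hvt : ∀ x, vt s x = linOp α β (v s) x + (cubic (v s x + w s x) - cubic (w s x)))
    (hz : modPert (w s) (v s) (γ s) ∈ HSpace 3)
    (hg : MemLp (inhom α β (w s) (v s) (γ s) (γt s)) 2 volume) :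
    HasDerivWithinAt (fun s => cls (modPert (w s) (v s) (γ s)))
      (-β • Jop (cls (iteratedDeriv 2 (modPert (w s) (v s) (γ s))))
        + cls (inhom α β (w s) (v s) (γ s) (γt s))) I s := by
  obtain ⟨m, m', d⟩ := hasDerivWithinAt_cls_comp hT hw hγ hs
  have e : ∀ r ∈ I, cls (modPert (w r) (v r) (γ r))
      = cls (v r) - cls (fun x => w r (x + γ r x) - w r x) := fun r hr => by
    rw [← cls_sub (HSpace.memLp (hv.1 r hr).1) (m r hr)]
    congr 1
    funext x
    simp only [modPert]
    abel
  have e' : -β • Jop (cls (iteratedDeriv 2 (modPert (w s) (v s) (γ s))))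
      + cls (inhom α β (w s) (v s) (γ s) (γt s)) = cls (vt s)
      - cls (fun x => wt s (x + γ s x) - wt s x + γt s x • iteratedDeriv 1 (w s) (x + γ s x)) := by
    have m2 := hz.2 2 (by norm_num)
    have m3 : MemLp (fun x => -β • J (iteratedDeriv 2 (modPert (w s) (v s) (γ s)) x)) 2 volume :=
      (memLp_J m2).const_smul (-β)
    rw [Jop_cls m2, ← cls_smul _ (memLp_J m2), ← cls_add m3 hg,
      ← cls_sub (HSpace.memLp (hv.2.1 s hs).1) m']
    congr 1
    funext x
    exact (modPert_time_deriv_eq hv3.1 hw6 hγ5.1 hwt hvt x).symm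
  rw [e']
  exact ((hv.hasDerivWithinAt_cls hs).sub d).congr_of_mem e hs

/-- A periodic solution `w`, a localized perturbation `v` of it and a phase modulation `γ` on
`[0, t]`, with a priori bound `N`. -/
structure IsModFlow (α β T : ℝ) (f : E2) (N t : ℝ) (w wt v vt : ℝ → ℝ → E2)
    (γ γt : ℝ → ℝ → ℝ) : Prop where
  nonneg : 0 ≤ t
  w_curve : C1Curve (HPerSpace T 4) (hPerNorm T 4) (Icc 0 t) w wt
  v_curve : C1Curve (HSpace 1) (hNorm 1) (Icc 0 t) v vt
  γ_curve : C1Curve (HSpace 3) (hNorm 3) (Icc 0 t) γ γt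
  γ_cont : ContCurve (HSpace 5) (hNorm 5) (Icc 0 t) γ
  w_ac : ∀ s ∈ Icc 0 t, IterAbsCont 6 (w s)
  v_mem : ∀ s ∈ Icc 0 t, v s ∈ HSpace 3
  w_eq : ∀ s ∈ Icc 0 t, ∀ x, wt s x = linOp α β (w s) x + cubic (w s x) + f
  v_eq : ∀ s ∈ Icc 0 t, ∀ x,
    vt s x = linOp α β (v s) x + (cubic (v s x + w s x) - cubic (w s x))
  w_le : ∀ s ∈ Icc 0 t, ∀ j ≤ 5, ∀ x, ‖iteratedDeriv j (w s) x‖ ≤ N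
  γ_le : ∀ s ∈ Icc 0 t, ∀ j, 1 ≤ j → j ≤ 3 → ∀ x, |iteratedDeriv j (γ s) x| ≤ N
  -- The factor 2 is the Sobolev constant, so that `N` also bounds the derivatives of order at most
  -- two pointwise.
  pert_le : ∀ s ∈ Icc 0 t, 2 * hNorm 3 (modPert (w s) (v s) (γ s)) ≤ N

namespace IsModFlow

variable {N t : ℝ}

lemma pert_mem (h : IsModFlow α β T f N t w wt v vt γ γt) (hN : 0 ≤ N) {s : ℝ}
    (hs : s ∈ Icc 0 t) : modPert (w s) (v s) (γ s) ∈ HSpace 3 :=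
  modPert_mem_hSpace hN (h.v_mem s hs) (h.w_ac s hs) (h.γ_cont s hs).1 (h.w_le s hs) (h.γ_le s hs)

lemma norm_pert_le (h : IsModFlow α β T f N t w wt v vt γ γt) (hN : 0 ≤ N) {s : ℝ}
    (hs : s ∈ Icc 0 t) {j : ℕ} (hj : j ≤ 2) (x : ℝ) :
    ‖iteratedDeriv j (modPert (w s) (v s) (γ s)) x‖ ≤ N :=
  (HSpace.norm_iteratedDeriv_le (by omega) (h.pert_mem hN hs) x).trans (h.pert_le s hs)

lemma norm_cls_pert_le (h : IsModFlow α β T f N t w wt v vt γ γt) (hN : 0 ≤ N) {s : ℝ}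
    (hs : s ∈ Icc 0 t) {j : ℕ} (hj : j ≤ 3) :
    ‖cls (iteratedDeriv j (modPert (w s) (v s) (γ s)))‖ ≤ N := by
  have h1 := norm_cls_iteratedDeriv_le hj (h.pert_mem hN hs)
  have h2 := h.pert_le s hs
  have h3 := norm_nonneg (cls (iteratedDeriv j (modPert (w s) (v s) (γ s))))
  linarith

/-- The norms are finite sums of squared norms of `L²` curves that are continuous in time; this
yields integrability of the source and its boundedness on `[0, t]`. -/
lemma continuousOn_source (h : IsModFlow α β T f N t w wt v vt γ γt) :
    ContinuousOn (fun s => hNorm 4 (deriv (γ s)) ^ 2 + hNorm 3 (γt s) ^ 2) (Icc 0 t) := by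
  have c1 : ContinuousOn (fun s => ∑ j ∈ Finset.range (4 + 1),
      ‖cls (iteratedDeriv (j + 1) (γ s))‖ ^ 2) (Icc 0 t) := continuousOn_finsetSum _ fun j hj =>
    (ContCurve.continuousOn_cls (by have := Finset.mem_range.1 hj; omega) h.γ_cont).norm.pow 2
  have c2 : ContinuousOn (fun s => ∑ j ∈ Finset.range (3 + 1),
      ‖cls (iteratedDeriv j (γt s))‖ ^ 2) (Icc 0 t) := continuousOn_finsetSum _ fun j hj =>
    (ContCurve.continuousOn_cls (by have := Finset.mem_range.1 hj; omega) h.γ_curve.2.1).norm.pow 2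
  exact (c1.add c2).congr fun s hs =>
    congrArg₂ (· + ·) (hNorm_deriv_sq (h.γ_cont s hs).1) (hNorm_sq (h.γ_curve.2.1 s hs).1)

/-- The bound `R` depends on the flow. It serves only to justify the energy identity and does not
enter the final constant. -/
lemma exists_norm_cls_dominant_le (h : IsModFlow α β T f N t w wt v vt γ γt) (hN : 0 ≤ N) :
    ∃ R, 0 ≤ R ∧ ∀ s ∈ Icc 0 t, ‖cls (dominant (modPert (w s) (v s) (γ s)) (γ s) (γt s))‖ ≤ R := by
  obtain ⟨B, hB⟩ := isCompact_Icc.exists_bound_of_continuousOn h.continuousOn_source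
  have hB0 : 0 ≤ B := (norm_nonneg _).trans (hB 0 ⟨le_rfl, h.nonneg⟩)
  refine ⟨1 + 15 * (3 * N ^ 2 + B), by positivity, fun s hs => ?_⟩
  have h1 := (memLp_dominant (h.pert_mem hN hs) (h.γ_cont s hs).1 (h.γ_curve.2.1 s hs).1).2
  have h2 : ∑ j ∈ Finset.range 3, ‖cls (iteratedDeriv j (modPert (w s) (v s) (γ s)))‖ ^ 2
      ≤ 3 * N ^ 2 := by
    refine (Finset.sum_le_card_nsmul _ _ (N ^ 2) fun j hj => ?_).trans (by simp)
    have := h.norm_cls_pert_le hN hs (j := j) (by have := Finset.mem_range.1 hj; omega)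
    gcongr
  have h3 := (le_abs_self _).trans (hB s hs)
  have h4 := le_one_add_sq ‖cls (dominant (modPert (w s) (v s) (γ s)) (γ s) (γt s))‖
  linarith

end IsModFlow

/-- `U` is fixed before the flow. Bounds for `u`, `u_x`, `u_xx` come from
`norm_iteratedDeriv_add_le`, and that for `u_t` from the equation. -/
lemma exists_isC1Bdd_sum (α β T : ℝ) (f : E2) (hT : 0 < T) {N : ℝ} (hN : 0 ≤ N) :
    ∃ U, 0 ≤ U ∧ ∀ {t : ℝ} {w wt v vt : ℝ → ℝ → E2} {γ γt : ℝ → ℝ → ℝ},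
      IsModFlow α β T f N t w wt v vt γ γt → ∀ s ∈ Icc 0 t,
        IsC1Bdd U (fun x => w s x + v s x)
          (fun x => iteratedDeriv 1 (w s) x + iteratedDeriv 1 (v s) x) ∧
        MemLp (fun x => wt s x + vt s x) ∞ volume ∧ ∀ x, ‖wt s x + vt s x‖ ≤ U := by
  obtain ⟨V, hV⟩ : ∃ V, V = sumConst N := ⟨_, rfl⟩
  have hV0 : 0 ≤ V := by rw [hV]; unfold sumConst; positivity
  have hV' : 0 ≤ |β| * V + |α| * V + V + V ^ 3 + ‖f‖ := by positivity
  refine ⟨V + (|β| * V + |α| * V + V + V ^ 3 + ‖f‖), add_nonneg hV0 hV', fun h s hs => ?_⟩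
  have hb := fun j (hj : j ≤ 2) x => (norm_iteratedDeriv_add_le hN (h.v_mem s hs) (h.w_ac s hs)
    (h.γ_cont s hs).1 (h.w_le s hs) (h.γ_le s hs) (fun j hj x => h.norm_pert_le hN hs hj x)
    hj x).trans hV.ge
  exact ⟨(isC1Bdd_add (h.v_mem s hs).1 (h.w_ac s hs) hb).mono (le_add_of_nonneg_right hV'),
    (memLp_top_of_hPerSpace hT (by norm_num) (h.w_curve.2.1 s hs).1).add
      (memLp_top_of_hSpace (by norm_num) (h.v_curve.2.1 s hs).1),
    fun x => (norm_add_time_deriv_le (h.w_eq s hs) (h.v_eq s hs) hb x).trans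
      (le_add_of_nonneg_left hV0)⟩

/-- The inhomogeneity lies in `H³`, with its leading part split off. -/
lemma exists_inhom_isH1 (α β : ℝ) {N : ℝ} (hN : 0 ≤ N) : ∃ C, 0 ≤ C ∧
    ∀ {T U t : ℝ} {f : E2} {w wt v vt : ℝ → ℝ → E2} {γ γt : ℝ → ℝ → ℝ},
      IsModFlow α β T f N t w wt v vt γ γt → ∀ s ∈ Icc 0 t,
      IsC1Bdd U (fun x => w s x + v s x)
        (fun x => iteratedDeriv 1 (w s) x + iteratedDeriv 1 (v s) x) →
      ∃ g₁ g₂ g₃ r : ℝ → E2, IsH1 (inhom α β (w s) (v s) (γ s) (γt s)) g₁ ∧ IsH1 g₁ g₂ ∧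
        IsH1 g₂ g₃ ∧ MemLp r 2 volume ∧
        ‖cls g₂‖ ≤ C * ‖cls (dominant (modPert (w s) (v s) (γ s)) (γ s) (γt s))‖ ∧
        ‖cls r‖ ≤ C * ‖cls (dominant (modPert (w s) (v s) (γ s)) (γ s) (γt s))‖ ∧
        ‖cls g₃‖ ≤ (3 * U ^ 2 + 1 + |α|) * N
          + C * ‖cls (dominant (modPert (w s) (v s) (γ s)) (γ s) (γt s))‖ ∧
        ∀ x, g₃ x = cubicDeriv (w s x + v s x) (iteratedDeriv 3 (modPert (w s) (v s) (γ s)) x)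
          - iteratedDeriv 3 (modPert (w s) (v s) (γ s)) x
          - α • J (iteratedDeriv 3 (modPert (w s) (v s) (γ s)) x) + r x := by
  obtain ⟨C, hC, hjet⟩ := exists_inhom_jet α β hN
  refine ⟨C, hC, ?_⟩
  intro T U t f w wt v vt γ γt h s hs hu
  have hz := h.pert_mem hN hs
  obtain ⟨hρ, -⟩ := memLp_dominant hz (h.γ_cont s hs).1 (h.γ_curve.2.1 s hs).1
  obtain ⟨g₁, g₂, g₃, r, p₁, p₂, p₃, b₀, b₁, b₂, br, e⟩ := hjet (h.v_mem s hs) (h.w_ac s hs)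
    (h.γ_cont s hs).1 (h.γ_curve.2.1 s hs).1 (h.w_le s hs) (h.γ_le s hs)
    (fun j hj x => h.norm_pert_le hN hs hj x)
  have hz₃ := hz.2 3 le_rfl
  have hlead : MemLp (fun x => cubicDeriv (w s x + v s x)
      (iteratedDeriv 3 (modPert (w s) (v s) (γ s)) x)
      - iteratedDeriv 3 (modPert (w s) (v s) (γ s)) x
      - α • J (iteratedDeriv 3 (modPert (w s) (v s) (γ s)) x)) 2 volume :=
    ((memLp_cubicDeriv hu hz₃).sub hz₃).sub ((memLp_J hz₃).const_smul α)
  have m₀ := norm_cls_mul_le hC p₁.continuous.aestronglyMeasurable hρ b₀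
  have m₁ := norm_cls_mul_le hC p₂.continuous.aestronglyMeasurable hρ b₁
  have m₂ := norm_cls_mul_le hC p₃.continuous.aestronglyMeasurable hρ b₂
  have mr := norm_cls_mul_le hC (by
    refine (p₃.locallyIntegrable.aestronglyMeasurable.sub hlead.aestronglyMeasurable).congr
      (Eventually.of_forall fun x => ?_)
    rw [Pi.sub_apply, e x]
    exact add_sub_cancel_left _ _) hρ br
  have e₃ : g₃ = _ := funext e
  have m₃ : MemLp g₃ 2 volume := by
    rw [e₃]
    exact hlead.add mr.1
  refine ⟨g₁, g₂, g₃, r, ⟨p₁, m₀.1, m₁.1⟩, ⟨p₂, m₁.1, m₂.1⟩, ⟨p₃, m₂.1, m₃⟩, mr.1, m₂.2, mr.2, ?_, e⟩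
  have hN' := h.norm_cls_pert_le hN hs (j := 3) le_rfl
  have hc : 0 ≤ 3 * U ^ 2 + 1 + |α| := by positivity
  have hl := norm_cls_le_mul hlead hz₃ hc (Eventually.of_forall fun x => by
    rw [add_mul, add_mul, one_mul]
    refine (norm_sub_le _ _).trans (add_le_add ((norm_sub_le _ _).trans (add_le_add
      (norm_cubicDeriv_le (hu.le x)) le_rfl)) ?_)
    rw [norm_smul, norm_J, Real.norm_eq_abs])
  rw [e₃]
  exact (congrArg norm (cls_add hlead mr.1)).trans_le ((norm_add_le _ _).trans
    (add_le_add (hl.trans (mul_le_mul_of_nonneg_left hN' hc)) mr.2))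

/-- The modified energy controls the third derivative up to lower order terms and decays up to
the source terms. -/
lemma exists_energy_le (α β T : ℝ) (f : E2) (hβ : |β| = 1) (hT : 0 < T) {N : ℝ} (hN : 0 ≤ N) :
    ∃ U D, 0 ≤ D ∧ ∀ {t : ℝ} {w wt v vt : ℝ → ℝ → E2} {γ γt : ℝ → ℝ → ℝ},
      IsModFlow α β T f N t w wt v vt γ γt → ∃ E : ℝ → ℝ,
        (∀ s ∈ Icc 0 t, |E s - ‖cls (iteratedDeriv 3 (modPert (w s) (v s) (γ s)))‖ ^ 2|
          ≤ 2 * U ^ 2 * ‖cls (iteratedDeriv 2 (modPert (w s) (v s) (γ s)))‖ ^ 2) ∧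
        IntervalIntegrable (fun s => Real.exp (-(t - s)) * (‖cls (modPert (w s) (v s) (γ s))‖ ^ 2
          + (hNorm 4 (deriv (γ s)) ^ 2 + hNorm 3 (γt s) ^ 2))) volume 0 t ∧
        E t ≤ Real.exp (-t) * E 0 + D * ∫ s in (0 : ℝ)..t, Real.exp (-(t - s)) *
          (‖cls (modPert (w s) (v s) (γ s))‖ ^ 2
            + (hNorm 4 (deriv (γ s)) ^ 2 + hNorm 3 (γt s) ^ 2)) := by
  obtain ⟨C, hC, hjet⟩ := exists_inhom_isH1 α β hN
  obtain ⟨U, hU, hub⟩ := exists_isC1Bdd_sum α β T f hT hN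
  -- The coefficients of the cross term and of the quadratic term in `energyRate_le`.
  obtain ⟨D₁, hD₁⟩ : ∃ D₁, D₁ = 2 * C + 8 * U ^ 2 := ⟨_, rfl⟩
  obtain ⟨D₂, hD₂⟩ : ∃ D₂, D₂ = 4 * (U ^ 2 + U ^ 2 * C) := ⟨_, rfl⟩
  have hD₂0 : 0 ≤ D₂ := by rw [hD₂]; positivity
  obtain ⟨P, hP⟩ : ∃ P, P = D₁ ^ 2 / 2 + D₂ + 2 * U ^ 2 := ⟨_, rfl⟩
  have hP0 : 0 ≤ P := by rw [hP]; positivity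
  -- Small enough for `15 * P * δ ≤ 1 / 2`, as the absorption in `rate_le_of_bounds` requires.
  obtain ⟨δ, hδ⟩ : ∃ δ, δ = (30 * P + 1)⁻¹ := ⟨_, rfl⟩
  have hδ0 : 0 < δ := by rw [hδ]; positivity
  have hδ1 : δ ≤ 1 := hδ.trans_le (inv_le_one_of_one_le₀ (by linarith))
  have hδP : δ * (30 * P + 1) = 1 := by rw [hδ]; exact inv_mul_cancel₀ (by linarith)
  refine ⟨U, 15 * P * (1 + 1 / δ ^ 2), by positivity, ?_⟩
  intro t w wt v vt γ γt h
  obtain ⟨R, hR, hρR⟩ := h.exists_norm_cls_dominant_le hN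
  -- Choosing the derivatives as functions of time requires values for all `s`; outside `[0, t]`
  -- they are arbitrary.
  have hjet' : ∀ s, ∃ g₁ g₂ g₃ r : ℝ → E2, s ∈ Icc 0 t → _ := fun s => by
    by_cases hs : s ∈ Icc 0 t
    · obtain ⟨g₁, g₂, g₃, r, hg⟩ := hjet h s hs (hub h s hs).1
      exact ⟨g₁, g₂, g₃, r, fun _ => hg⟩
    · exact ⟨0, 0, 0, 0, fun h => absurd h hs⟩
  choose g₁ g₂ g₃ r hg using hjet'
  obtain ⟨z, hz⟩ : ∃ z : ℝ → ℝ → E2, z = fun s => modPert (w s) (v s) (γ s) := ⟨_, rfl⟩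
  have hzs : ∀ s, modPert (w s) (v s) (γ s) = z s := fun s => by rw [hz]
  have hzm := fun s (hs : s ∈ Icc 0 t) => h.pert_mem hN hs
  have hzj := fun s (hs : s ∈ Icc 0 t) j (hj : j ≤ 3) => h.norm_cls_pert_le hN hs hj
  have hρ := fun s (hs : s ∈ Icc 0 t) =>
    memLp_dominant (hzm s hs) (h.γ_cont s hs).1 (h.γ_curve.2.1 s hs).1
  have hdz := fun s (hs : s ∈ Icc 0 t) => hasDerivWithinAt_cls_modPert hT h.w_curve h.v_curve
    h.γ_curve hs (h.w_ac s hs) (h.v_mem s hs) (h.γ_cont s hs).1 (h.w_eq s hs) (h.v_eq s hs)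
    (hzm s hs) (hg s hs).1.memLp
  simp only [hzs] at hzm hzj hρ hρR hdz hg ⊢
  -- One bound for everything in `energy_identity`. It depends on the flow through `R`, which is
  -- harmless since the identity does not contain it.
  obtain ⟨M, hM⟩ : ∃ M, M = U + N + C * R + ((3 * U ^ 2 + 1 + |α|) * N + C * R) := ⟨_, rfl⟩
  have hCR : 0 ≤ C * R := by positivity
  have hlast : 0 ≤ (3 * U ^ 2 + 1 + |α|) * N + C * R := by positivity
  have hUM : U ≤ M := by linarith
  have hNM : N ≤ M := by linarith
  have hCM : ∀ s ∈ Icc 0 t, C * ‖cls (dominant (z s) (γ s) (γt s))‖ ≤ C * R := fun s hs =>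
    mul_le_mul_of_nonneg_left (hρR s hs) hC
  have hid := energy_identity (t := t) (β := β) (N := M) (Z := fun s => cls (z s)) (z₀ := z)
    (z₁ := fun s => iteratedDeriv 1 (z s)) (z₂ := fun s => iteratedDeriv 2 (z s))
    (z₃ := fun s => iteratedDeriv 3 (z s))
    (g₀ := fun s => inhom α β (w s) (v s) (γ s) (γt s)) (g₁ := g₁) (g₂ := g₂) (g₃ := g₃)
    (fun _ => rfl) (fun s hs => (hub h s hs).1.mono hUM)
    (fun s hs => ⟨(hub h s hs).2.1, fun x => ((hub h s hs).2.2 x).trans hUM⟩)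
    (fun s hs => hasDerivWithinAt_clsTop_add hT h.w_curve h.v_curve hs)
    (fun s hs => by simpa using HSpace.isH1 (by norm_num : 0 < 3) (hzm s hs))
    (fun s hs => HSpace.isH1 (by norm_num : 1 < 3) (hzm s hs))
    (fun s hs => HSpace.isH1 (by norm_num : 2 < 3) (hzm s hs))
    (fun s hs => (hg s hs).1) (fun s hs => (hg s hs).2.1) (fun s hs => (hg s hs).2.2.1) hdz
    (fun s hs => (hzj s hs 2 (by norm_num)).trans hNM)
    (fun s hs => (hzj s hs 3 le_rfl).trans hNM)
    (fun s hs => by linarith [(hg s hs).2.2.2.2.1, hCM s hs])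
    (fun s hs => by linarith [(hg s hs).2.2.2.2.2.2.1, hCM s hs])
  have hint : ∀ s ∈ Icc 0 t,
      ‖cls (iteratedDeriv 1 (z s))‖ ^ 2 ≤ ‖cls (z s)‖ * ‖cls (iteratedDeriv 2 (z s))‖ ∧
      ‖cls (iteratedDeriv 2 (z s))‖ ^ 2
        ≤ ‖cls (iteratedDeriv 1 (z s))‖ * ‖cls (iteratedDeriv 3 (z s))‖ := fun s hs =>
    norm_cls_interpolation (hzm s hs)
  -- The energy correction involves only the second derivative of `z`, so it can be handled by
  -- interpolation whatever its sign.
  have hmul : ∀ s ∈ Icc 0 t,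
      |2 * β * ‖mulInner (fun x => w s x + v s x) (cls (iteratedDeriv 2 (z s)))‖ ^ 2|
      ≤ 2 * U ^ 2 * ‖cls (iteratedDeriv 2 (z s))‖ ^ 2 := fun s hs => by
    have h1 := norm_mulInner_le (hub h s hs).1.memLp hU (hub h s hs).1.le
      (cls (iteratedDeriv 2 (z s)))
    rw [abs_mul, abs_mul, abs_two, hβ, abs_of_nonneg (by positivity), mul_one, mul_assoc,
      ← mul_pow]
    gcongr
  have hZc : ContinuousOn (fun s => cls (z s)) (Icc 0 t) := fun s hs =>
    (hdz s hs).continuousWithinAt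
  have hii : IntervalIntegrable (fun s => Real.exp (-(t - s)) * (‖cls (z s)‖ ^ 2
      + (hNorm 4 (deriv (γ s)) ^ 2 + hNorm 3 (γt s) ^ 2))) volume 0 t :=
    ((by fun_prop : Continuous fun s => Real.exp (-(t - s))).continuousOn.mul
      ((hZc.norm.pow 2).add h.continuousOn_source)).intervalIntegrable_of_Icc h.nonneg
  have hgron := gronwall_exp h.nonneg (b := fun s => 15 * P * (1 + 1 / δ ^ 2) * (‖cls (z s)‖ ^ 2
      + (hNorm 4 (deriv (γ s)) ^ 2 + hNorm 3 (γt s) ^ 2))) hid (fun s hs => by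
    rw [hP] at hδP ⊢
    refine rate_le_of_bounds (δ := δ) hD₂0 hδP ?_ hδ0 ?_ (by positivity)
      (interpolation_aux hδ0 hδ1 (hint s hs).1 (hint s hs).2)
      ((energyRate_le hβ (hub h s hs).1 (hub h s hs).2.1 (hub h s hs).2.2
        ((hzm s hs).2 3 le_rfl) (hg s hs).2.2.2.1 (hg s hs).2.2.2.2.2.2.2
        (P := cls (iteratedDeriv 2 (z s))) (S := ‖cls (dominant (z s) (γ s) (γt s))‖) ?_
        (hg s hs).2.2.2.2.1 (hg s hs).2.2.2.2.2.1).trans_eq (by rw [hD₁, hD₂]))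
    · exact add_le_add le_rfl ((le_abs_self _).trans (hmul s hs))
    · refine (hρ s hs).2.trans (le_of_eq ?_)
      simp [Finset.sum_range_succ]
    · exact norm_cls_le ((hzm s hs).2 2 (by norm_num)) (hρ s hs).1 (Eventually.of_forall fun x =>
        (norm_iteratedDeriv_le_dominant _ _ _ (by norm_num) x).trans (le_abs_self _)))
    ((hii.const_mul (15 * P * (1 + 1 / δ ^ 2))).congr fun s _ => mul_left_comm _ _ _)
  simp only [mul_left_comm (Real.exp _) (15 * P * (1 + 1 / δ ^ 2)),
    intervalIntegral.integral_const_mul] at hgron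
  exact ⟨_, fun s hs => by rw [add_sub_cancel_left]; exact hmul s hs, hii, hgron⟩

/-- The `H³` estimate for the forward-modulated perturbation under a priori bounds. -/
theorem exists_hNorm_modPert_sq_le (α β T : ℝ) (f : E2) (hβ : |β| = 1) (hT : 0 < T) {N : ℝ}
    (hN : 0 ≤ N) :
    ∃ C, 0 < C ∧ ∀ {t : ℝ} {w wt v vt : ℝ → ℝ → E2} {γ γt : ℝ → ℝ → ℝ},
      IsModFlow α β T f N t w wt v vt γ γt →
      modPert (w t) (v t) (γ t) ∈ HSpace 3 ∧
      IntervalIntegrable (fun s => Real.exp (-(t - s)) *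
        (hNorm 0 (modPert (w s) (v s) (γ s)) ^ 2
          + hNorm 4 (deriv (γ s)) ^ 2 + hNorm 3 (γt s) ^ 2)) volume 0 t ∧
      hNorm 3 (modPert (w t) (v t) (γ t)) ^ 2 ≤
        C * (Real.exp (-t) * hNorm 3 (modPert (w 0) (v 0) (γ 0)) ^ 2
          + hNorm 0 (modPert (w t) (v t) (γ t)) ^ 2
          + ∫ s in (0 : ℝ)..t, Real.exp (-(t - s)) *
            (hNorm 0 (modPert (w s) (v s) (γ s)) ^ 2
              + hNorm 4 (deriv (γ s)) ^ 2 + hNorm 3 (γt s) ^ 2)) := by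
  obtain ⟨U, D, hD, hen⟩ := exists_energy_le α β T f hβ hT hN
  -- `k₁` bounds the initial energy by the squared `H³` norm; `k₂` is the loss in `L²` when the norm
  -- is recovered from the energy.
  obtain ⟨k₁, hk₁⟩ : ∃ k₁, k₁ = 1 + 2 * U ^ 2 := ⟨_, rfl⟩
  obtain ⟨k₂, hk₂⟩ : ∃ k₂, k₂ = 8 * U ^ 2 * (4 * U ^ 2 + 1) ^ 2 + 2 := ⟨_, rfl⟩
  have hk₁0 : 0 < k₁ := by rw [hk₁]; positivity
  have hk₂0 : 0 < k₂ := by rw [hk₂]; positivity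
  refine ⟨4 * k₁ + k₂ + 4 * D, by positivity, ?_⟩
  intro t w wt v vt γ γt h
  obtain ⟨E, hE, hii, hEt⟩ := hen h
  have h0 : (0 : ℝ) ∈ Icc 0 t := ⟨le_rfl, h.nonneg⟩
  have ht : t ∈ Icc 0 t := ⟨h.nonneg, le_rfl⟩
  have hzm := fun s (hs : s ∈ Icc 0 t) => h.pert_mem hN hs
  have hcongr : ∀ s ∈ uIcc 0 t, Real.exp (-(t - s)) * (hNorm 0 (modPert (w s) (v s) (γ s)) ^ 2
      + hNorm 4 (deriv (γ s)) ^ 2 + hNorm 3 (γt s) ^ 2)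
      = Real.exp (-(t - s)) * (‖cls (modPert (w s) (v s) (γ s))‖ ^ 2
        + (hNorm 4 (deriv (γ s)) ^ 2 + hNorm 3 (γt s) ^ 2)) := fun s hs => by
    rw [uIcc_of_le h.nonneg] at hs
    rw [hNorm_zero_sq (hzm s hs), add_assoc]
  refine ⟨hzm t ht, hii.congr fun s hs => (hcongr s (uIoc_subset_uIcc hs)).symm, ?_⟩
  rw [intervalIntegral.integral_congr hcongr, hNorm_zero_sq (hzm t ht)]
  have hQ : 0 ≤ ∫ s in (0 : ℝ)..t, Real.exp (-(t - s)) *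
      (‖cls (modPert (w s) (v s) (γ s))‖ ^ 2
        + (hNorm 4 (deriv (γ s)) ^ 2 + hNorm 3 (γt s) ^ 2)) :=
    intervalIntegral.integral_nonneg h.nonneg fun s _ => by positivity
  generalize ∫ s in (0 : ℝ)..t, Real.exp (-(t - s)) * (‖cls (modPert (w s) (v s) (γ s))‖ ^ 2
    + (hNorm 4 (deriv (γ s)) ^ 2 + hNorm 3 (γt s) ^ 2)) = Q at hQ hEt ⊢
  have hE0 : E 0 ≤ k₁ * hNorm 3 (modPert (w 0) (v 0) (γ 0)) ^ 2 := by
    have h1 := le_of_abs_le (hE 0 h0)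
    have h2 : 2 * U ^ 2 * ‖cls (iteratedDeriv 2 (modPert (w 0) (v 0) (γ 0)))‖ ^ 2
        ≤ 2 * U ^ 2 * hNorm 3 (modPert (w 0) (v 0) (γ 0)) ^ 2 := by
      gcongr
      exact norm_cls_iteratedDeriv_le (by norm_num) (hzm 0 h0)
    have h3 : ‖cls (iteratedDeriv 3 (modPert (w 0) (v 0) (γ 0)))‖ ^ 2
        ≤ hNorm 3 (modPert (w 0) (v 0) (γ 0)) ^ 2 := by
      gcongr
      exact norm_cls_iteratedDeriv_le le_rfl (hzm 0 h0)
    rw [hk₁]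
    linarith
  have hfin := sum_sq_le_of_energy (U := U) (E := E t)
    (by linarith [neg_le_of_abs_le (hE t ht)]) (norm_cls_interpolation (hzm t ht)).1
    (norm_cls_interpolation (hzm t ht)).2 (m := hNorm 3 (modPert (w t) (v t) (γ t)) ^ 2) (by
      rw [hNorm_sq (hzm t ht)]
      simp [Finset.sum_range_succ])
  rw [← hk₂] at hfin
  have hexp := mul_le_mul_of_nonneg_left hE0 (Real.exp_pos (-t)).le
  rw [mul_left_comm] at hexp
  have hX : 0 ≤ Real.exp (-t) * hNorm 3 (modPert (w 0) (v 0) (γ 0)) ^ 2 := by positivity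
  have hY : 0 ≤ ‖cls (modPert (w t) (v t) (γ t))‖ ^ 2 := by positivity
  generalize Real.exp (-t) * hNorm 3 (modPert (w 0) (v 0) (γ 0)) ^ 2 = X at hX hexp ⊢
  generalize ‖cls (modPert (w t) (v t) (γ t))‖ ^ 2 = Y at hY hfin ⊢
  have hrest : 0 ≤ 4 * k₁ * (Y + Q) + k₂ * (X + Q) + 4 * D * (X + Y) := by positivity
  have e : (4 * k₁ + k₂ + 4 * D) * (X + Y + Q) = 4 * (k₁ * X + D * Q) + k₂ * Y
      + (4 * k₁ * (Y + Q) + k₂ * (X + Q) + 4 * D * (X + Y)) := by ring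
  rw [e]
  linarith

end Evolution

/-! ### The estimate for the forward-modulated perturbation. -/

/-- The forward shift by `σ` undoes the one inside `wHat`, and `φ` cancels; this is why `σ` may be
arbitrary. -/
lemma vRing_eq_modPert (φ : ℝ → E2) (σ : ℝ → ℝ) (γ : ℝ → ℝ → ℝ) (w v : ℝ → ℝ → E2) (s : ℝ) :
    vRing φ σ γ w v s = modPert (w s) (v s) (γ s) := by
  funext x
  simp only [vRing, wHat, modPert]
  rw [show x + σ s + γ s x - σ s = x + γ s x by ring]
  abel

lemma Icc_subset_timeInterval {τ : EReal} {t : ℝ} (ht : t ∈ timeInterval τ) :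
    Icc 0 t ⊆ timeInterval τ := fun _ hs =>
  ⟨hs.1, (EReal.coe_le_coe_iff.2 hs.2).trans_lt ht.2⟩

end LLE

end

theorem proposition3p8 (α β F T : ℝ) (hβ : β = 1 ∨ β = -1) (hF : 0 < F) (hT : 0 < T)
    (φ : ℝ → LLE.E2) (hφ : LLE.IsPeriodicWave α β F T φ) (K : ℝ) (hK : 0 < K) :
    ∃ C : ℝ, 0 < C ∧
      ∀ (τ : EReal) (w₀ v₀ : ℝ → LLE.E2) (w v : ℝ → ℝ → LLE.E2) (σ : ℝ → ℝ) (γ γt : ℝ → ℝ → ℝ),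
        w₀ ∈ LLE.HPerSpace T 6 → v₀ ∈ LLE.HSpace 3 →
        LLE.IsPeriodicSolution α β F T τ φ w₀ w →
        LLE.IsLocalizedSolution α β τ w v₀ v →
        LLE.IsPhaseModulation τ γ γt →
        ∀ t ∈ LLE.timeInterval τ,
          (∀ s ∈ Set.Icc 0 t,
            LLE.hPerNorm T 6 (w s - φ) + LLE.hNorm 3 (LLE.vRing φ σ γ w v s)
              + Real.sqrt (LLE.hNorm 3 (deriv (γ s)) ^ 2 + LLE.hNorm 2 (γt s) ^ 2) ≤ K) →
          LLE.vRing φ σ γ w v t ∈ LLE.HSpace 3 ∧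
          IntervalIntegrable
            (fun s => Real.exp (-(t - s)) *
              (LLE.hNorm 0 (LLE.vRing φ σ γ w v s) ^ 2
                + LLE.hNorm 4 (deriv (γ s)) ^ 2 + LLE.hNorm 3 (γt s) ^ 2)) volume 0 t ∧
          LLE.hNorm 3 (LLE.vRing φ σ γ w v t) ^ 2 ≤
            C * (Real.exp (-t) * LLE.hNorm 3 v₀ ^ 2
              + LLE.hNorm 0 (LLE.vRing φ σ γ w v t) ^ 2
              + ∫ s in (0 : ℝ)..t, Real.exp (-(t - s)) *
                  (LLE.hNorm 0 (LLE.vRing φ σ γ w v s) ^ 2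
                    + LLE.hNorm 4 (deriv (γ s)) ^ 2 + LLE.hNorm 3 (γt s) ^ 2)) := by
  open LLE in
  have hφ6 : φ ∈ HPerSpace T 6 := HPerSpace.of_contDiff hφ.smooth hφ.periodic
  have hp := perConst_nonneg hT
  have hn := hPerNorm_nonneg (E := E2) (T := T) (k := 6)
  have hpN : 0 ≤ perConst T * (K + hPerNorm T 6 φ) := mul_nonneg hp (add_nonneg hK.le (hn _))
  -- This `N` is fixed by the data: the first summand bounds `w = (w - φ) + φ` and its derivatives
  -- up to order five pointwise, and `2 * K` bounds `γ_x` and the perturbation through the embedding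
  -- on the line.
  have hN : 0 ≤ perConst T * (K + hPerNorm T 6 φ) + 2 * K := by linarith
  have hβ1 : |β| = 1 := by rcases hβ with rfl | rfl <;> simp
  obtain ⟨C, hC, key⟩ := exists_hNorm_modPert_sq_le α β T !₂[F, 0] hβ1 hT hN
  refine ⟨C, hC, fun τ w₀ v₀ w v σ γ γt _ _ hw hv hγ t ht hbd => ?_⟩
  obtain ⟨hw6, ⟨wt, hw4, hwt⟩, -⟩ := hw
  obtain ⟨hv3, ⟨vt, hv1, hvt⟩, hv0⟩ := hv
  obtain ⟨hγ5, hγ3, hγ0⟩ := hγ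
  have hI := Icc_subset_timeInterval ht
  simp only [vRing_eq_modPert] at hbd ⊢
  -- As `γ` vanishes initially, the modulation does not change the initial perturbation.
  have hz0 : modPert (w 0) (v 0) (γ 0) = v₀ := by
    funext x
    simp [modPert, hγ0, hv0]
  rw [← hz0]
  have hbd' : ∀ s ∈ Icc 0 t, hPerNorm T 6 (w s - φ) ≤ K ∧
      hNorm 3 (modPert (w s) (v s) (γ s)) ≤ K ∧ hNorm 3 (deriv (γ s)) ≤ K := fun s hs => by
    have h1 := hbd s hs
    have h2 := hn (w s - φ)
    have h3 := hNorm_nonneg (k := 3) (modPert (w s) (v s) (γ s))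
    have h4 : hNorm 3 (deriv (γ s)) ≤ √(hNorm 3 (deriv (γ s)) ^ 2 + hNorm 2 (γt s) ^ 2) :=
      Real.le_sqrt_of_sq_le (le_add_of_nonneg_right (sq_nonneg _))
    have h5 := Real.sqrt_nonneg (hNorm 3 (deriv (γ s)) ^ 2 + hNorm 2 (γt s) ^ 2)
    exact ⟨by linarith, by linarith, by linarith⟩
  refine key ⟨ht.1, hw4.mono hI, hv1.mono hI, hγ3.mono hI, hγ5.mono hI,
    fun s hs => (hw6 s (hI hs)).1.2.1, fun s hs => (hv3 s (hI hs)).1,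
    fun s hs => hwt s (hI hs), fun s hs => hvt s (hI hs), fun s hs j hj x => ?_,
    fun s hs j h1 h3 x => ?_, fun s hs => ?_⟩
  · have hws := (hw6 s (hI hs)).1
    have e := iteratedDeriv_sub_of_iterAbsCont hws.2.1 hφ6.2.1 (by omega : j < 6)
    have b1 := HPerSpace.norm_iteratedDeriv_le hT (by omega : j < 6) (HPerSpace.sub hws hφ6) x
    have b2 := HPerSpace.norm_iteratedDeriv_le hT (by omega : j < 6) hφ6 x
    rw [e] at b1
    beta_reduce at b1
    have b3 := norm_le_norm_sub_add (iteratedDeriv j (w s) x) (iteratedDeriv j φ x)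
    have b4 := mul_le_mul_of_nonneg_left (hbd' s hs).1 hp
    linarith
  · obtain ⟨i, rfl⟩ := Nat.exists_eq_add_of_le' h1
    rw [iteratedDeriv_succ', ← Real.norm_eq_abs]
    have := HSpace.norm_iteratedDeriv_le (by omega : i < 3)
      (HSpace.mono (by norm_num : 3 ≤ 4) (HSpace.deriv (hγ5 s (hI hs)).1)) x
    linarith [(hbd' s hs).2.2]
  · linarith [(hbd' s hs).2.1]
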